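/- Let $n\ge 7$ be an odd integer not divisible by $5$. Up to translation there is exactly one $4$-gon $T(5,n,\infty)\subset\mathbb{C}$ whose sides, traversed counterclockwise as vectors $I_4,I_1,I_2,I_3$, satisfy $I_4=1$ and $|\mathrm{Re}(I_3)|=\cos(\pi/n)+\cos(\pi/5)$, and whose interior angles are $\pi/n$ between $I_1$ and $I_2$, $\pi/n$ between $I_2$ and $I_3$, $\pi/2n$ between $I_3$ and $I_4$, and hence $2\pi-5\pi/2n$ between $I_4$ and $I_1$. Let $(X,\omega)=X(5,n,\infty)$ be the translation surface obtained by unfolding $P=T(5,n,\infty)$: with $G\subset O_2(\mathbb{R})$ the finite group generated by the linear parts $\sigma_s$ of the reflections in the sides $s$ of $P$, it is the disjoint union of the polygons $gP$, $g\in G$ (polygons that differ by a translation being identified by it), where for every side $s$ of $P$ the side $gs$ of $gP$ is glued by a translation to the side $g\sigma_s s$ of $g\sigma_sP$; the form $\omega$ is $dz$ on each $gP$. The affine group $\mathrm{SL}(X,\omega)\subset \mathrm{SL}_2(\mathbb{R})$ is the group of derivatives of the orientation preserving homeomorphisms of $X$ that preserve the set of zeros of $\omega$ and are affine, away from the zeros,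 in the charts obtained by integrating $\omega$. Then: (1) $\mathrm{SL}(X,\omega)$ contains $$R=\begin{pmatrix}\cos(\pi/n)&-\sin(\pi/n)\\ \sin(\pi/n)&\cos(\pi/n)\end{pmatrix}\quad\text{and}\quad T=\begin{pmatrix}1&2\,\frac{\cos(\pi/n)+\cos(\pi/5)}{\sin(\pi/n)}\\0&1\end{pmatrix}.$$ (2) The images of $R$ and $T$ in $\mathrm{PSL}_2(\mathbb{R})$ generate a Fuchsian triangle group $\Delta(5,n,\infty)$, that is, a discrete subgroup of $\mathrm{PSL}_2(\mathbb{R})$ generated by the images of matrices $M_1,M_2,M_3\in \mathrm{SL}_2(\mathbb{R})$ with $M_1M_2M_3=-1$ and traces $2\cos(\pi/5)$, $2\cos(\pi/n)$, $2$. (3) $X(5,n,\infty)$ is a Veech surface: the image of $\mathrm{SL}(X,\omega)$ in $\mathrm{PSL}_2(\mathbb{R})$ is a lattice, i.e. a discrete subgroup $\Gamma$ such that $\Gamma\backslash\mathbb{H}$ has finite hyperbolic area. -/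

import Mathlib

open Filter Topology MeasureTheory
open scoped MatrixGroups UpperHalfPlane

noncomputable section

namespace BilliardVeech

/-! ### Translation surfaces and their affine groups -/

/-- A matrix acting on `ℂ = ℝ²` (a complex number `x + iy` is the column vector `(x, y)`). -/
def matAct (A : SL(2, ℝ)) (z : ℂ) : ℂ :=
  ⟨A 0 0 * z.re + A 0 1 * z.im, A 1 0 * z.re + A 1 1 * z.im⟩

/-- A translation structure on (part of) a space `X`: a family of charts with values in `ℂ`
whose coordinate changes are locally translations. Points outside every chart are singular. -/
structure TranslationAtlas (X : Type*) [TopologicalSpace X] where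
  charts : Set (OpenPartialHomeomorph X ℂ)
  compat : ∀ e ∈ charts, ∀ e' ∈ charts, ∀ x ∈ e.source, x ∈ e'.source →
    ∃ c : ℂ, ∀ᶠ y in 𝓝 x, e' y = e y + c

variable {X : Type*} [TopologicalSpace X]

/-- A point is regular if it lies in the domain of a chart. -/
def TranslationAtlas.IsRegular (𝒜 : TranslationAtlas X) (x : X) : Prop :=
  ∃ e ∈ 𝒜.charts, x ∈ e.source

/-- `f` is an affine homeomorphism with derivative `A`: it preserves the set of regular
(equivalently, of singular) points, and in the charts it has the form `z ↦ A z + b`. -/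
def TranslationAtlas.IsAffine (𝒜 : TranslationAtlas X) (f : X ≃ₜ X) (A : SL(2, ℝ)) : Prop :=
  (∀ x, 𝒜.IsRegular (f x) ↔ 𝒜.IsRegular x) ∧
  ∀ e ∈ 𝒜.charts, ∀ e' ∈ 𝒜.charts, ∀ x ∈ e.source, f x ∈ e'.source →
    ∃ b : ℂ, ∀ᶠ y in 𝓝 x, e' (f y) = matAct A (e y) + b

theorem matAct_one (z : ℂ) : matAct 1 z = z := by
  simp [matAct]

theorem matAct_add (A : SL(2, ℝ)) (z w : ℂ) : matAct A (z + w) = matAct A z + matAct A w := by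
  apply Complex.ext <;> simp [matAct] <;> ring

theorem matAct_mul (A B : SL(2, ℝ)) (z : ℂ) : matAct (A * B) z = matAct A (matAct B z) := by
  apply Complex.ext <;>
    simp [matAct, Matrix.SpecialLinearGroup.coe_mul, Matrix.mul_apply, Fin.sum_univ_two] <;> ring

/-- The affine group of a translation surface: the subgroup of `SL(2, ℝ)` of all derivatives of
affine homeomorphisms. -/
def TranslationAtlas.affineGroup (𝒜 : TranslationAtlas X) : Subgroup SL(2, ℝ) where
  carrier := {A | ∃ f : X ≃ₜ X, 𝒜.IsAffine f A}
  one_mem' := by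
    refine ⟨Homeomorph.refl X, fun x => Iff.rfl, fun e he e' he' x hx hx' => ?_⟩
    obtain ⟨c, hc⟩ := 𝒜.compat e he e' he' x hx hx'
    exact ⟨c, hc.mono fun y hy => by simpa [matAct_one] using hy⟩
  mul_mem' := by
    rintro A B ⟨f, hf, hf'⟩ ⟨g, hg, hg'⟩
    refine ⟨g.trans f, fun x => (hf (g x)).trans (hg x), fun e he e' he' x hx hx' => ?_⟩
    obtain ⟨d, hd, hxd⟩ := (hg x).2 ⟨e, he, hx⟩
    obtain ⟨b, hb⟩ := hg' e he d hd x hx hxd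
    obtain ⟨c, hc⟩ := hf' d hd e' he' (g x) hxd hx'
    refine ⟨matAct A b + c, ?_⟩
    filter_upwards [hb, g.continuous.continuousAt.eventually hc] with y h1 h2
    change e' (f (g y)) = _
    rw [h2, h1, matAct_add, matAct_mul, add_assoc]
  inv_mem' := by
    rintro A ⟨f, hf, hf'⟩
    refine ⟨f.symm, fun x => ?_, fun e he e' he' x hx hx' => ?_⟩
    · simpa using (hf (f.symm x)).symm
    obtain ⟨b, hb⟩ := hf' e' he' e he (f.symm x) hx' (by simpa using hx)
    refine ⟨- matAct A⁻¹ b, ?_⟩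
    filter_upwards [f.symm.continuous.continuousAt.eventually hb] with y h1
    rw [f.apply_symm_apply] at h1
    rw [h1, matAct_add, ← matAct_mul, inv_mul_cancel, matAct_one, add_neg_cancel_right]

/-! ### Fuchsian groups -/

/-- The group `PSL(2, ℝ)`, with its quotient topology. -/
abbrev PSL2R : Type := Matrix.ProjectiveSpecialLinearGroup (Fin 2) ℝ

/-- The projection `SL(2, ℝ) → PSL(2, ℝ)`. -/
def toPSL : SL(2, ℝ) →* PSL2R := QuotientGroup.mk' _

/-- A Fuchsian group: a discrete subgroup of `PSL(2, ℝ)`. -/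
def IsFuchsian (Γ : Subgroup PSL2R) : Prop := DiscreteTopology Γ

/-- A lattice in `PSL(2, ℝ)`: a discrete subgroup `Γ` such that `Γ \ ℍ` has finite hyperbolic
area, i.e. some measurable set of finite hyperbolic area meets every `Γ`-orbit. -/
def IsLattice (Γ : Subgroup PSL2R) : Prop :=
  IsFuchsian Γ ∧ ∃ F : Set ℍ, MeasurableSet F ∧ volume F < ⊤ ∧
    ∀ z : ℍ, ∃ A : SL(2, ℝ), toPSL A ∈ Γ ∧ A • z ∈ F

/-- `Γ` is a Fuchsian `(m, n, ∞)`-triangle group: it is discrete and generated by elements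
`M₁, M₂, M₃` of product `1` in `PSL(2, ℝ)` and traces `± 2 cos (π/m)`, `± 2 cos (π/n)`, `± 2`.
The lifts to `SL(2, ℝ)` are normalized to have non-negative traces; their product is then `-1`
for the rotations about the vertices of a triangle with angles `π/m`, `π/n`, `0`. -/
def IsTriangleGroup (m n : ℕ) (Γ : Subgroup PSL2R) : Prop :=
  IsFuchsian Γ ∧ ∃ M₁ M₂ M₃ : SL(2, ℝ),
    M₁ * M₂ * M₃ = -1 ∧
    M₁.1.trace = 2 * Real.cos (Real.pi / m) ∧
    M₂.1.trace = 2 * Real.cos (Real.pi / n) ∧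
    M₃.1.trace = 2 ∧
    Subgroup.closure {toPSL M₁, toPSL M₂, toPSL M₃} = Γ

/-- A translation surface is a Veech surface if its projective affine group is a lattice. -/
def TranslationAtlas.IsVeech (𝒜 : TranslationAtlas X) : Prop :=
  IsLattice (𝒜.affineGroup.map toPSL)

/-! ### Unfolding a rational polygon

Throughout, `P ⊆ ℂ` is a compact polygon whose vertices, in cyclic order, are `V 0, …, V (k-1)`;
the `i`-th side is the segment from `V i` to `V (i + 1)`. -/

section Unfolding

variable {k : ℕ} [NeZero k] (P : Set ℂ) (V : Fin k → ℂ)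

/-- The linear part of the reflection in the `i`-th side. -/
def sideReflection (i : Fin k) : ℂ ≃ₗᵢ[ℝ] ℂ :=
  (Submodule.span ℝ {V (i + 1) - V i}).reflection

/-- The group generated by the linear parts of the reflections in the sides. -/
def reflectionGroup : Subgroup (ℂ ≃ₗᵢ[ℝ] ℂ) :=
  Subgroup.closure (Set.range (sideReflection V))

/-- The reflection in the `i`-th side as an element of the reflection group. -/
def sideGen (i : Fin k) : reflectionGroup V :=
  ⟨sideReflection V i, Subgroup.subset_closure ⟨i, rfl⟩⟩

/-- The disjoint union of the polygons `g P`, where `g` runs through the reflection group. The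
pair `⟨g, p⟩` stands for the point `g p` of `g P`. -/
abbrev Copies : Type := (_ : reflectionGroup V) × P

/-- The point `g p` of the plane. -/
def develop (d : Copies P V) : ℂ := d.1.1 (d.2 : ℂ)

/-- The gluing. First, for a side `s` of `P` with linear reflection `σ`, the polygon obtained from
`g P` by reflection along its side `g s` is, up to translation, `(g σ) P`, because
`σ_{g s} g = g σ g⁻¹ g = g σ`; the side `g s` of `g P` is glued to the side `g σ s` of `(g σ) P`
by a translation, which matches `g p` with `g σ p`. Second, if `g P` and `g' P` differ by a
translation, then they are identified by it (only one polygon of each translation class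
is used). -/
inductive Glue : Copies P V → Copies P V → Prop
  | side (g : reflectionGroup V) (i : Fin k) (p : P)
      (hp : (p : ℂ) ∈ segment ℝ (V i) (V (i + 1))) :
      Glue ⟨g, p⟩ ⟨g * sideGen V i, p⟩
  | translate (g g' : reflectionGroup V) (t : ℂ)
      (h : (fun z => g.1 z + t) '' P = (fun z => g'.1 z) '' P)
      (p p' : P) (hp : g.1 (p : ℂ) + t = g'.1 (p' : ℂ)) :
      Glue ⟨g, p⟩ ⟨g', p'⟩

/-- The surface obtained by unfolding the polygon. -/
abbrev Unfolding : Type := Quot (Glue P V)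

/-- The translation structure of the unfolding. Its charts are the charts obtained by
integrating the `1`-form which is `dz` on each copy `g P`: the homeomorphisms from open
sets of the surface onto open sets of `ℂ` which on each copy are locally `z ↦ z + c`. -/
def unfoldingAtlas : TranslationAtlas (Unfolding P V) where
  charts := {e | ∀ d : Copies P V, Quot.mk _ d ∈ e.source →
    ∃ c : ℂ, ∀ᶠ d' in 𝓝 d, e (Quot.mk _ d') = develop P V d' + c}
  compat := by
    intro e he e' he' x hx hx'
    refine ⟨e' x - e x, ?_⟩
    let U : Set (Unfolding P V) := {y | y ∈ e.source ∧ y ∈ e'.source ∧ e' y - e y = e' x - e x}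
    have hU : IsOpen U := by
      have hq : IsQuotientMap (Quot.mk (Glue P V)) := isQuotientMap_quot_mk
      rw [← hq.isOpen_preimage, isOpen_iff_mem_nhds]
      rintro d ⟨h1, h2, h3⟩
      obtain ⟨c, hc⟩ := he d h1
      obtain ⟨c', hc'⟩ := he' d h2
      have ho := hq.continuous.continuousAt.eventually (e.open_source.mem_nhds h1)
      have ho' := hq.continuous.continuousAt.eventually (e'.open_source.mem_nhds h2)
      have k1 := hc.self_of_nhds
      have k2 := hc'.self_of_nhds
      filter_upwards [hc, hc', ho, ho'] with d' a1 a2 a3 a4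
      refine ⟨a3, a4, ?_⟩
      rw [a1, a2, ← h3, k1, k2]
      ring
    filter_upwards [hU.mem_nhds (⟨hx, hx', rfl⟩ : x ∈ U)] with y hy
    rw [← hy.2.2]
    ring

end Unfolding

/-! ### The billiard table `T(5, n, ∞)` -/

/-- The interior angle at the vertex `V i` of a polygon whose boundary is traversed
counterclockwise is `φ` (modulo `2π`): turning the side towards `V (i + 1)` counterclockwise
by `φ` gives the direction of the side towards `V (i - 1)`. -/
def HasInteriorAngle {k : ℕ} [NeZero k] (V : Fin k → ℂ) (i : Fin k) (φ : ℝ) : Prop :=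
  V (i + 1) ≠ V i ∧
  ∃ r : ℝ, 0 < r ∧ V (i - 1) - V i = r * Complex.exp (φ * Complex.I) * (V (i + 1) - V i)

/-- `V` is the list of vertices of `T(5, n, ∞)`, counterclockwise, placed with its first vertex
at the origin. The sides are `I₄ = V 1 - V 0`, `I₁ = V 2 - V 1`, `I₂ = V 3 - V 2`,
`I₃ = V 0 - V 3`; the angle `α = π/n` is between `I₁` and `I₂`, `β = π/n` between `I₂`
and `I₃`, `γ = π/2n` between `I₃` and `I₄`, and the fourth angle `δ`, between `I₄` and `I₁`, is
reflex. -/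
structure IsTable (n : ℕ) (V : Fin 4 → ℂ) : Prop where
  vertex_zero : V 0 = 0
  side_four : V 1 - V 0 = 1
  side_three : |(V 0 - V 3).re| = Real.cos (Real.pi / n) + Real.cos (Real.pi / 5)
  angle_α : HasInteriorAngle V 2 (Real.pi / n)
  angle_β : HasInteriorAngle V 3 (Real.pi / n)
  angle_γ : HasInteriorAngle V 0 (Real.pi / (2 * n))
  angle_δ : HasInteriorAngle V 1 (2 * Real.pi - 5 * Real.pi / (2 * n))

/-- The closed region bounded by a 4-gon which is convex except possibly for a reflex angle
at `V 1`: cut along the diagonal from `V 1` to `V 3`, it is the union of two triangles. -/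
def quadRegion (V : Fin 4 → ℂ) : Set ℂ :=
  convexHull ℝ {V 0, V 1, V 3} ∪ convexHull ℝ {V 1, V 2, V 3}

/-- The translation surface obtained by unfolding the 4-gon with vertices `V`. -/
def quadSurface (V : Fin 4 → ℂ) : TranslationAtlas (Unfolding (quadRegion V) V) :=
  unfoldingAtlas (quadRegion V) V

/-- The rotation by `π/n`. -/
def matR (n : ℕ) : SL(2, ℝ) :=
  ⟨!![Real.cos (Real.pi / n), -Real.sin (Real.pi / n);
      Real.sin (Real.pi / n), Real.cos (Real.pi / n)], by
    rw [Matrix.det_fin_two_of]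
    nlinarith [Real.sin_sq_add_cos_sq (Real.pi / n)]⟩

/-- The parabolic element `T`. -/
def matT (n : ℕ) : SL(2, ℝ) :=
  ⟨!![1, 2 * ((Real.cos (Real.pi / n) + Real.cos (Real.pi / 5)) / Real.sin (Real.pi / n));
      0, 1], by
    rw [Matrix.det_fin_two_of]
    ring⟩

end BilliardVeech

end

noncomputable section

namespace BilliardVeech

/-! The unfolding is recut into five polygons in which the affine symmetries become visible. Put γ =
π/2n. The sides of the polygon with index a (`poly`, a = 0, …, 4) are normal to the odd multiples of
γ, and their half lengths alternate between h_a and h_{a+1}, where h_k (`halfSide`) is proportional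
to sin(kπ/5). Since n is odd, opposite normals are of different types. So the sides of half length
h_{a+1} of the polygon a can be glued by translations to parallel sides of the polygon a+1, and
nothing stays unglued because h_0 = h_5 = 0. The middle polygon is a regular 2n-gon of circumradius
1, the two outer ones are regular n-gons.

The vertices V 0, V 3, V 2 of the table are the centers of the polygons 2, 1, 0, and V 1 is a common
vertex of these polygons. The table is therefore a union of one sector of angle γ and two sectors of
angle 2γ (`exists_part`, `part_mem`). The reflection group is dihedral of order 4n, and the images
of the sectors reassemble into the five polygons; elements outside the subgroup `IsPos` of index two
exchange a and 4 - a. This gives mutually inverse homeomorphisms `phi` and `kappa` that are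
translations in the plane coordinates. The identification of copies that differ by a translation has
no effect, because the table has no symmetries (`table_rigid`).

The rotation R comes from left multiplication by the reflection group (`matR_mem`). For T, the
horizontal lines through the vertices cut the polygons into trapezoids, which fit in pairs into
horizontal cylinders. Such a cylinder has height 2 h_{b+1} cos(jγ) and circumference 2 d cos(jγ),
where d is the distance of the centers of the polygons b and b+1. The recursion h_b + h_{b+2} = 2
cos(π/5) h_{b+1} (`halfSide_rec`) yields d = `shear n` · h_{b+1} (`centerDist_eq`), so all cylinders
have the same modulus. The simultaneous full twist in all of them is then one affine homeomorphism,
with derivative T (`twistHomeo`, `matT_mem`).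

Discreteness rests on the absence of short closed geodesics (`exists_systole`). An affine
homeomorphism with derivative A maps the core curve of a cylinder to a closed geodesic, so the norm
of A applied to the horizontal unit vector is bounded below uniformly over the affine group
(`exists_lower_bound`). Multiplying by powers of T turns this into a gap for the lower left entry,
and conjugating by R controls the upper right entry (`eq_one_of_near_one`).

The triangle group inherits discreteness, and its trace relations amount to tr(R⁻¹T) = -2 cos(π/5).
For finite area, powers of T bring a point of the upper half plane to |Re| ≤ `shear n`/2, and there
R or R⁻¹ raises the imaginary part by a fixed factor as long as it is at most 1/2
(`exists_im_increase`). Every orbit thus meets a vertical strip above a positive height, which has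
finite area. Neither an exact fundamental domain nor the full affine group has to be determined. -/

/-! ### Trigonometry -/

/-- The angle `π / (2 n)`; all directions in the construction are multiples of it. -/
def gam (n : ℕ) : ℝ := Real.pi / (2 * n)

/-- Standing assumptions on `n`. -/
structure Good (n : ℕ) : Prop where
  seven_le : 7 ≤ n
  odd : Odd n

section

variable {n : ℕ}

theorem Good.pos (H : Good n) : (0 : ℝ) < n := by
  have := H.seven_le
  exact_mod_cast (by omega : 0 < n)

theorem Good.gam_pos (H : Good n) : 0 < gam n := by
  have := H.pos
  have := Real.pi_pos
  unfold gam
  positivity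

theorem Good.gam_mul (H : Good n) : 2 * n * gam n = Real.pi := by
  have := H.pos
  unfold gam
  field_simp

theorem Good.gam_le (H : Good n) : 14 * gam n ≤ Real.pi := by
  have h7 : (7 : ℝ) ≤ n := by exact_mod_cast H.seven_le
  have := H.gam_mul
  nlinarith [H.gam_pos]

theorem Good.two_gam (H : Good n) : 2 * gam n = Real.pi / n := by
  have := H.pos
  unfold gam
  field_simp

theorem Good.sin_pos (H : Good n) {x : ℝ} (h0 : 0 < x) (h1 : x < 2 * n) :
    0 < Real.sin (x * gam n) := by
  apply Real.sin_pos_of_pos_of_lt_pi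
  · exact mul_pos h0 H.gam_pos
  · rw [← H.gam_mul]
    exact mul_lt_mul_of_pos_right h1 H.gam_pos

theorem Good.cos_pos (H : Good n) {x : ℝ} (h0 : -n < x) (h1 : x < n) :
    0 < Real.cos (x * gam n) := by
  have := H.gam_mul
  have := H.gam_pos
  apply Real.cos_pos_of_mem_Ioo
  constructor <;> nlinarith

theorem Good.sin_one_pos (H : Good n) : 0 < Real.sin (gam n) := by
  have h := H.sin_pos (x := 1) one_pos (by have := H.seven_le; norm_cast; omega)
  rwa [one_mul] at h

theorem Good.sin_two_pos (H : Good n) : 0 < Real.sin (2 * gam n) :=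
  H.sin_pos two_pos (by have := H.seven_le; norm_cast; omega)

theorem Good.cos_one_pos (H : Good n) : 0 < Real.cos (gam n) := by
  have h := H.cos_pos (x := 1) (by linarith [H.pos]) (by have := H.seven_le; norm_cast; omega)
  rwa [one_mul] at h

theorem Good.cos_two_pos (H : Good n) : 0 < Real.cos (2 * gam n) :=
  H.cos_pos (by linarith [H.pos]) (by have := H.seven_le; norm_cast; omega)

theorem cos_add_two_n (H : Good n) (x : ℝ) :
    Real.cos ((x + 2 * n) * gam n) = - Real.cos (x * gam n) := by
  rw [show (x + 2 * n) * gam n = x * gam n + (2 * n * gam n) by ring, H.gam_mul,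
    Real.cos_add_pi]

theorem sin_add_two_n (H : Good n) (x : ℝ) :
    Real.sin ((x + 2 * n) * gam n) = - Real.sin (x * gam n) := by
  rw [show (x + 2 * n) * gam n = x * gam n + (2 * n * gam n) by ring, H.gam_mul,
    Real.sin_add_pi]

theorem cos_four_n_mul (H : Good n) (x : ℝ) (q : ℤ) :
    Real.cos ((x + 4 * n * q) * gam n) = Real.cos (x * gam n) := by
  rw [show (x + 4 * n * q) * gam n = x * gam n + q * (2 * (2 * n * gam n)) by ring, H.gam_mul,
    Real.cos_add_int_mul_two_pi]

theorem sin_four_n_mul (H : Good n) (x : ℝ) (q : ℤ) :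
    Real.sin ((x + 4 * n * q) * gam n) = Real.sin (x * gam n) := by
  rw [show (x + 4 * n * q) * gam n = x * gam n + q * (2 * (2 * n * gam n)) by ring, H.gam_mul,
    Real.sin_add_int_mul_two_pi]

/-- Among the odd multiples of `π / n`, the cosine is largest at `π / n`. -/
theorem cos_odd_le (H : Good n) (k : ℤ) :
    Real.cos ((2 * (2 * k + 1) : ℤ) * gam n) ≤ Real.cos (2 * gam n) := by
  have hn : (0 : ℤ) < 2 * n := by have := H.seven_le; omega
  set r := (2 * k + 1) % (2 * n : ℤ) with hr
  have h0 := Int.emod_nonneg (2 * k + 1) hn.ne'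
  have h1 := Int.emod_lt_of_pos (2 * k + 1) hn
  have hdiv := Int.emod_add_mul_ediv (2 * k + 1) (2 * n)
  rw [← hr] at h0 h1 hdiv
  set q := (2 * k + 1) / (2 * n : ℤ)
  have hodd : r % 2 = 1 := by
    have : r = 2 * k + 1 - 2 * (n * q) := by linarith
    omega
  have e : Real.cos ((2 * (2 * k + 1) : ℤ) * gam n) = Real.cos ((2 * r : ℝ) * gam n) := by
    rw [← cos_four_n_mul H (2 * r : ℝ) q, ← hdiv]
    push_cast
    ring_nf
  rw [e]
  have g := H.gam_pos
  have gm := H.gam_mul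
  rcases le_or_gt r n with h | h
  -- The residue r is odd, hence between 1 and 2n - 1. The cosine decreases up to r = n and is
  -- symmetric under r ↦ 2n - r, so both ends of the range give the maximum.
  · have h' : (r : ℝ) ≤ n := by exact_mod_cast h
    have h'' : (1 : ℝ) ≤ r := by exact_mod_cast (by omega : 1 ≤ r)
    apply Real.cos_le_cos_of_nonneg_of_le_pi <;> nlinarith
  · have h' : (n : ℝ) ≤ r := by exact_mod_cast h.le
    have h'' : (r : ℝ) ≤ 2 * n - 1 := by exact_mod_cast (by omega : r ≤ 2 * n - 1)
    rw [← Real.cos_two_pi_sub, ← gm]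
    apply Real.cos_le_cos_of_nonneg_of_le_pi <;> nlinarith

/-! ### Semiregular polygons -/

/-- Half the side length of the sides between the polygons `k - 1` and `k`. -/
def halfSide (n k : ℕ) : ℝ :=
  Real.sin (gam n) * Real.sin (k * (Real.pi / 5)) / Real.sin (2 * (Real.pi / 5))

theorem sin_mul_pi_div_five_pos {k : ℝ} (h0 : 0 < k) (h5 : k < 5) :
    0 < Real.sin (k * (Real.pi / 5)) := by
  apply Real.sin_pos_of_pos_of_lt_pi
  · have := Real.pi_pos
    positivity
  · nlinarith [Real.pi_pos]

theorem halfSide_zero : halfSide n 0 = 0 := by simp [halfSide]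

theorem halfSide_five : halfSide n 5 = 0 := by
  simp only [halfSide]
  rw [show ((5 : ℕ) : ℝ) * (Real.pi / 5) = Real.pi by push_cast; ring, Real.sin_pi]
  simp

/-- The constant factor in `halfSide` is chosen for this value: the middle polygon becomes the
regular 2n-gon with circumradius 1, matching the side `I₄ = 1` of the table. -/
theorem halfSide_two : halfSide n 2 = Real.sin (gam n) := by
  have := sin_mul_pi_div_five_pos (k := 2) (by norm_num) (by norm_num)
  simp only [halfSide]
  push_cast
  exact mul_div_cancel_right₀ _ this.ne'

/-- This symmetry is what allows half of the reflection group to exchange the polygons c and 4 - c.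
-/
theorem halfSide_reflect {k : ℕ} (hk : k ≤ 5) : halfSide n (5 - k) = halfSide n k := by
  simp only [halfSide]
  rw [show ((5 - k : ℕ) : ℝ) * (Real.pi / 5) = Real.pi - k * (Real.pi / 5) by
    push_cast [hk]; ring, Real.sin_pi_sub]

theorem halfSide_pos (H : Good n) {k : ℕ} (h0 : 0 < k) (h5 : k < 5) : 0 < halfSide n k := by
  have h1 := sin_mul_pi_div_five_pos (k := k) (by exact_mod_cast h0) (by exact_mod_cast h5)
  have h2 := sin_mul_pi_div_five_pos (k := 2) (by norm_num) (by norm_num)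
  have h3 := H.sin_one_pos
  unfold halfSide
  positivity

theorem halfSide_nonneg (H : Good n) {k : ℕ} (h5 : k ≤ 5) : 0 ≤ halfSide n k := by
  rcases Nat.eq_zero_or_pos k with h | h
  · rw [h, halfSide_zero]
  rcases h5.eq_or_lt with h' | h'
  · rw [h', halfSide_five]
  · exact (halfSide_pos H h h').le

/-- By the addition formula, sin(kπ/5) is an eigenvector of the path graph on four vertices with
eigenvalue 2 cos(π/5). This is the identity behind the equality of all moduli. -/
theorem halfSide_rec (k : ℕ) : halfSide n k + halfSide n (k + 2) =
    2 * Real.cos (Real.pi / 5) * halfSide n (k + 1) := by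
  have e : Real.sin (k * (Real.pi / 5)) + Real.sin ((k + 2 : ℕ) * (Real.pi / 5)) =
      2 * Real.cos (Real.pi / 5) * Real.sin ((k + 1 : ℕ) * (Real.pi / 5)) := by
    rw [show (k : ℝ) * (Real.pi / 5) = (k + 1 : ℕ) * (Real.pi / 5) - Real.pi / 5 by push_cast; ring,
      show ((k + 2 : ℕ) : ℝ) * (Real.pi / 5) = (k + 1 : ℕ) * (Real.pi / 5) + Real.pi / 5 by
        push_cast; ring, Real.sin_sub, Real.sin_add]
    ring
  unfold halfSide
  rw [← add_div, ← mul_add, e]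
  ring

/-- Half the length of the side of the polygon `a` with outer normal of angle `j π / (2 n)`. -/
def hl (n a : ℕ) (j : ℤ) : ℝ := if j % 4 = 3 then halfSide n (a + 1) else halfSide n a

/-- The distance from the center to the side with outer normal of angle `j π / (2 n)`. -/
def apo (n a : ℕ) (j : ℤ) : ℝ :=
  (hl n a j * Real.cos (2 * gam n) + hl n a (j + 2)) / Real.sin (2 * gam n)

/-- The scalar product with the unit vector of angle `j π / (2 n)`. -/
def ip (n : ℕ) (j : ℤ) (z : ℂ) : ℝ := z.re * Real.cos (j * gam n) + z.im * Real.sin (j * gam n)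

/-- The unit vector of angle `x π / (2 n)`. -/
def uvec (n : ℕ) (x : ℝ) : ℂ := ⟨Real.cos (x * gam n), Real.sin (x * gam n)⟩

@[simp] theorem uvec_re (x : ℝ) : (uvec n x).re = Real.cos (x * gam n) := rfl
@[simp] theorem uvec_im (x : ℝ) : (uvec n x).im = Real.sin (x * gam n) := rfl

/-- The semiregular polygon with index `a`. -/
def poly (n a : ℕ) : Set ℂ := {z | ∀ k : ℤ, ip n (2 * k + 1) z ≤ apo n a (2 * k + 1)}

theorem hl_congr {a : ℕ} {i j : ℤ} (h : i % 4 = j % 4) : hl n a i = hl n a j := by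
  simp [hl, h]

theorem apo_congr {a : ℕ} {i j : ℤ} (h : i % 4 = j % 4) : apo n a i = apo n a j := by
  simp only [apo]
  rw [hl_congr h, hl_congr (by omega : (i + 2) % 4 = (j + 2) % 4)]

theorem hl_nonneg (H : Good n) {a : ℕ} (ha : a < 5) (j : ℤ) : 0 ≤ hl n a j := by
  unfold hl
  split_ifs
  · exact halfSide_nonneg H (by omega)
  · exact halfSide_nonneg H (by omega)

theorem ip_congr (H : Good n) {i j : ℤ} {q : ℤ} (h : i = j + 4 * n * q) (z : ℂ) :
    ip n i z = ip n j z := by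
  subst h
  simp only [ip]
  push_cast
  rw [cos_four_n_mul H, sin_four_n_mul H]

/-- The right side is the scalar product of the end point of side j with the next normal. The
identity says that neighbouring sides meet at a common vertex. -/
theorem apo_add_two (H : Good n) (a : ℕ) (j : ℤ) :
    apo n a (j + 2) = apo n a j * Real.cos (2 * gam n) + hl n a j * Real.sin (2 * gam n) := by
  have h := H.sin_two_pos
  simp only [apo]
  rw [show j + 2 + 2 = j + 4 by ring, hl_congr (by omega : (j + 4) % 4 = j % 4)]
  have := Real.sin_sq_add_cos_sq (2 * gam n)
  field_simp
  linear_combination (hl n a j) * (-this)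

theorem apo_sub_two (H : Good n) (a : ℕ) (j : ℤ) :
    apo n a (j - 2) = apo n a j * Real.cos (2 * gam n) + hl n a j * Real.sin (2 * gam n) := by
  rw [← apo_add_two H]
  exact apo_congr (by omega)

theorem ip_add_two (j : ℤ) (z : ℂ) : ip n (j + 2) z =
    ip n j z * Real.cos (2 * gam n) +
      (z.im * Real.cos (j * gam n) - z.re * Real.sin (j * gam n)) * Real.sin (2 * gam n) := by
  simp only [ip]
  push_cast
  rw [add_mul, Real.cos_add, Real.sin_add]
  ring

theorem ip_sub_two (j : ℤ) (z : ℂ) : ip n (j - 2) z =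
    ip n j z * Real.cos (2 * gam n) -
      (z.im * Real.cos (j * gam n) - z.re * Real.sin (j * gam n)) * Real.sin (2 * gam n) := by
  simp only [ip]
  push_cast
  rw [sub_mul, Real.cos_sub, Real.sin_sub]
  ring

theorem poly_le {a : ℕ} {z : ℂ} (hz : z ∈ poly n a) {j : ℤ} (hj : j % 2 = 1) :
    ip n j z ≤ apo n a j := by
  have := hz ((j - 1) / 2)
  rwa [show 2 * ((j - 1) / 2) + 1 = j by omega] at this

/-- A point of a polygon on the line that carries a side belongs to the side. -/
theorem abs_le_hl (H : Good n) {a : ℕ} {z : ℂ} (hz : z ∈ poly n a) {j : ℤ} (hj : j % 2 = 1)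
    (h : ip n j z = apo n a j) :
    |z.im * Real.cos (j * gam n) - z.re * Real.sin (j * gam n)| ≤ hl n a j := by
  have h1 := poly_le hz (j := j + 2) (by omega)
  have h2 := poly_le hz (j := j - 2) (by omega)
  rw [ip_add_two, apo_add_two H, h] at h1
  rw [ip_sub_two, apo_sub_two H, h] at h2
  have hs := H.sin_two_pos
  rw [abs_le]
  constructor <;> nlinarith

theorem ip_side (j i : ℤ) (m u : ℝ) :
    ip n i ⟨m * Real.cos (j * gam n) - u * Real.sin (j * gam n),
      m * Real.sin (j * gam n) + u * Real.cos (j * gam n)⟩ =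
    m * Real.cos ((i - j : ℤ) * gam n) + u * Real.sin ((i - j : ℤ) * gam n) := by
  simp only [ip]
  push_cast
  rw [sub_mul (i : ℝ), Real.cos_sub, Real.sin_sub]
  ring

/-- Substituting the formula for `apo` turns the left side into a combination of the two half
lengths with cosines at consecutive multiples of 2γ. One of these multiples is odd, so its cosine is
at most cos 2γ by `cos_odd_le`; the other is bounded by 1. That bound is exactly the apothem on the
right. -/
theorem apo_bound (H : Good n) {a : ℕ} (ha : a < 5) (j k : ℤ) :
    apo n a j * Real.cos ((2 * k : ℤ) * gam n) + hl n a j * Real.sin ((2 * k : ℤ) * gam n)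
      ≤ apo n a (j + 2 * k) := by
  have hs := H.sin_two_pos
  have h1 := hl_nonneg H ha j
  have h2 := hl_nonneg H ha (j + 2)
  have e : apo n a j * Real.cos ((2 * k : ℤ) * gam n) + hl n a j * Real.sin ((2 * k : ℤ) * gam n) =
      (hl n a j * Real.cos ((2 * (k - 1) : ℤ) * gam n) +
        hl n a (j + 2) * Real.cos ((2 * k : ℤ) * gam n)) / Real.sin (2 * gam n) := by
    rw [show ((2 * (k - 1) : ℤ) : ℝ) * gam n = (2 * k : ℤ) * gam n - 2 * gam n by push_cast; ring,
      Real.cos_sub]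
    simp only [apo]
    field_simp
    ring
  rw [e]
  simp only [apo]
  gcongr ?_ / _
  rcases Int.emod_two_eq_zero_or_one k with hk | hk
  · rw [hl_congr (by omega : (j + 2 * k) % 4 = j % 4),
      hl_congr (by omega : (j + 2 * k + 2) % 4 = (j + 2) % 4)]
    have := cos_odd_le H ((k - 2) / 2)
    rw [show 2 * ((k - 2) / 2) + 1 = k - 1 by omega] at this
    nlinarith [Real.cos_le_one ((2 * k : ℤ) * gam n)]
  · rw [hl_congr (by omega : (j + 2 * k) % 4 = (j + 2) % 4),
      hl_congr (by omega : (j + 2 * k + 2) % 4 = j % 4)]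
    have := cos_odd_le H ((k - 1) / 2)
    rw [show 2 * ((k - 1) / 2) + 1 = k by omega] at this
    nlinarith [Real.cos_le_one ((2 * (k - 1) : ℤ) * gam n)]

/-- The sides belong to the polygon. -/
theorem side_mem_poly (H : Good n) {a : ℕ} (ha : a < 5) {j : ℤ} (hj : j % 2 = 1) {u : ℝ}
    (hu : |u| ≤ hl n a j) :
    (⟨apo n a j * Real.cos (j * gam n) - u * Real.sin (j * gam n),
      apo n a j * Real.sin (j * gam n) + u * Real.cos (j * gam n)⟩ : ℂ) ∈ poly n a := by
  intro k
  rw [ip_side]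
  have h1 := apo_bound H ha j ((2 * k + 1 - j) / 2)
  have h2 := apo_bound H ha j (-((2 * k + 1 - j) / 2))
  rw [show 2 * ((2 * k + 1 - j) / 2) = 2 * k + 1 - j by omega] at h1
  rw [show 2 * (-((2 * k + 1 - j) / 2)) = -(2 * k + 1 - j) by omega] at h2
  rw [show j + (2 * k + 1 - j) = 2 * k + 1 by ring] at h1
  rw [apo_congr (by omega : (j + -(2 * k + 1 - j)) % 4 = (2 * k + 1) % 4)] at h2
  rw [show ((-(2 * k + 1 - j) : ℤ) : ℝ) * gam n = -((2 * k + 1 - j : ℤ) * gam n) by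
    push_cast; ring, Real.cos_neg, Real.sin_neg] at h2
  rw [abs_le] at hu
  rcases le_total 0 (Real.sin ((2 * k + 1 - j : ℤ) * gam n)) with h | h <;> nlinarith

theorem ip_mirror (H : Good n) (j : ℤ) (z : ℂ) :
    ip n j ⟨-z.re, z.im⟩ = ip n (2 * n - j) z := by
  simp only [ip]
  push_cast
  rw [show (2 * n - (j : ℝ)) * gam n = 2 * n * gam n - j * gam n by ring, H.gam_mul,
    Real.cos_pi_sub, Real.sin_pi_sub]
  ring

/-- The polygons are symmetric about the vertical axis. -/
theorem mirror_mem_poly (H : Good n) {a : ℕ} {z : ℂ} (hz : z ∈ poly n a) :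
    (⟨-z.re, z.im⟩ : ℂ) ∈ poly n a := by
  intro k
  rw [ip_mirror H]
  have ho := H.odd
  obtain ⟨m, hm⟩ := ho
  have := poly_le hz (j := 2 * n - (2 * k + 1)) (by omega)
  rwa [apo_congr (by omega : (2 * (n : ℤ) - (2 * k + 1)) % 4 = (2 * k + 1) % 4)] at this

/-- The point lies on the horizontal segment between a point of the polygon and its mirror image, so
convexity suffices. -/
theorem poly_of_abs_re_le (H : Good n) {a : ℕ} {x x' y : ℝ} (hz : (⟨x, y⟩ : ℂ) ∈ poly n a)
    (h : |x'| ≤ x) : (⟨x', y⟩ : ℂ) ∈ poly n a := by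
  intro k
  have h1 := hz k
  have h2 := mirror_mem_poly H hz k
  simp only [ip] at h1 h2 ⊢
  rw [abs_le] at h
  rcases le_total 0 (Real.cos ((2 * k + 1 : ℤ) * gam n)) with hc | hc <;> nlinarith

/-- The polygon `a` is the union of the trapezoids cut off by the horizontal lines through
its vertices: each of its points lies at the level of a side on the right. -/
theorem exists_right_side (H : Good n) {a : ℕ} (ha : a < 5) {z : ℂ} (hz : z ∈ poly n a) :
    ∃ j : ℤ, j % 2 = 1 ∧ -n < j ∧ j < n ∧ 0 < hl n a j ∧
      |z.im - apo n a j * Real.sin (j * gam n)| ≤ hl n a j * Real.cos (j * gam n) ∧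
      |z.re| * Real.cos (j * gam n) + z.im * Real.sin (j * gam n) ≤ apo n a j := by
  classical
  have h7 := H.seven_le
  have cospos : ∀ j : ℤ, -n < j → j < n → 0 < Real.cos (j * gam n) := fun j h1 h2 =>
    H.cos_pos (by exact_mod_cast h1) (by exact_mod_cast h2)
  -- `F j` is the abscissa at which the horizontal line through `z` meets the line carrying the side
  -- `j`. Its minimum over the right-hand sides is the right end of the slice of the polygon at this
  -- height.
  let F : ℤ → ℝ := fun j => (apo n a j - z.im * Real.sin (j * gam n)) / Real.cos (j * gam n)
  obtain ⟨j, hj, hmin⟩ := Finset.exists_min_image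
    ((Finset.Ioo (-n : ℤ) n).filter (fun j => j % 2 = 1)) F
    ⟨1, by simp only [Finset.mem_filter, Finset.mem_Ioo]; omega⟩
  simp only [Finset.mem_filter, Finset.mem_Ioo] at hj hmin
  obtain ⟨⟨hj1, hj2⟩, hjo⟩ := hj
  have hc := cospos j hj1 hj2
  have hxj : z.re ≤ F j := by
    have := poly_le hz hjo
    simp only [ip] at this
    rw [le_div_iff₀ hc]
    linarith
  let q : ℂ := ⟨F j, z.im⟩
  have hq : q ∈ poly n a := by
    intro k
    -- Normals are periodic with period 4n. In the window [-n, 3n) the cosine is positive exactly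
    -- for |i| < n. These are the right-hand sides controlled by minimality; for the others, moving
    -- `z` to the right does not increase the scalar product.
    obtain ⟨i, ⟨p, hp⟩, hi0, hi1⟩ : ∃ i : ℤ, (∃ p : ℤ, 2 * k + 1 = i + 4 * n * p) ∧ -n ≤ i ∧
        i < 3 * n := by
      refine ⟨(2 * k + 1 + n) % (4 * n) - n, ⟨(2 * k + 1 + n) / (4 * n), ?_⟩, ?_, ?_⟩
      · have := Int.emod_add_mul_ediv (2 * k + 1 + n) (4 * n)
        linarith
      · have := Int.emod_nonneg (2 * k + 1 + n) (by omega : (4 * n : ℤ) ≠ 0)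
        omega
      · have := Int.emod_lt_of_pos (2 * k + 1 + n) (by omega : (0 : ℤ) < 4 * n)
        omega
    have hpar : (2 * k + 1) % 4 = i % 4 := by
      rw [hp, show i + 4 * n * p = i + 4 * (n * p) by ring]
      omega
    rw [ip_congr H hp, apo_congr hpar]
    have hio : i % 2 = 1 := by omega
    by_cases hin : -n < i ∧ i < n
    · have h1 := hmin i ⟨⟨hin.1, hin.2⟩, hio⟩
      have h2 := cospos i hin.1 hin.2
      have h3 : F j * Real.cos (i * gam n) ≤ F i * Real.cos (i * gam n) := by gcongr
      have h4 : F i * Real.cos (i * gam n) = apo n a i - z.im * Real.sin (i * gam n) := by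
        simp only [F]
        field_simp
      simp only [ip, q]
      linarith
    · have hcle : Real.cos (i * gam n) ≤ 0 := by
        by_cases hi : i = -n
        · rw [hi]
          push_cast
          rw [show -(n : ℝ) * gam n = -(2 * n * gam n / 2) by ring, H.gam_mul, Real.cos_neg,
            Real.cos_pi_div_two]
        · have h1 : (n : ℝ) ≤ i := by exact_mod_cast (by omega : (n : ℤ) ≤ i)
          have h2 : (i : ℝ) ≤ 3 * n := by exact_mod_cast hi1.le
          have g := H.gam_pos
          have gm := H.gam_mul
          apply Real.cos_nonpos_of_pi_div_two_le_of_le <;> nlinarith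
      have h1 := poly_le hz hio
      simp only [ip] at h1
      simp only [ip, q]
      nlinarith
  have hqj : ip n j q = apo n a j := by
    simp only [ip, q, F]
    field_simp
    ring
  have fin : ∀ i : ℤ, i % 2 = 1 → -n < i → i < n → ip n i q = apo n a i →
      |z.im - apo n a i * Real.sin (i * gam n)| ≤ hl n a i * Real.cos (i * gam n) ∧
      |z.re| * Real.cos (i * gam n) + z.im * Real.sin (i * gam n) ≤ apo n a i := by
    intro i hio hi1 hi2 hi
    have hci := cospos i hi1 hi2
    constructor
    · have h1 := abs_le_hl H hq hio hi
      have e : z.im - apo n a i * Real.sin (i * gam n) =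
          (q.im * Real.cos (i * gam n) - q.re * Real.sin (i * gam n)) * Real.cos (i * gam n) := by
        rw [← hi]
        simp only [ip, q]
        have := Real.sin_sq_add_cos_sq (i * gam n)
        linear_combination (-z.im) * this
      rw [e, abs_mul, abs_of_pos hci]
      gcongr
    · have h1 := poly_le hz hio
      have h2 := poly_le (mirror_mem_poly H hz) hio
      simp only [ip] at h1 h2
      rcases abs_cases z.re with h | h <;> rw [h.1] <;> linarith
  -- The minimizing side may be degenerate, as every other side of the polygons 0 and 4 is. Then `q`
  -- is a vertex, and it also lies on a neighbouring side, which has positive length.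
  rcases (hl_nonneg H ha j).eq_or_lt with h0 | h0
  · have hu := abs_le_hl H hq hjo hqj
    rw [← h0, abs_nonpos_iff] at hu
    have hnext : hl n a (j + 2) ≠ 0 := by
      unfold hl at h0 ⊢
      rcases (by omega : j % 4 = 1 ∨ j % 4 = 3) with h | h
      · rw [if_neg (by omega)] at h0
        rw [if_pos (by omega)]
        by_cases ha4 : a + 1 = 5
        · exact absurd h0.symm (halfSide_pos H (by omega) (by omega)).ne'
        · exact (halfSide_pos H (by omega) (by omega)).ne'
      · rw [if_pos h] at h0
        rw [if_neg (by omega)]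
        by_cases ha4 : a = 0
        · exact absurd h0.symm (halfSide_pos H (by omega) (by omega)).ne'
        · exact (halfSide_pos H (by omega) (by omega)).ne'
    have hnext' : 0 < hl n a (j + 2) := lt_of_le_of_ne (hl_nonneg H ha _) (Ne.symm hnext)
    by_cases hj3 : j + 2 < n
    · refine ⟨j + 2, by omega, by omega, hj3, hnext', fin _ (by omega) (by omega) hj3 ?_⟩
      rw [ip_add_two, apo_add_two H, hu, hqj, ← h0]
    · refine ⟨j - 2, by omega, by omega, by omega, ?_, fin _ (by omega) (by omega) (by omega) ?_⟩
      · rwa [hl_congr (by omega : (j - 2) % 4 = (j + 2) % 4)]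
      · rw [ip_sub_two, apo_sub_two H, hu, hqj, ← h0]
        ring_nf
  · exact ⟨j, hjo, hj1, hj2, h0, fin j hjo hj1 hj2 hqj⟩

/-! ### Equal moduli of the cylinders -/

/-- The distance between the centers of two neighbouring polygons. -/
def centerDist (n b : ℕ) : ℝ := apo n b 3 + apo n (b + 1) 1

/-- The off-diagonal entry of the parabolic matrix `T`. -/
def shear (n : ℕ) : ℝ :=
  2 * ((Real.cos (Real.pi / n) + Real.cos (Real.pi / 5)) / Real.sin (Real.pi / n))

/-- Adding the two apothems leaves twice the common half side times cos 2γ plus the sum of its two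
neighbours in the sequence, and `halfSide_rec` makes the total proportional to the common half side.
-/
theorem centerDist_eq (H : Good n) (b : ℕ) : centerDist n b = shear n * halfSide n (b + 1) := by
  have hs := H.sin_two_pos
  have h := halfSide_rec (n := n) b
  simp only [centerDist, apo, shear, ← H.two_gam, hl]
  norm_num [-Real.cos_pi_div_five]
  field_simp
  linear_combination h

end

/-! ### The surface glued from the polygons, and its horizontal cylinders -/

/-- The disjoint union of the five polygons. -/
abbrev Pts (n : ℕ) : Type := {p : ℕ × ℂ // p.1 < 5 ∧ p.2 ∈ poly n p.1}

/-- Gluing of a side of the polygon `b` with the parallel side of the polygon `b + 1`. -/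
def EdgeRel (n : ℕ) (p q : Pts n) : Prop :=
  ∃ j : ℤ, j % 4 = 3 ∧ q.1.1 = p.1.1 + 1 ∧ ip n j p.1.2 = apo n p.1.1 j ∧
    q.1.2 = p.1.2 - (centerDist n p.1.1 : ℂ) * uvec n j

/-- The surface glued from the polygons. -/
abbrev PolySurf (n : ℕ) : Type := Quot (EdgeRel n)

/-- The projection to the surface glued from the polygons. -/
abbrev pmk {n : ℕ} (p : Pts n) : PolySurf n := Quot.mk _ p

/-- The horizontal cylinder that crosses the sides between the polygons `b` and `b + 1` with
normal direction `j`. -/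
structure Cyl (n b : ℕ) (j : ℤ) : Prop where
  b_lt : b < 4
  mod : j % 4 = 3
  gt : -n < j
  lt : j < n

/-- The half-width of the polygon `a` at height `y`, where `j` is the side on the right. -/
def hw (n a : ℕ) (j : ℤ) (y : ℝ) : ℝ :=
  (apo n a j - y * Real.sin (j * gam n)) / Real.cos (j * gam n)

/-- The height `y` belongs to the side `j` of the polygon `a`. -/
def Level (n a : ℕ) (j : ℤ) (y : ℝ) : Prop :=
  |y - apo n a j * Real.sin (j * gam n)| ≤ hl n a j * Real.cos (j * gam n)

/-- The circumference of a cylinder. -/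
def cwid (n b : ℕ) (j : ℤ) : ℝ := 2 * centerDist n b * Real.cos (j * gam n)

/-- The positions of the centers of the two polygons of a cylinder. -/
def shiftv (n b : ℕ) (j : ℤ) (s : Bool) : ℂ := if s then (centerDist n b : ℂ) * uvec n j else 0

/-- The half-widths of the two polygons of a cylinder. -/
def bwid (n b : ℕ) (j : ℤ) (y : ℝ) (s : Bool) : ℝ :=
  if s then centerDist n b * Real.cos (j * gam n) - hw n b j y else hw n b j y

/-- The point `p` lies at the position `ξ` of the infinite strip that covers the cylinder. -/
def PosAt (n b : ℕ) (j : ℤ) (s : Bool) (k : ℤ) (ξ : ℂ) (p : Pts n) : Prop :=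
  p.1.1 = b + s.toNat ∧ p.1.2 = ξ - ((k * cwid n b j : ℝ) : ℂ) - shiftv n b j s ∧
    |p.1.2.re| ≤ bwid n b j ξ.im s

/-- The `ε`-th power of the twist, on the strip. -/
def tw (n b : ℕ) (j : ℤ) (ε : ℤ) (ξ : ℂ) : ℂ :=
  ξ + ((ε * (shear n *
    (ξ.im - (apo n b j * Real.sin (j * gam n) - hl n b j * Real.cos (j * gam n)))) : ℝ) : ℂ)

section

variable {n : ℕ}

theorem Good.cos_right (H : Good n) {j : ℤ} (h1 : -n < j) (h2 : j < n) :
    0 < Real.cos (j * gam n) :=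
  H.cos_pos (by exact_mod_cast h1) (by exact_mod_cast h2)

theorem Cyl.cos_pos (H : Good n) {b : ℕ} {j : ℤ} (h : Cyl n b j) : 0 < Real.cos (j * gam n) :=
  H.cos_right h.gt h.lt

theorem Cyl.hl_eq {b : ℕ} {j : ℤ} (h : Cyl n b j) : hl n b j = halfSide n (b + 1) := by
  simp [hl, h.mod]

theorem Cyl.hl_pos (H : Good n) {b : ℕ} {j : ℤ} (h : Cyl n b j) : 0 < hl n b j := by
  rw [h.hl_eq]
  exact halfSide_pos H (by omega) (by have := h.b_lt; omega)

theorem Cyl.hl_neg {b : ℕ} {j : ℤ} (h : Cyl n b j) : hl n (b + 1) (-j) = hl n b j := by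
  have := h.mod
  rw [h.hl_eq, hl, if_neg (by omega)]

theorem Cyl.dist_eq {b : ℕ} {j : ℤ} (h : Cyl n b j) :
    centerDist n b = apo n b j + apo n (b + 1) (-j) := by
  have := h.mod
  rw [centerDist, apo_congr (by omega : 3 % 4 = j % 4), apo_congr (by omega : 1 % 4 = (-j) % 4)]

theorem Cyl.dist_pos (H : Good n) {b : ℕ} {j : ℤ} (h : Cyl n b j) : 0 < centerDist n b := by
  have h5 : 0 < Real.cos (Real.pi / 5) := by
    apply Real.cos_pos_of_mem_Ioo
    constructor <;> linarith [Real.pi_pos]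
  have h2 := H.cos_two_pos
  have h3 := H.sin_two_pos
  have h4 := h.hl_pos H
  rw [h.hl_eq] at h4
  rw [centerDist_eq H, shear, ← H.two_gam]
  positivity

theorem Cyl.cwid_pos (H : Good n) {b : ℕ} {j : ℤ} (h : Cyl n b j) : 0 < cwid n b j := by
  have := h.dist_pos H
  have := h.cos_pos H
  unfold cwid
  positivity

/-- Circumference over height does not depend on the cylinder. Hence one shear matrix is the
derivative of the full twist in all cylinders at once. -/
theorem Cyl.shear_mul (H : Good n) {b : ℕ} {j : ℤ} (h : Cyl n b j) :
    shear n * (2 * (hl n b j * Real.cos (j * gam n))) = cwid n b j := by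
  rw [cwid, centerDist_eq H, h.hl_eq]
  ring

/-! ### Trapezoids cut off by horizontal lines -/

theorem level_mem_poly (H : Good n) {a : ℕ} (ha : a < 5) {j : ℤ} (hj : j % 2 = 1) (h1 : -n < j)
    (h2 : j < n) {y : ℝ} (hy : Level n a j y) : (⟨hw n a j y, y⟩ : ℂ) ∈ poly n a := by
  have hc := H.cos_right h1 h2
  have h : |(y - apo n a j * Real.sin (j * gam n)) / Real.cos (j * gam n)| ≤ hl n a j := by
    rw [abs_div, abs_of_pos hc, div_le_iff₀ hc]
    exact hy
  convert side_mem_poly H ha hj h using 2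
  · have := Real.sin_sq_add_cos_sq (j * gam n)
    simp only [hw]
    field_simp
    linear_combination (- apo n a j) * this
  · field_simp
    ring

theorem hw_nonneg (H : Good n) {a : ℕ} (ha : a < 5) {j : ℤ} (hj : j % 2 = 1) (h1 : -n < j)
    (h2 : j < n) {y : ℝ} (hy : Level n a j y) : 0 ≤ hw n a j y := by
  have hc := H.cos_right h1 h2
  have h := poly_le (mirror_mem_poly H (level_mem_poly H ha hj h1 h2 hy)) hj
  have e : apo n a j = hw n a j y * Real.cos (j * gam n) + y * Real.sin (j * gam n) := by
    simp only [hw]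
    field_simp
    ring
  rw [e] at h
  simp only [ip] at h
  nlinarith

theorem mem_poly_of_hw (H : Good n) {a : ℕ} (ha : a < 5) {j : ℤ} (hj : j % 2 = 1) (h1 : -n < j)
    (h2 : j < n) {z : ℂ} (hy : Level n a j z.im) (hx : |z.re| ≤ hw n a j z.im) : z ∈ poly n a :=
  poly_of_abs_re_le H (level_mem_poly H ha hj h1 h2 hy) hx

/-- The side glued to j has normal 2n + j, and its mirror image in the vertical axis is -j. So -j is
the right-hand side of the upper polygon's trapezoid. -/
theorem Cyl.level_neg {b : ℕ} {j : ℤ} (h : Cyl n b j) (y : ℝ) :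
    Level n (b + 1) (-j) (y - centerDist n b * Real.sin (j * gam n)) ↔ Level n b j y := by
  unfold Level
  rw [h.hl_neg, h.dist_eq]
  push_cast
  rw [neg_mul, Real.sin_neg, Real.cos_neg]
  ring_nf

/-- At a fixed height the right half of one trapezoid and the left half of the other fill the
horizontal distance between the two centers, because they meet along the glued side. -/
theorem Cyl.hw_neg (H : Good n) {b : ℕ} {j : ℤ} (h : Cyl n b j) (y : ℝ) :
    hw n (b + 1) (-j) (y - centerDist n b * Real.sin (j * gam n)) =
      centerDist n b * Real.cos (j * gam n) - hw n b j y := by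
  have hc := h.cos_pos H
  unfold hw
  rw [h.dist_eq]
  push_cast
  rw [neg_mul, Real.sin_neg, Real.cos_neg]
  field_simp
  have := Real.sin_sq_add_cos_sq (j * gam n)
  linear_combination (-(apo n b j + apo n (b + 1) (-j))) * this

theorem Cyl.bwid_nonneg (H : Good n) {b : ℕ} {j : ℤ} (h : Cyl n b j) {y : ℝ} (hy : Level n b j y)
    (s : Bool) : 0 ≤ bwid n b j y s := by
  have := h.b_lt
  have := h.mod
  have := h.gt
  have := h.lt
  cases s
  · exact hw_nonneg H (by omega) (by omega) h.gt h.lt hy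
  · simp only [bwid, if_true]
    rw [← h.hw_neg H]
    exact hw_nonneg H (by omega) (by omega) (by omega) (by omega) ((h.level_neg y).2 hy)

theorem Cyl.mem_poly (H : Good n) {b : ℕ} {j : ℤ} (h : Cyl n b j) {z ξ : ℂ}
    (hy : Level n b j ξ.im) (s : Bool) (hz : z.im = ξ.im - (shiftv n b j s).im)
    (hx : |z.re| ≤ bwid n b j ξ.im s) : z ∈ poly n (b + s.toNat) := by
  have := h.b_lt
  have := h.mod
  have := h.gt
  have := h.lt
  cases s
  · simp only [shiftv, bwid, if_false, Bool.false_eq_true, Complex.zero_im, sub_zero] at hz hx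
    exact mem_poly_of_hw H (by simp; omega) (by omega) h.gt h.lt (by rwa [hz]) (by rwa [hz])
  · simp only [shiftv, bwid, if_true, Complex.im_ofReal_mul, uvec_im]
      at hz hx
    refine mem_poly_of_hw H (j := -j) (by simp; omega) (by omega) (by omega) (by omega) ?_ ?_
    · rw [hz]
      exact (h.level_neg _).2 hy
    · rw [hz]
      exact hx.trans_eq (h.hw_neg H _).symm

/-! ### The strip covering a cylinder -/

theorem Cyl.exists_posAt (H : Good n) {b : ℕ} {j : ℤ} (h : Cyl n b j) {ξ : ℂ}
    (hy : Level n b j ξ.im) {s : Bool} {k : ℤ}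
    (hx : |ξ.re - k * cwid n b j - (shiftv n b j s).re| ≤ bwid n b j ξ.im s) :
    ∃ p, PosAt n b j s k ξ p := by
  have hb := h.b_lt
  refine ⟨⟨(b + s.toNat, ξ - ((k * cwid n b j : ℝ) : ℂ) - shiftv n b j s), ?_, ?_⟩, rfl, rfl, ?_⟩
  · have := Bool.toNat_le s
    change b + s.toNat < 5
    omega
  · refine h.mem_poly H hy s ?_ ?_
    · simp only [Complex.sub_im, Complex.ofReal_im]
      ring
    · simpa only [Complex.sub_re, Complex.ofReal_re] using hx
  · simpa only [Complex.sub_re, Complex.ofReal_re] using hx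

/-- Trapezoids of the two kinds alternate along the strip, with centers half a circumference apart.
The identity says that at each height they tile it without gaps or overlaps. -/
theorem bwid_add (b : ℕ) (j : ℤ) (y : ℝ) :
    bwid n b j y false + bwid n b j y true = cwid n b j / 2 := by
  simp only [bwid, cwid, if_true, Bool.false_eq_true, if_false]
  ring

@[simp] theorem shiftv_false (b : ℕ) (j : ℤ) : shiftv n b j false = 0 := by simp [shiftv]

theorem shiftv_true_re (b : ℕ) (j : ℤ) : (shiftv n b j true).re = cwid n b j / 2 := by
  simp only [shiftv, cwid, if_true, Complex.re_ofReal_mul, uvec_re]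
  ring

/-- Every point of the strip is covered by one of the two polygons. -/
theorem Cyl.exists_index (H : Good n) {b : ℕ} {j : ℤ} (h : Cyl n b j) (ξ : ℂ) :
    ∃ (s : Bool) (k : ℤ), |ξ.re - k * cwid n b j - (shiftv n b j s).re| ≤ bwid n b j ξ.im s := by
  have hw := h.cwid_pos H
  have e := bwid_add (n := n) b j ξ.im
  -- The nearest center of the first kind. If the point is outside that trapezoid, it lies in the
  -- one of the second kind to its right (index `k`) or to its left (index `k - 1`).
  set k := round (ξ.re / cwid n b j)
  have hk := abs_sub_round (ξ.re / cwid n b j)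
  have hk' : |ξ.re - k * cwid n b j| ≤ cwid n b j / 2 := by
    rw [show ξ.re - k * cwid n b j = (ξ.re / cwid n b j - k) * cwid n b j by field_simp, abs_mul,
      abs_of_pos hw]
    nlinarith
  rw [abs_le] at hk'
  rcases le_or_gt |ξ.re - k * cwid n b j| (bwid n b j ξ.im false) with h1 | h1
  · exact ⟨false, k, by simpa using h1⟩
  · rcases lt_abs.1 h1 with h2 | h2
    · refine ⟨true, k, ?_⟩
      rw [shiftv_true_re, abs_le]
      constructor <;> linarith
    · refine ⟨true, k - 1, ?_⟩
      rw [shiftv_true_re, abs_le]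
      push_cast
      constructor <;> linarith

theorem ip_side_eq {a : ℕ} {j : ℤ} (hc : Real.cos (j * gam n) ≠ 0) {z : ℂ} :
    ip n j z = apo n a j ↔ z.re = hw n a j z.im := by
  simp only [ip, hw]
  rw [eq_div_iff hc]
  constructor <;> intro h <;> linarith

theorem mod_mirror (H : Good n) {j : ℤ} (h : j % 2 = 1) : (2 * n - j) % 4 = j % 4 := by
  obtain ⟨m, hm⟩ := H.odd
  omega

theorem uvec_mirror (H : Good n) (j : ℤ) :
    uvec n (2 * n - j : ℤ) = ⟨- Real.cos (j * gam n), Real.sin (j * gam n)⟩ := by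
  have e : ((2 * n - j : ℤ) : ℝ) * gam n = Real.pi - j * gam n := by
    rw [← H.gam_mul]
    push_cast
    ring
  simp only [uvec, e, Real.cos_pi_sub, Real.sin_pi_sub]

/-- Trapezoids of different kinds can share a position only on a common slanted side, where the two
points are identified by the gluing. -/
theorem posAt_false_true (H : Good n) {b : ℕ} {j : ℤ} (h : Cyl n b j) {ξ : ℂ} {k k' : ℤ}
    {p p' : Pts n} (hp : PosAt n b j false k ξ p) (hp' : PosAt n b j true k' ξ p') :
    pmk p = pmk p' := by
  obtain ⟨h1, h2, h3⟩ := hp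
  obtain ⟨h1', h2', h3'⟩ := hp'
  have hwp := h.cwid_pos H
  have hc := h.cos_pos H
  have hm := h.mod
  have e := bwid_add (n := n) b j ξ.im
  simp only [shiftv_false, sub_zero] at h2
  simp only [Bool.toNat_false, add_zero] at h1
  have him : p.1.2.im = ξ.im := by rw [h2]; simp
  rw [h2'] at h3'
  simp only [Complex.sub_re, Complex.ofReal_re, shiftv_true_re] at h3'
  have h3a := h3
  rw [h2] at h3a
  simp only [Complex.sub_re, Complex.ofReal_re] at h3a
  rw [abs_le] at h3a h3'
  have hk1 : ((k - k' : ℤ) : ℝ) * cwid n b j ≤ (1 : ℤ) * cwid n b j := by push_cast; linarith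
  have hk2 : (0 : ℤ) * cwid n b j ≤ ((k - k' : ℤ) : ℝ) * cwid n b j := by push_cast; linarith
  have hk1' : k - k' ≤ 1 := by exact_mod_cast le_of_mul_le_mul_right hk1 hwp
  have hk2' : 0 ≤ k - k' := by exact_mod_cast le_of_mul_le_mul_right hk2 hwp
  apply Quot.sound
  -- The neighbour is attached to the right along side `j`, or to the left along the mirror side `2
  -- * n - j`.
  rcases (by omega : k' = k ∨ k' = k - 1) with rfl | rfl
  · refine ⟨j, h.mod, by simp [h1, h1'], ?_, ?_⟩
    · rw [h1, ip_side_eq hc.ne', him]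
      have : bwid n b j ξ.im false = hw n b j ξ.im := by simp [bwid]
      rw [h2]
      simp only [Complex.sub_re, Complex.ofReal_re]
      linarith
    · rw [h2', h2, h1, shiftv, if_pos rfl]
  · refine ⟨2 * n - j, ?_, by simp [h1, h1'], ?_, ?_⟩
    · rw [mod_mirror H (by omega)]
      exact h.mod
    · rw [← ip_mirror H, h1, apo_congr (mod_mirror H (by omega)), ip_side_eq hc.ne']
      have : bwid n b j ξ.im false = hw n b j ξ.im := by simp [bwid]
      simp only [him]
      rw [h2]
      simp only [Complex.sub_re, Complex.ofReal_re]
      push_cast at h3'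
      linarith
    · rw [h2', h2, h1, shiftv, if_pos rfl, uvec_mirror H]
      apply Complex.ext
      · simp only [Complex.sub_re, Complex.ofReal_re, Complex.re_ofReal_mul, uvec_re, cwid]
        push_cast
        ring
      · simp only [Complex.sub_im, Complex.ofReal_im, Complex.im_ofReal_mul, uvec_im]

/-- Two points with the same position agree on the surface. -/
theorem posAt_unique (H : Good n) {b : ℕ} {j : ℤ} (h : Cyl n b j) {ξ : ℂ} (hy : Level n b j ξ.im)
    {s s' : Bool} {k k' : ℤ} {p p' : Pts n} (hp : PosAt n b j s k ξ p)
    (hp' : PosAt n b j s' k' ξ p') : pmk p = pmk p' := by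
  have hw := h.cwid_pos H
  have e := bwid_add (n := n) b j ξ.im
  have n1 := h.bwid_nonneg H hy false
  have n2 := h.bwid_nonneg H hy true
  -- Two copies of the same trapezoid overlap only if they are consecutive and the trapezoid of the
  -- other kind between them has width zero at this height. Both points are compared with the single
  -- point of that one.
  have key : ∀ (s : Bool) {k k' : ℤ} {p p' : Pts n}, PosAt n b j s k ξ p → PosAt n b j s k' ξ p' →
      k < k' → pmk p = pmk p' := by
    intro s k k' p p' hp hp' hlt
    obtain ⟨h1, h2, h3⟩ := id hp
    obtain ⟨h1', h2', h3'⟩ := id hp'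
    rw [h2] at h3
    rw [h2'] at h3'
    simp only [Complex.sub_re, Complex.ofReal_re] at h3 h3'
    rw [abs_le] at h3 h3'
    have hle : bwid n b j ξ.im s ≤ cwid n b j / 2 := by cases s <;> linarith
    have hk1 : ((k' - k : ℤ) : ℝ) * cwid n b j ≤ (1 : ℤ) * cwid n b j := by push_cast; linarith
    have hk1' : k' - k ≤ 1 := by exact_mod_cast le_of_mul_le_mul_right hk1 hw
    obtain rfl : k' = k + 1 := by omega
    push_cast at h3 h3'
    cases s
    · simp only [shiftv_false, Complex.zero_re, sub_zero] at h3 h3'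
      obtain ⟨q, hq⟩ := h.exists_posAt H hy (s := true) (k := k) (by
        rw [shiftv_true_re, abs_le]
        constructor <;> linarith)
      exact (posAt_false_true H h hp hq).trans (posAt_false_true H h hp' hq).symm
    · rw [shiftv_true_re] at h3 h3'
      obtain ⟨q, hq⟩ := h.exists_posAt H hy (s := false) (k := k + 1) (by
        rw [shiftv_false, Complex.zero_re, sub_zero, abs_le]
        push_cast
        constructor <;> linarith)
      exact (posAt_false_true H h hq hp).symm.trans (posAt_false_true H h hq hp')
  cases s <;> cases s'
  · rcases lt_trichotomy k k' with hlt | rfl | hlt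
    · exact key _ hp hp' hlt
    · exact congrArg _ (Subtype.ext (Prod.ext (hp.1.trans hp'.1.symm) (hp.2.1.trans hp'.2.1.symm)))
    · exact (key _ hp' hp hlt).symm
  · exact posAt_false_true H h hp hp'
  · exact (posAt_false_true H h hp' hp).symm
  · rcases lt_trichotomy k k' with hlt | rfl | hlt
    · exact key _ hp hp' hlt
    · exact congrArg _ (Subtype.ext (Prod.ext (hp.1.trans hp'.1.symm) (hp.2.1.trans hp'.2.1.symm)))
    · exact (key _ hp' hp hlt).symm

theorem PosAt.shift {b : ℕ} {j : ℤ} {s : Bool} {k : ℤ} {ξ : ℂ} {p : Pts n} (m : ℤ)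
    (h : PosAt n b j s k (ξ + ((m * cwid n b j : ℝ) : ℂ)) p) : PosAt n b j s (k - m) ξ p := by
  obtain ⟨h1, h2, h3⟩ := h
  refine ⟨h1, ?_, by simpa using h3⟩
  rw [h2]
  push_cast
  ring

/-! ### The twist on the strip and at the cylinder boundary -/

@[simp] theorem tw_im (b : ℕ) (j ε : ℤ) (ξ : ℂ) : (tw n b j ε ξ).im = ξ.im := by
  simp only [tw, Complex.add_im, Complex.ofReal_im, add_zero]

theorem tw_add (b : ℕ) (j ε : ℤ) (ξ : ℂ) (x : ℝ) :
    tw n b j ε (ξ + (x : ℂ)) = tw n b j ε ξ + (x : ℂ) := by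
  simp only [tw, Complex.add_im, Complex.ofReal_im, add_zero]
  ring

theorem tw_neg_tw (b : ℕ) (j ε : ℤ) (ξ : ℂ) : tw n b j (-ε) (tw n b j ε ξ) = ξ := by
  conv_lhs => rw [tw]
  rw [tw_im]
  simp only [tw]
  push_cast
  ring

/-- The height `y` is that of an end point of the side `j` of the polygon `a`. -/
def LevelEnd (n a : ℕ) (j : ℤ) (y : ℝ) : Prop :=
  y = apo n a j * Real.sin (j * gam n) - hl n a j * Real.cos (j * gam n) ∨
  y = apo n a j * Real.sin (j * gam n) + hl n a j * Real.cos (j * gam n)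

/-- On the bottom of the cylinder the twist is the identity, and on the top it is the translation by
ε circumferences, which does not change the point of the surface. So the twists of different
cylinders fit together. -/
theorem posAt_tw_of_levelEnd (H : Good n) {b : ℕ} {j : ℤ} (h : Cyl n b j) {ξ : ℂ} (ε : ℤ)
    (hy : LevelEnd n b j ξ.im) {s s' : Bool} {k k' : ℤ} {p p' : Pts n}
    (hp : PosAt n b j s k ξ p) (hp' : PosAt n b j s' k' (tw n b j ε ξ) p') : pmk p = pmk p' := by
  have hc := h.cos_pos H
  have hpos := mul_pos (h.hl_pos H) hc
  have hlev : Level n b j ξ.im := by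
    unfold Level
    rcases hy with hy | hy <;> rw [hy, abs_le] <;> constructor <;> linarith
  rcases hy with hy | hy
  · have e : tw n b j ε ξ = ξ := by
      simp only [tw, hy, sub_self]
      simp
    rw [e] at hp'
    exact posAt_unique H h hlev hp hp'
  · have e : tw n b j ε ξ = ξ + ((ε * cwid n b j : ℝ) : ℂ) := by
      rw [← h.shear_mul H]
      simp only [tw, hy]
      congr 3
      ring
    rw [e] at hp'
    exact posAt_unique H h hlev hp (hp'.shift ε)

theorem levelEnd_mem_poly (H : Good n) {a : ℕ} (ha : a < 5) {j : ℤ} (hj : j % 2 = 1)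
    (h1 : -n < j) (h2 : j < n) {y : ℝ} (hy : LevelEnd n a j y) :
    (⟨hw n a j y, y⟩ : ℂ) ∈ poly n a := by
  apply level_mem_poly H ha hj h1 h2
  have := mul_nonneg (hl_nonneg H ha j) (H.cos_right h1 h2).le
  unfold Level
  rcases hy with hy | hy <;> rw [hy, abs_le] <;> constructor <;> linarith

/-! ### Vertical order of the sides -/

/-- The sides on the right of a polygon occupy intervals of heights which do not overlap. -/
theorem level_sorted (H : Good n) {a : ℕ} (ha : a < 5) {i j : ℤ} (hi : i % 2 = 1) (hj : j % 2 = 1)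
    (hi1 : -n < i) (hij : i < j) (hj2 : j < n) :
    apo n a i * Real.sin (i * gam n) + hl n a i * Real.cos (i * gam n) ≤
      apo n a j * Real.sin (j * gam n) - hl n a j * Real.cos (j * gam n) := by
  have v := levelEnd_mem_poly H ha hi hi1 (by omega) (Or.inr rfl)
  have v' := levelEnd_mem_poly H ha hj (by omega) hj2 (Or.inl rfl)
  have k1 := poly_le v hj
  have k2 := poly_le v' hi
  have ci := H.cos_right hi1 (by omega : i < n)
  have cj := H.cos_right (by omega : -n < j) hj2
  have e1 := (ip_side_eq (a := a) ci.ne' (z := ⟨hw n a i (apo n a i * Real.sin (i * gam n) +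
    hl n a i * Real.cos (i * gam n)), apo n a i * Real.sin (i * gam n) +
    hl n a i * Real.cos (i * gam n)⟩)).2 rfl
  have e2 := (ip_side_eq (a := a) cj.ne' (z := ⟨hw n a j (apo n a j * Real.sin (j * gam n) -
    hl n a j * Real.cos (j * gam n)), apo n a j * Real.sin (j * gam n) -
    hl n a j * Real.cos (j * gam n)⟩)).2 rfl
  have hs : 0 < Real.sin (j * gam n - i * gam n) := by
    rw [← sub_mul]
    apply H.sin_pos
    · exact_mod_cast (by omega : 0 < j - i)
    · exact_mod_cast (by omega : j - i < 2 * n)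
  rw [Real.sin_sub] at hs
  rw [← e2] at k1
  rw [← e1] at k2
  simp only [ip] at k1 k2
  generalize apo n a i * Real.sin (i * gam n) + hl n a i * Real.cos (i * gam n) = y at *
  generalize apo n a j * Real.sin (j * gam n) - hl n a j * Real.cos (j * gam n) = y' at *
  generalize hw n a i y = x at *
  generalize hw n a j y' = x' at *
  -- Each vertex satisfies the inequality of the other side. Weighting by the two cosines eliminates
  -- the abscissas and leaves sin((j - i)γ)(y' - y) ≥ 0.
  have m1 := mul_le_mul_of_nonneg_left k1 ci.le
  have m2 := mul_le_mul_of_nonneg_left k2 cj.le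
  by_contra hlt
  nlinarith

/-- A point in two different trapezoids of a polygon lies on the horizontal line between them. This
reduces compatibility of the twists to the boundaries of cylinders. -/
theorem levelEnd_of_level (H : Good n) {a : ℕ} (ha : a < 5) {i j : ℤ} (hi : i % 2 = 1)
    (hj : j % 2 = 1) (hi1 : -n < i) (hi2 : i < n) (hj1 : -n < j) (hj2 : j < n) (hij : i ≠ j)
    {y : ℝ} (h : Level n a i y) (h' : Level n a j y) : LevelEnd n a i y := by
  unfold Level at h h'
  rw [abs_le] at h h'
  rcases lt_or_gt_of_ne hij with hlt | hlt
  · right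
    have := level_sorted H ha hi hj hi1 hlt hj2
    linarith
  · left
    have := level_sorted H ha hj hi hj1 hlt hi2
    linarith

/-- A horizontal side is at the extreme height of the polygon, so any level reaching it does so at
an end. Such sides exist because n is odd; their gluing takes place along boundaries of cylinders.
-/
theorem levelEnd_of_horizontal (H : Good n) {a : ℕ} (ha : a < 5) {i j : ℤ}
    (hi : i = n ∨ i = -n) (hj : j % 2 = 1) (hj1 : -n < j) (hj2 : j < n) {z : ℂ}
    (hz : ip n i z = apo n a i) (h' : Level n a j z.im) : LevelEnd n a j z.im := by
  obtain ⟨m, hm⟩ := H.odd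
  have v := poly_le (levelEnd_mem_poly H ha hj hj1 hj2 (Or.inr rfl)) (j := i) (by omega)
  have v' := poly_le (levelEnd_mem_poly H ha hj hj1 hj2 (Or.inl rfl)) (j := i) (by omega)
  rw [← hz] at v v'
  have e : (n : ℝ) * gam n = Real.pi / 2 := by rw [← H.gam_mul]; ring
  unfold Level at h'
  rw [abs_le] at h'
  rcases hi with rfl | rfl
  · right
    simp only [ip, Int.cast_natCast, e, Real.cos_pi_div_two, Real.sin_pi_div_two] at v
    linarith
  · left
    simp only [ip, Int.cast_neg, Int.cast_natCast, neg_mul, e, Real.cos_neg, Real.sin_neg,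
      Real.cos_pi_div_two, Real.sin_pi_div_two] at v'
    linarith

/-! ### The twist -/

/-- The relation between a point and its image under the `ε`-th power of the twist. -/
def Twist (n : ℕ) (ε : ℤ) (p q : Pts n) : Prop :=
  ∃ (b : ℕ) (j : ℤ) (_ : Cyl n b j) (ξ : ℂ) (s : Bool) (k : ℤ) (s' : Bool) (k' : ℤ),
    Level n b j ξ.im ∧ PosAt n b j s k ξ p ∧ PosAt n b j s' k' (tw n b j ε ξ) q

theorem Twist.symm {ε : ℤ} {p q : Pts n} (h : Twist n ε p q) : Twist n (-ε) q p := by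
  obtain ⟨b, j, hc, ξ, s, k, s', k', h1, h2, h3⟩ := h
  exact ⟨b, j, hc, tw n b j ε ξ, s', k', s, k, by simpa using h1, h3, by rwa [tw_neg_tw]⟩

/-- The side on the right of the trapezoid of the polygon `b + s` in a cylinder. -/
def rside (j : ℤ) (s : Bool) : ℤ := if s then -j else j

theorem PosAt.level {b : ℕ} {j : ℤ} (h : Cyl n b j) {s : Bool} {k : ℤ} {ξ : ℂ}
    {p : Pts n} (hp : PosAt n b j s k ξ p) (hy : Level n b j ξ.im) :
    Level n p.1.1 (rside j s) p.1.2.im := by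
  obtain ⟨h1, h2, -⟩ := hp
  cases s
  · have : p.1.2.im = ξ.im := by rw [h2]; simp
    rw [h1, this]
    simpa [rside] using hy
  · have : p.1.2.im = ξ.im - centerDist n b * Real.sin (j * gam n) := by rw [h2]; simp [shiftv]
    rw [h1, this]
    simpa [rside] using (h.level_neg ξ.im).2 hy

theorem PosAt.levelEnd {b : ℕ} {j : ℤ} (h : Cyl n b j) {s : Bool} {k : ℤ} {ξ : ℂ}
    {p : Pts n} (hp : PosAt n b j s k ξ p) (hy : LevelEnd n p.1.1 (rside j s) p.1.2.im) :
    LevelEnd n b j ξ.im := by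
  obtain ⟨h1, h2, -⟩ := hp
  cases s
  · have : p.1.2.im = ξ.im := by rw [h2]; simp
    rw [h1, this] at hy
    simpa [rside] using hy
  · have : p.1.2.im = ξ.im - centerDist n b * Real.sin (j * gam n) := by rw [h2]; simp [shiftv]
    rw [h1, this] at hy
    simp only [rside, if_true, LevelEnd, Bool.toNat_true, h.hl_neg, h.dist_eq, Int.cast_neg, neg_mul,
      Real.sin_neg, Real.cos_neg] at hy
    unfold LevelEnd
    rcases hy with hy | hy
    · left
      linarith
    · right
      linarith

theorem Cyl.rside_odd {b : ℕ} {j : ℤ} (h : Cyl n b j) (s : Bool) : rside j s % 2 = 1 := by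
  have := h.mod
  cases s <;> simp [rside] <;> omega

theorem Cyl.rside_gt {b : ℕ} {j : ℤ} (h : Cyl n b j) (s : Bool) : -n < rside j s := by
  have := h.lt
  have := h.gt
  cases s <;> simp [rside] <;> omega

theorem Cyl.rside_lt {b : ℕ} {j : ℤ} (h : Cyl n b j) (s : Bool) : rside j s < n := by
  have := h.lt
  have := h.gt
  cases s <;> simp [rside] <;> omega

/-- The twist is well defined as a map from the polygons to the surface. -/
theorem Twist.unique (H : Good n) {ε : ℤ} {p q q' : Pts n} (h : Twist n ε p q)
    (h' : Twist n ε p q') : pmk q = pmk q' := by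
  obtain ⟨b, j, hc, ξ, s, k, t, l, h1, h2, h3⟩ := h
  obtain ⟨b', j', hc', ξ', s', k', t', l', h1', h2', h3'⟩ := h'
  by_cases hr : rside j s = rside j' s'
  · have hs : s = s' := by
      have := hc.mod
      have := hc'.mod
      cases s <;> cases s' <;> simp [rside] at hr ⊢ <;> omega
    subst hs
    have hj : j = j' := by cases s <;> simpa [rside] using hr
    subst hj
    have hb : b = b' := by
      have := h2.1
      have := h2'.1
      omega
    subst hb
    have e : ξ' = ξ + (((k' - k : ℤ) * cwid n b j : ℝ) : ℂ) := by
      have := h2.2.1.symm.trans h2'.2.1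
      push_cast at this ⊢
      linear_combination -this
    rw [e, tw_add] at h3'
    exact posAt_unique H hc (by simpa using h1) h3 (h3'.shift _)
  -- The point lies in two different trapezoids, hence on the boundary of both cylinders, and each
  -- description of the twist fixes its image in the surface.
  · have l1 := h2.level hc h1
    have l2 := h2'.level hc' h1'
    have e1 := levelEnd_of_level H p.2.1 (hc.rside_odd s) (hc'.rside_odd s') (hc.rside_gt s)
      (hc.rside_lt s) (hc'.rside_gt s') (hc'.rside_lt s') hr l1 l2
    have e2 := levelEnd_of_level H p.2.1 (hc'.rside_odd s') (hc.rside_odd s) (hc'.rside_gt s')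
      (hc'.rside_lt s') (hc.rside_gt s) (hc.rside_lt s) (Ne.symm hr) l2 l1
    exact (posAt_tw_of_levelEnd H hc ε (h2.levelEnd hc e1) h2 h3).symm.trans
      (posAt_tw_of_levelEnd H hc' ε (h2'.levelEnd hc' e2) h2' h3')

theorem Twist.eq_of_horizontal (H : Good n) {ε : ℤ} {p q : Pts n} (h : Twist n ε p q) {i : ℤ}
    (hi : i = n ∨ i = -n) (hp : ip n i p.1.2 = apo n p.1.1 i) : pmk p = pmk q := by
  obtain ⟨b, j, hc, ξ, s, k, t, l, h1, h2, h3⟩ := h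
  have e := levelEnd_of_horizontal H p.2.1 hi (hc.rside_odd s) (hc.rside_gt s)
      (hc.rside_lt s) hp (h2.level hc h1)
  exact posAt_tw_of_levelEnd H hc ε (h2.levelEnd hc e) h2 h3

/-- Every point lies in a cylinder. -/
theorem exists_cyl (H : Good n) (p : Pts n) : ∃ (b : ℕ) (j : ℤ) (_ : Cyl n b j) (s : Bool),
    Level n b j (p.1.2 + shiftv n b j s).im ∧ PosAt n b j s 0 (p.1.2 + shiftv n b j s) p := by
  obtain ⟨⟨a, z⟩, ha, hz⟩ := p
  simp only at ha hz ⊢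
  obtain ⟨i, hio, hi1, hi2, hpos, hlev, hx⟩ := exists_right_side H ha hz
  have hc := H.cos_right hi1 hi2
  have hx' : |z.re| ≤ hw n a i z.im := by
    rw [hw, le_div_iff₀ hc]
    linarith
  -- The type of the right-hand side tells whether the polygon has the smaller or the larger index
  -- in its cylinder. Positivity of the side excludes the missing neighbours of the polygons 4 and
  -- 0.
  rcases (by omega : i % 4 = 3 ∨ i % 4 = 1) with hm | hm
  · have ha4 : a ≠ 4 := by
      rintro rfl
      rw [hl, if_pos hm, halfSide_five] at hpos
      exact hpos.false
    refine ⟨a, i, ⟨by omega, hm, hi1, hi2⟩, false, ?_, ?_, ?_, ?_⟩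
    · rw [shiftv_false, add_zero]
      exact hlev
    · simp
    · simp
    · simpa [bwid] using hx'
  · have ha0 : a ≠ 0 := by
      rintro rfl
      rw [hl, if_neg (by omega), halfSide_zero] at hpos
      exact hpos.false
    obtain ⟨b, rfl⟩ : ∃ b, a = b + 1 := ⟨a - 1, by omega⟩
    have cy : Cyl n b (-i) := ⟨by omega, by omega, by omega, by omega⟩
    have e : (z + shiftv n b (-i) true).im - centerDist n b * Real.sin ((-i : ℤ) * gam n) = z.im := by
      simp [shiftv]
    refine ⟨b, -i, cy, true, ?_, ?_, ?_, ?_⟩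
    · rw [← cy.level_neg, e, neg_neg]
      exact hlev
    · simp
    · simp
    · simp only [bwid, if_true]
      rw [← cy.hw_neg H, e, neg_neg]
      exact hx'

theorem exists_twist (H : Good n) (ε : ℤ) (p : Pts n) : ∃ q, Twist n ε p q := by
  obtain ⟨b, j, hc, s, h1, h2⟩ := exists_cyl H p
  obtain ⟨s', k', h3⟩ := hc.exists_index H (tw n b j ε (p.1.2 + shiftv n b j s))
  obtain ⟨q, hq⟩ := hc.exists_posAt H (by simpa using h1) h3
  exact ⟨q, b, j, hc, _, s, 0, s', k', h1, h2, hq⟩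

theorem exists_int_rep (H : Good n) (k : ℤ) : ∃ i p : ℤ, k = i + 4 * n * p ∧ -n ≤ i ∧ i < 3 * n ∧
    k % 4 = i % 4 := by
  have h7 := H.seven_le
  have e := Int.emod_add_mul_ediv (k + n) (4 * n)
  refine ⟨(k + n) % (4 * n) - n, (k + n) / (4 * n), by linarith, ?_, ?_, ?_⟩
  · have := Int.emod_nonneg (k + n) (by omega : (4 * n : ℤ) ≠ 0)
    omega
  · have := Int.emod_lt_of_pos (k + n) (by omega : (0 : ℤ) < 4 * n)
    omega
  · have : (k + n) % (4 * n) = k + n - 4 * (n * ((k + n) / (4 * n))) := by linarith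
    omega

theorem uvec_congr (H : Good n) {i j q : ℤ} (h : i = j + 4 * n * q) : uvec n i = uvec n j := by
  subst h
  simp only [uvec]
  push_cast
  rw [cos_four_n_mul H, sin_four_n_mul H]

/-- The twist respects the gluing of the sides. -/
theorem Twist.edge (H : Good n) {ε : ℤ} {p p' q q' : Pts n} (e : EdgeRel n p p')
    (h : Twist n ε p q) (h' : Twist n ε p' q') : pmk q = pmk q' := by
  have h7 := H.seven_le
  have e0 : pmk p = pmk p' := Quot.sound e
  obtain ⟨k, hk, hb, hip, hz⟩ := e
  obtain ⟨i, m, hkm, hi1, hi2, hmod⟩ := exists_int_rep H k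
  rw [uvec_congr H hkm] at hz
  rw [ip_congr H hkm, apo_congr hmod] at hip
  rw [hmod] at hk
  have hb4 : p.1.1 < 4 := by
    have := p'.2.1
    omega
  -- Once both glued points have the same position in the strip of one cylinder, a single point `q0`
  -- serves as the image of both.
  have fin : ∀ (j : ℤ) (cy : Cyl n p.1.1 j) (s s' : Bool) (l l' : ℤ),
      Level n p.1.1 j p.1.2.im → PosAt n p.1.1 j s l p.1.2 p →
      PosAt n p.1.1 j s' l' p.1.2 p' → pmk q = pmk q' := by
    intro j cy s s' l l' hlev hp hp'
    obtain ⟨t, m, h3⟩ := cy.exists_index H (tw n p.1.1 j ε p.1.2)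
    obtain ⟨q0, hq0⟩ := cy.exists_posAt H (by simpa using hlev) h3
    have t1 : Twist n ε p q0 := ⟨_, j, cy, p.1.2, s, l, t, m, hlev, hp, hq0⟩
    have t2 : Twist n ε p' q0 := ⟨_, j, cy, p.1.2, s', l', t, m, hlev, hp', hq0⟩
    exact (h.unique H t1).trans (t2.unique H h')
  have levelOf : ∀ (z : ℂ) (j : ℤ), z ∈ poly n p.1.1 → Cyl n p.1.1 j →
      ip n j z = apo n p.1.1 j → Level n p.1.1 j z.im := by
    intro z j hz cy hip
    have hc := cy.cos_pos H
    have h1 := abs_le_hl H hz (by have := cy.mod; omega) hip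
    unfold Level
    have e : z.im - apo n p.1.1 j * Real.sin (j * gam n) =
        (z.im * Real.cos (j * gam n) - z.re * Real.sin (j * gam n)) * Real.cos (j * gam n) := by
      rw [← hip]
      simp only [ip]
      have := Real.sin_sq_add_cos_sq (j * gam n)
      linear_combination (-z.im) * this
    rw [e, abs_mul, abs_of_pos hc]
    gcongr
  -- Horizontal sides are crossed by no cylinder, but the twist fixes them pointwise. The partner of
  -- the side `i` is the side `-i`, since opposite normals differ by 2n and the period is 4n.
  by_cases hor : i = n ∨ i = -n
  · have hor' : i + 2 * n = n + 2 * n ∨ i + 2 * n = n := by omega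
    have e1 := h.eq_of_horizontal H hor hip
    have e2 : pmk p' = pmk q' := by
      refine h'.eq_of_horizontal H (i := -i) (by omega) ?_
      have cn : Real.cos (i * gam n) = 0 := by
        have e : (n : ℝ) * gam n = Real.pi / 2 := by rw [← H.gam_mul]; ring
        rcases hor with rfl | rfl
        · simp [e]
        · simp [e]
      have sn := Real.sin_sq_add_cos_sq (i * gam n)
      rw [cn] at sn
      have cd : centerDist n p.1.1 = apo n p.1.1 i + apo n (p.1.1 + 1) (-i) := by
        rw [centerDist, apo_congr (by omega : 3 % 4 = i % 4),
          apo_congr (by omega : 1 % 4 = (-i) % 4)]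
      rw [hz, hb]
      simp only [ip, cn] at hip
      simp only [ip, Int.cast_neg, neg_mul, Real.cos_neg, Real.sin_neg, cn, Complex.sub_im,
        Complex.im_ofReal_mul, uvec_im]
      linear_combination centerDist n p.1.1 * sn - hip + cd
    rw [← e1, ← e2, e0]
  rcases lt_or_ge i n with hlt | hge
  · have cy : Cyl n p.1.1 i := ⟨hb4, hk, by omega, hlt⟩
    have hc := cy.cos_pos H
    have hlev := levelOf p.1.2 i p.2.2 cy hip
    have hre := (ip_side_eq hc.ne').1 hip
    have b1 := cy.bwid_nonneg H hlev false
    have b2 := cy.bwid_nonneg H hlev true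
    simp only [bwid, Bool.false_eq_true, if_false, if_true] at b1 b2
    refine fin i cy false true 0 0 hlev ⟨by simp, by simp, ?_⟩ ⟨by simp [hb], ?_, ?_⟩
    · simp only [bwid, Bool.false_eq_true, if_false]
      rw [hre, abs_of_nonneg b1]
    · simp [hz, shiftv]
    · rw [hz, Complex.sub_re, hre, Complex.re_ofReal_mul, uvec_re]
      simp only [bwid, if_true]
      rw [abs_of_nonpos (by linarith)]
      linarith
  -- A left-hand side is the mirror image of a right-hand side `j`. The glued point then sits in the
  -- second trapezoid to the left, with index -1.
  · obtain ⟨j, rfl⟩ : ∃ j : ℤ, i = 2 * n - j := ⟨2 * n - i, by ring⟩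
    have hjo : j % 2 = 1 := by omega
    have cy : Cyl n p.1.1 j := ⟨hb4, by rwa [mod_mirror H hjo] at hk, by omega, by omega⟩
    have hc := cy.cos_pos H
    rw [← ip_mirror H, apo_congr (mod_mirror H hjo)] at hip
    have hlev : Level n p.1.1 j p.1.2.im := 
      levelOf ⟨-p.1.2.re, p.1.2.im⟩ j (mirror_mem_poly H p.2.2) cy hip
    have hre := (ip_side_eq hc.ne').1 hip
    simp only at hre
    have b1 := cy.bwid_nonneg H hlev false
    have b2 := cy.bwid_nonneg H hlev true
    simp only [bwid, Bool.false_eq_true, if_false, if_true] at b1 b2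
    have hre' : p.1.2.re = - hw n p.1.1 j p.1.2.im := by linarith
    rw [uvec_mirror H] at hz
    refine fin j cy false true 0 (-1) hlev ⟨by simp, by simp, ?_⟩ ⟨by simp [hb], ?_, ?_⟩
    · simp only [bwid, Bool.false_eq_true, if_false]
      rw [hre', abs_neg, abs_of_nonneg b1]
    · rw [hz]
      apply Complex.ext
      · simp only [shiftv, cwid, if_true, Complex.sub_re, Complex.ofReal_re, Complex.re_ofReal_mul,
          uvec_re]
        push_cast
        ring
      · simp only [shiftv, if_true, Complex.sub_im, Complex.ofReal_im, Complex.im_ofReal_mul,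
          uvec_im]
        ring
    · rw [hz, Complex.sub_re, hre', Complex.re_ofReal_mul]
      simp only [bwid, if_true]
      rw [abs_of_nonneg (by linarith)]
      linarith

/-- The `ε`-th power of the twist on the surface glued from the polygons. -/
def twistFun (H : Good n) (ε : ℤ) : PolySurf n → PolySurf n :=
  Quot.lift (fun p => pmk (exists_twist H ε p).choose) fun p p' h =>
    Twist.edge H h (exists_twist H ε p).choose_spec (exists_twist H ε p').choose_spec

theorem twistFun_eq (H : Good n) {ε : ℤ} {p q : Pts n} (h : Twist n ε p q) :
    twistFun H ε (pmk p) = pmk q :=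
  Twist.unique H (exists_twist H ε p).choose_spec h

theorem twistFun_neg (H : Good n) (ε : ℤ) (x : PolySurf n) :
    twistFun H (-ε) (twistFun H ε x) = x := by
  induction x using Quot.ind with
  | mk p =>
    obtain ⟨q, hq⟩ := exists_twist H ε p
    rw [twistFun_eq H hq, twistFun_eq H hq.symm]

end

/-! ### Piecewise affine lifts -/

section

variable {W W' Z : Type*} [TopologicalSpace W] [TopologicalSpace W']

/-- The map `q` lifts, on the members of a finite closed cover, through `q'`, by maps which in the
coordinates `dev` and `dev'` are affine with derivative `B`. -/
def AffLift (B : SL(2, ℝ)) (dev : W → ℂ) (dev' : W' → ℂ) (q : W → Z) (q' : W' → Z) : Prop :=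
  ∃ (ι : Type) (_ : Finite ι) (K : ι → Set W) (s : ι → W → W') (c : ι → ℂ),
    (∀ i, IsClosed (K i)) ∧ (∀ w, ∃ i, w ∈ K i) ∧ (∀ i, ContinuousOn (s i) (K i)) ∧
    ∀ i, ∀ w ∈ K i, q w = q' (s i w) ∧ dev' (s i w) = matAct B (dev w) + c i

/-- The function `φ` on `U ⊆ Z` is, in the coordinate `dev`, locally affine with derivative `A`. -/
def FlatOn (A : SL(2, ℝ)) (dev : W → ℂ) (q : W → Z) (U : Set Z) (φ : Z → ℂ) : Prop :=
  ∀ w, q w ∈ U → ∃ c : ℂ, ∀ᶠ w' in 𝓝 w, φ (q w') = matAct A (dev w') + c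

/-- The pasting lemma for a finite closed cover. -/
theorem AffLift.continuous [TopologicalSpace Z] {B : SL(2, ℝ)} {dev : W → ℂ} {dev' : W' → ℂ}
    {q : W → Z} {q' : W' → Z} (h : AffLift B dev dev' q q') (hq' : Continuous q') :
    Continuous q := by
  obtain ⟨ι, _, K, s, c, h1, h2, h3, h4⟩ := h
  refine (locallyFinite_of_finite K).continuous (Set.eq_univ_of_forall fun w =>
    Set.mem_iUnion.2 (h2 w)) h1 fun i => ?_
  exact (hq'.comp_continuousOn (h3 i)).congr fun w hw => (h4 i w hw).1

/-- A chain rule that tolerates pieces. The constants on the different pieces through a point agree,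
because all of them are determined by the value at that point. -/
theorem AffLift.flatOn {A B : SL(2, ℝ)} {dev : W → ℂ} {dev' : W' → ℂ} {q : W → Z} {q' : W' → Z}
    (h : AffLift B dev dev' q q') {U : Set Z} {φ : Z → ℂ} (hφ : FlatOn A dev' q' U φ) :
    FlatOn (A * B) dev q U φ := by
  obtain ⟨ι, _, K, s, c, h1, h2, h3, h4⟩ := h
  intro w hw
  refine ⟨φ (q w) - matAct (A * B) (dev w), ?_⟩
  have key : ∀ i, ∀ᶠ w' in 𝓝 w, w' ∈ K i →
      φ (q w') = matAct (A * B) (dev w') + (φ (q w) - matAct (A * B) (dev w)) := by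
    intro i
    by_cases hi : w ∈ K i
    · have hqi := (h4 i w hi).1
      obtain ⟨d, hd⟩ := hφ (s i w) (hqi ▸ hw)
      have hd' := (h3 i w hi).eventually hd
      have hd0 := hd.self_of_nhds
      rw [eventually_nhdsWithin_iff] at hd'
      filter_upwards [hd'] with w' hw' hmem
      rw [(h4 i w' hmem).1, hw' hmem, (h4 i w' hmem).2, (h4 i w hi).1, hd0, (h4 i w hi).2,
        matAct_add, matAct_add, matAct_mul, matAct_mul]
      ring
    -- A closed piece that misses `w` also misses a neighbourhood of `w`; with finitely many pieces,
    -- one neighbourhood serves for all.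
    · filter_upwards [(h1 i).isOpen_compl.mem_nhds hi] with w' hw' hmem
      exact absurd hmem hw'
  filter_upwards [eventually_all.2 key] with w' hw'
  obtain ⟨i, hi⟩ := h2 w'
  exact hw' i hi

end

/-! ### The twist as a piecewise affine map -/

/-- The matrix of the `ε`-th power of the twist. -/
def twMat (n : ℕ) (ε : ℤ) : SL(2, ℝ) :=
  ⟨!![1, ε * shear n; 0, 1], by rw [Matrix.det_fin_two_of]; ring⟩

theorem matAct_twMat (n : ℕ) (ε : ℤ) (z : ℂ) :
    matAct (twMat n ε) z = z + ((ε * shear n * z.im : ℝ) : ℂ) := by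
  apply Complex.ext
  · simp [matAct, twMat]
  · simp [matAct, twMat, Complex.ofReal_im, -Complex.ofReal_mul]

/-- The plane coordinate on the polygons. -/
def pdev {n : ℕ} (p : Pts n) : ℂ := p.1.2

section

variable {n : ℕ}

theorem continuous_pdev : Continuous (pdev (n := n)) := by
  unfold pdev
  fun_prop

theorem shear_pos (H : Good n) : 0 < shear n := by
  have h5 : 0 < Real.cos (Real.pi / 5) := by
    apply Real.cos_pos_of_mem_Ioo
    constructor <;> linarith [Real.pi_pos]
  have h2 := H.cos_two_pos
  have h3 := H.sin_two_pos
  rw [shear, ← H.two_gam]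
  positivity

theorem continuous_bwid (b : ℕ) (j : ℤ) (s : Bool) : Continuous fun y => bwid n b j y s := by
  cases s <;> simp only [bwid, hw, if_true, Bool.false_eq_true, if_false] <;> fun_prop

/-- The part of the polygons which, via the position in the cylinder `(b, j)` relative to its
half `s`, is mapped by the twist to the half `s'`, after `k` rounds. -/
def twPiece (n : ℕ) (ε : ℤ) (b : ℕ) (j : ℤ) (s s' : Bool) (k : ℤ) : Set (Pts n) :=
  {p | Cyl n b j ∧ p.1.1 = b + s.toNat ∧ Level n b j (p.1.2 + shiftv n b j s).im ∧
    |p.1.2.re| ≤ bwid n b j (p.1.2 + shiftv n b j s).im s ∧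
    |(tw n b j ε (p.1.2 + shiftv n b j s)).re - k * cwid n b j - (shiftv n b j s').re| ≤
      bwid n b j (p.1.2 + shiftv n b j s).im s'}

theorem continuous_tw (b : ℕ) (j ε : ℤ) : Continuous (tw n b j ε) := by
  unfold tw
  fun_prop

theorem isClosed_twPiece (ε : ℤ) (b : ℕ) (j : ℤ) (s s' : Bool) (k : ℤ) :
    IsClosed (twPiece n ε b j s s' k) := by
  have c1 : Continuous fun p : Pts n => p.1.2 + shiftv n b j s := by fun_prop
  have c2 : Continuous fun p : Pts n => (p.1.2 + shiftv n b j s).im := by fun_prop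
  have c3 := (continuous_tw (n := n) b j ε).comp c1
  unfold twPiece Level
  refine isClosed_const.and (IsClosed.and ?_ (IsClosed.and ?_ (IsClosed.and ?_ ?_)))
  · exact isClosed_eq (by fun_prop) continuous_const
  · exact isClosed_le (by fun_prop) continuous_const
  · exact isClosed_le (by fun_prop) ((continuous_bwid b j s).comp c2)
  · refine isClosed_le ?_ ((continuous_bwid b j s').comp c2)
    exact (((Complex.continuous_re.comp c3).sub continuous_const).sub continuous_const).abs

theorem twPiece_mem (H : Good n) {ε : ℤ} {b : ℕ} {j : ℤ} {s s' : Bool} {k : ℤ} {p : Pts n}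
    (hp : p ∈ twPiece n ε b j s s' k) :
    ∃ q, PosAt n b j s' k (tw n b j ε (p.1.2 + shiftv n b j s)) q := by
  obtain ⟨hc, h1, h2, h3, h4⟩ := hp
  exact hc.exists_posAt H (by simpa using h2) (by simpa using h4)

theorem twPiece_twist {ε : ℤ} {b : ℕ} {j : ℤ} {s s' : Bool} {k : ℤ} {p q : Pts n}
    (hp : p ∈ twPiece n ε b j s s' k)
    (hq : PosAt n b j s' k (tw n b j ε (p.1.2 + shiftv n b j s)) q) : Twist n ε p q := by
  obtain ⟨hc, h1, h2, h3, h4⟩ := hp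
  exact ⟨b, j, hc, _, s, 0, s', k, h2, ⟨h1, by simp, h3⟩, hq⟩

/-- The ε-th power of the twist moves a point by at most |ε| circumferences. The resulting bound on
k makes the cover by the pieces finite. -/
theorem exists_twPiece (H : Good n) (ε : ℤ) (p : Pts n) : ∃ (b : ℕ) (j : ℤ) (s s' : Bool) (k : ℤ),
    b < 4 ∧ -n < j ∧ j < n ∧ |k| ≤ |ε| + 2 ∧ p ∈ twPiece n ε b j s s' k := by
  obtain ⟨b, j, hc, s, h1, h2⟩ := exists_cyl H p
  obtain ⟨s', k, h3⟩ := hc.exists_index H (tw n b j ε (p.1.2 + shiftv n b j s))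
  refine ⟨b, j, s, s', k, hc.b_lt, hc.gt, hc.lt, ?_, hc, h2.1, h1, h2.2.2, by simpa using h3⟩
  have hwp := hc.cwid_pos H
  rw [tw_im] at h3
  have e := bwid_add (n := n) b j (p.1.2 + shiftv n b j s).im
  have n1 := hc.bwid_nonneg H h1 false
  have n2 := hc.bwid_nonneg H h1 true
  have hb : ∀ t, bwid n b j (p.1.2 + shiftv n b j s).im t ≤ cwid n b j / 2 := by
    intro t
    cases t <;> linarith
  have hsh : ∀ t, 0 ≤ (shiftv n b j t).re ∧ (shiftv n b j t).re ≤ cwid n b j / 2 := by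
    intro t
    cases t
    · rw [shiftv_false, Complex.zero_re]
      constructor <;> linarith
    · rw [shiftv_true_re]
      constructor <;> linarith
  have h4 := h2.2.2.trans (hb s)
  have h3' := h3.trans (hb s')
  have t1 := hsh s
  have t2 := hsh s'
  set y := (p.1.2 + shiftv n b j s).im
  have hre : (tw n b j ε (p.1.2 + shiftv n b j s)).re = p.1.2.re + (shiftv n b j s).re +
      ε * (shear n * (y - (apo n b j * Real.sin (j * gam n) - hl n b j * Real.cos (j * gam n)))) := by
    simp only [tw, Complex.add_re, Complex.ofReal_re, y]
  have hS := shear_pos H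
  unfold Level at h1
  rw [abs_le] at h1 h3' h4
  have s1 : 0 ≤ shear n * (y - (apo n b j * Real.sin (j * gam n) - hl n b j * Real.cos (j * gam n))) :=
    mul_nonneg hS.le (by linarith)
  have s2 : shear n * (y - (apo n b j * Real.sin (j * gam n) - hl n b j * Real.cos (j * gam n))) ≤
      cwid n b j := by
    rw [← hc.shear_mul H]
    exact mul_le_mul_of_nonneg_left (by linarith) hS.le
  have s3 : |(ε : ℝ) * (shear n * (y - (apo n b j * Real.sin (j * gam n) -
      hl n b j * Real.cos (j * gam n))))| ≤ |(ε : ℝ)| * cwid n b j := by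
    rw [abs_mul, abs_of_nonneg s1]
    gcongr
  rw [hre] at h3'
  rw [abs_le] at s3
  have : |(k : ℝ)| * cwid n b j ≤ (|(ε : ℝ)| + 2) * cwid n b j := by
    rw [← abs_of_pos hwp, ← abs_mul, abs_of_pos hwp, abs_le]
    constructor <;> nlinarith
  exact_mod_cast le_of_mul_le_mul_right this hwp

/-- On a piece, source and target are read off from fixed centers of the strip, so the map in plane
coordinates is the shear `tw` between two translations. -/
theorem affLift_twist (H : Good n) (ε : ℤ) :
    AffLift (twMat n ε) pdev pdev (fun p : Pts n => twistFun H ε (pmk p)) pmk := by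
  classical
  refine ⟨Fin 4 × Finset.Ioo (-n : ℤ) n × Bool × Bool × Finset.Icc (-(|ε| + 2)) (|ε| + 2),
    inferInstance, fun i => twPiece n ε i.1 i.2.1 i.2.2.1 i.2.2.2.1 i.2.2.2.2,
    fun i p => if h : p ∈ twPiece n ε i.1 i.2.1 i.2.2.1 i.2.2.2.1 i.2.2.2.2 then
      (twPiece_mem H h).choose else p,
    fun i => tw n i.1 i.2.1 ε (shiftv n i.1 i.2.1 i.2.2.1) -
      ((i.2.2.2.2 * cwid n i.1 i.2.1 : ℝ) : ℂ) - shiftv n i.1 i.2.1 i.2.2.2.1,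
    fun i => isClosed_twPiece _ _ _ _ _ _, ?_, ?_, ?_⟩
  · intro p
    obtain ⟨b, j, s, s', k, h1, h2, h3, h4, h5⟩ := exists_twPiece H ε p
    exact ⟨⟨⟨b, h1⟩, ⟨j, by simp only [Finset.mem_Ioo]; exact ⟨h2, h3⟩⟩, s, s',
      ⟨k, by rw [Finset.mem_Icc]; exact abs_le.1 h4⟩⟩, h5⟩
  · rintro ⟨b, j, s, s', k⟩
    refine Topology.IsInducing.subtypeVal.continuousOn_iff.2 ?_
    have hcont : Continuous fun p : Pts n => (((b : ℕ) + s'.toNat,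
        tw n b j ε (p.1.2 + shiftv n b j s) - (((k : ℤ) * cwid n b j : ℝ) : ℂ) -
          shiftv n b j s') : ℕ × ℂ) := by
      have c1 : Continuous fun p : Pts n => p.1.2 + shiftv n b j s := by fun_prop
      have c3 := (continuous_tw (n := n) b j ε).comp c1
      exact continuous_const.prodMk ((c3.sub continuous_const).sub continuous_const)
    refine hcont.continuousOn.congr fun p hp => ?_
    simp only [Function.comp, dif_pos hp]
    have := (twPiece_mem H hp).choose_spec
    exact Prod.ext this.1 this.2.1
  · rintro ⟨b, j, s, s', k⟩ p hp
    simp only [dif_pos hp]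
    have := (twPiece_mem H hp).choose_spec
    refine ⟨twistFun_eq H (twPiece_twist hp this), ?_⟩
    rw [pdev, this.2.1, matAct_twMat]
    simp only [tw, pdev, Complex.add_im]
    push_cast
    ring

/-- The twist as a homeomorphism. -/
def twistHomeo (H : Good n) (ε : ℤ) : PolySurf n ≃ₜ PolySurf n where
  toFun := twistFun H ε
  invFun := twistFun H (-ε)
  left_inv := twistFun_neg H ε
  right_inv x := by
    have := twistFun_neg H (-ε) x
    rwa [neg_neg] at this
  continuous_toFun := by
    rw [isQuotientMap_quot_mk.continuous_iff]
    exact (affLift_twist H ε).continuous continuous_quot_mk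
  continuous_invFun := by
    rw [isQuotientMap_quot_mk.continuous_iff]
    exact (affLift_twist H (-ε)).continuous continuous_quot_mk

end

/-! ### The table -/

section

variable {n : ℕ}

theorem exp_mul_I (φ : ℝ) : Complex.exp (φ * Complex.I) = ⟨Real.cos φ, Real.sin φ⟩ := by
  apply Complex.ext
  · rw [Complex.exp_ofReal_mul_I_re]
  · rw [Complex.exp_ofReal_mul_I_im]

theorem uvec_eq_exp (x : ℝ) : uvec n x = Complex.exp ((x * gam n : ℝ) * Complex.I) :=
  (exp_mul_I _).symm

theorem uvec_add (x y : ℝ) : uvec n (x + y) = uvec n x * uvec n y := by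
  rw [uvec_eq_exp, uvec_eq_exp, uvec_eq_exp, ← Complex.exp_add]
  congr 1
  push_cast
  ring

@[simp] theorem uvec_zero : uvec n 0 = 1 := by
  rw [uvec_eq_exp]
  simp

theorem conj_uvec (x : ℝ) : (starRingEnd ℂ) (uvec n x) = uvec n (-x) := by
  apply Complex.ext
  · simp
  · simp

theorem uvec_neg_mul (x : ℝ) : uvec n (-x) * uvec n x = 1 := by
  rw [← uvec_add, neg_add_cancel, uvec_zero]

theorem uvec_ne_zero (x : ℝ) : uvec n x ≠ 0 := right_ne_zero_of_mul_eq_one (uvec_neg_mul x)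

theorem norm_uvec (x : ℝ) : ‖uvec n x‖ = 1 := by
  rw [uvec_eq_exp, Complex.norm_exp_ofReal_mul_I]

theorem uvec_add_two_n (H : Good n) (x : ℝ) : uvec n (x + 2 * n) = - uvec n x := by
  apply Complex.ext
  · simp only [uvec_re, Complex.neg_re]
    rw [cos_add_two_n H]
  · simp only [uvec_im, Complex.neg_im]
    rw [sin_add_two_n H]

/-! ### Side lengths of the table and its uniqueness -/

/-- `cos (π / 5)`. -/
abbrev c5 : ℝ := Real.cos (Real.pi / 5)

theorem c5_sq : 4 * c5 ^ 2 = 2 * c5 + 1 := by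
  have : 4 * c5 ^ 2 - 2 * c5 - 1 = 0 := Real.quadratic_root_cos_pi_div_five
  linear_combination this

theorem half_lt_c5 : 1 / 2 < c5 := by
  rw [← Real.cos_pi_div_three]
  have := Real.pi_pos
  apply Real.cos_lt_cos_of_nonneg_of_le_pi_div_two <;> linarith

theorem c5_lt_one : c5 < 1 := by
  rw [← Real.cos_zero]
  have := Real.pi_pos
  apply Real.cos_lt_cos_of_nonneg_of_le_pi_div_two <;> linarith

theorem c5_lt_cos (H : Good n) : c5 < Real.cos (2 * gam n) := by
  have := H.gam_le
  have := H.gam_pos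
  apply Real.cos_lt_cos_of_nonneg_of_le_pi_div_two <;> linarith

/-- The length of the side `I₃` of the table. -/
def tabR (n : ℕ) : ℝ := (Real.cos (2 * gam n) + c5) / Real.cos (gam n)

/-- The length of the side `I₂` of the table. -/
def tabS (n : ℕ) : ℝ := (2 * c5 - 1) * tabR n

/-- The length of the side `I₁` of the table. -/
def tabT (n : ℕ) : ℝ := (2 * c5 - 1) / (2 * Real.cos (gam n))

theorem tabR_pos (H : Good n) : 0 < tabR n := by
  have := half_lt_c5
  have := H.cos_one_pos
  have := H.cos_two_pos
  unfold tabR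
  positivity

theorem tabS_pos (H : Good n) : 0 < tabS n :=
  mul_pos (by linarith [half_lt_c5]) (tabR_pos H)

theorem tabT_pos (H : Good n) : 0 < tabT n :=
  div_pos (by linarith [half_lt_c5]) (by linarith [H.cos_one_pos])

theorem tabR_mul (H : Good n) : tabR n * Real.cos (gam n) = Real.cos (2 * gam n) + c5 := by
  have := H.cos_one_pos
  unfold tabR
  field_simp

theorem tabT_mul (H : Good n) : tabT n * Real.cos (gam n) = c5 - 1 / 2 := by
  have := H.cos_one_pos
  unfold tabT
  field_simp

theorem tabS_eq (H : Good n) : tabS n = 2 * tabT n * (Real.cos (2 * gam n) + c5) := by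
  have := H.cos_one_pos
  unfold tabS tabR tabT
  field_simp

theorem cos_two_gam : Real.cos (2 * gam n) = 2 * Real.cos (gam n) ^ 2 - 1 := Real.cos_two_mul _

theorem sin_two_gam : Real.sin (2 * gam n) = 2 * Real.sin (gam n) * Real.cos (gam n) :=
  Real.sin_two_mul _

theorem sin_three_gam :
    Real.sin (3 * gam n) = Real.sin (gam n) * (4 * Real.cos (gam n) ^ 2 - 1) := by
  rw [Real.sin_three_mul]
  have := Real.sin_sq_add_cos_sq (gam n)
  linear_combination (-4 * Real.sin (gam n)) * this

theorem cos_three_gam :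
    Real.cos (3 * gam n) = 4 * Real.cos (gam n) ^ 3 - 3 * Real.cos (gam n) := Real.cos_three_mul _

theorem table_im (H : Good n) :
    tabR n * Real.sin (2 * gam n) = Real.sin (3 * gam n) + tabT n * Real.sin (2 * gam n) := by
  rw [sin_two_gam, sin_three_gam]
  have h1 := tabR_mul H
  have h2 := tabT_mul H
  rw [cos_two_gam] at h1
  linear_combination (2 * Real.sin (gam n)) * h1 - (2 * Real.sin (gam n)) * h2

theorem table_re (H : Good n) : tabR n * Real.cos (2 * gam n) + tabT n * Real.cos (2 * gam n) =
    Real.cos (3 * gam n) + tabS n := by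
  have hc := H.cos_one_pos
  have h1 := tabR_mul H
  have h2 := tabT_mul H
  have h3 : tabS n * Real.cos (gam n) = (2 * c5 - 1) * (Real.cos (2 * gam n) + c5) := by
    rw [tabS, mul_assoc, h1]
  have h5 := c5_sq
  apply mul_right_cancel₀ hc.ne'
  rw [cos_three_gam]
  rw [cos_two_gam] at h1 h3 ⊢
  linear_combination (2 * Real.cos (gam n) ^ 2 - 1) * h1 + (2 * Real.cos (gam n) ^ 2 - 1) * h2 - h3
    - (1 / 2) * h5

/-- Both paths from V 0 to V 3 agree. Rotating by -3γ makes the directions of `I₁` and `I₃`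
conjugate and that of `I₂` real, so the relation splits into `table_re` and `table_im`. -/
theorem table_closes (H : Good n) : (tabR n : ℂ) * uvec n 1 + tabT n * uvec n 5 =
    1 + tabS n * uvec n 3 := by
  have key : (tabR n : ℂ) * uvec n (-2) + tabT n * uvec n 2 = uvec n (-3) + tabS n := by
    apply Complex.ext
    · simp only [Complex.add_re, Complex.re_ofReal_mul, uvec_re, Complex.ofReal_re, neg_mul,
        Real.cos_neg]
      exact table_re H
    · simp only [Complex.add_im, Complex.im_ofReal_mul, uvec_im, Complex.ofReal_im, neg_mul,
        Real.sin_neg]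
      linear_combination - table_im H
  have e1 : uvec n 1 = uvec n (-2) * uvec n 3 := by rw [← uvec_add]; norm_num
  have e5 : uvec n 5 = uvec n 2 * uvec n 3 := by rw [← uvec_add]; norm_num
  have e0 : (1 : ℂ) = uvec n (-3) * uvec n 3 := by rw [← uvec_add]; norm_num
  rw [e1, e5]
  conv_rhs => rw [e0]
  linear_combination (uvec n 3) * key

/-- The vertices of the table. -/
def tableV (n : ℕ) : Fin 4 → ℂ :=
  ![0, 1, 1 - tabT n * uvec n 5, tabR n * uvec n 1]

theorem tableV_two (H : Good n) : tableV n 2 = tabR n * uvec n 1 - tabS n * uvec n 3 := by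
  change 1 - tabT n * uvec n 5 = _
  linear_combination -table_closes H

theorem exp_angle (H : Good n) : Complex.exp ((Real.pi / n : ℝ) * Complex.I) = uvec n 2 := by
  rw [uvec_eq_exp, H.two_gam]

theorem exp_angle_half : Complex.exp ((Real.pi / (2 * n) : ℝ) * Complex.I) = uvec n 1 := by
  rw [uvec_eq_exp, one_mul, gam]

theorem exp_angle_reflex : Complex.exp ((2 * Real.pi - 5 * Real.pi / (2 * n) : ℝ) * Complex.I) =
    uvec n (-5) := by
  rw [exp_mul_I]
  have : 2 * Real.pi - 5 * Real.pi / (2 * n) = 2 * Real.pi - 5 * gam n := by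
    unfold gam
    ring
  rw [this, Real.cos_two_pi_sub, Real.sin_two_pi_sub]
  simp only [uvec, neg_mul, Real.cos_neg, Real.sin_neg]

theorem isTable_tableV (H : Good n) : IsTable n (tableV n) := by
  have hr := tabR_pos H
  have hs := tabS_pos H
  have ht := tabT_pos H
  have hr' : (tabR n : ℂ) ≠ 0 := by exact_mod_cast hr.ne'
  have hs' : (tabS n : ℂ) ≠ 0 := by exact_mod_cast hs.ne'
  have ht' : (tabT n : ℂ) ≠ 0 := by exact_mod_cast ht.ne'
  have v0 : tableV n 0 = 0 := rfl
  have v1 : tableV n 1 = 1 := rfl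
  have v2 : tableV n 2 = 1 - tabT n * uvec n 5 := rfl
  have v2' := tableV_two H
  have v3 : tableV n 3 = tabR n * uvec n 1 := rfl
  refine ⟨v0, by rw [v0, v1, sub_zero], ?_, ⟨?_, tabT n / tabS n, by positivity, ?_⟩,
    ⟨?_, tabS n / tabR n, by positivity, ?_⟩, ⟨?_, tabR n, hr, ?_⟩, ⟨?_, 1 / tabT n, by positivity, ?_⟩⟩
  · rw [v0, v3, zero_sub, Complex.neg_re, abs_neg, Complex.re_ofReal_mul, uvec_re, one_mul,
      tabR_mul H, H.two_gam, abs_of_pos]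
    have := H.cos_two_pos
    rw [H.two_gam] at this
    linarith [half_lt_c5]
  · change tableV n 3 ≠ tableV n 2
    rw [v3, v2']
    intro h
    have : (tabS n : ℂ) * uvec n 3 = 0 := by linear_combination h
    exact mul_ne_zero hs' (uvec_ne_zero 3) this
  · change tableV n 1 - tableV n 2 = _ * (tableV n 3 - tableV n 2)
    rw [exp_angle H, v1, v2]
    have e : tableV n 3 - (1 - tabT n * uvec n 5) = tabS n * uvec n 3 := by
      rw [v3]
      linear_combination table_closes H
    have e5 : uvec n 5 = uvec n 2 * uvec n 3 := by rw [← uvec_add]; norm_num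
    rw [e, e5]
    push_cast
    field_simp
    ring
  · change tableV n 0 ≠ tableV n 3
    rw [v0, v3]
    exact (mul_ne_zero hr' (uvec_ne_zero 1)).symm
  · change tableV n 2 - tableV n 3 = _ * (tableV n 0 - tableV n 3)
    rw [exp_angle H, v2', v3, v0]
    have e3 : uvec n 3 = uvec n 2 * uvec n 1 := by rw [← uvec_add]; norm_num
    rw [e3]
    push_cast
    field_simp
    ring
  · change tableV n 1 ≠ tableV n 0
    rw [v0, v1]
    exact one_ne_zero
  · change tableV n 3 - tableV n 0 = _ * (tableV n 1 - tableV n 0)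
    rw [exp_angle_half, v3, v1, v0]
    ring
  · change tableV n 2 ≠ tableV n 1
    rw [v2, v1]
    intro h
    have : (tabT n : ℂ) * uvec n 5 = 0 := by linear_combination -h
    exact mul_ne_zero ht' (uvec_ne_zero 5) this
  · change tableV n 0 - tableV n 1 = _ * (tableV n 2 - tableV n 1)
    rw [exp_angle_reflex, v0, v1, v2]
    have e := uvec_neg_mul (n := n) 5
    push_cast
    field_simp
    linear_combination (tabT n : ℂ) * e

/-- The angle γ and the horizontal extent of `I₃` fix V 3. The angles β and α fix the directions of
`I₂` and `I₁`, and the closing relation determines their lengths because the directions are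
independent. -/
theorem IsTable.eq_tableV (H : Good n) {V : Fin 4 → ℂ} (h : IsTable n V) : V = tableV n := by
  obtain ⟨h0, h4, h3, ⟨-, ρ3, hρ3, hα⟩, ⟨-, ρ2, hρ2, hβ⟩, ⟨-, ρ, hρ, hγ⟩, -⟩ := h
  change V 1 - V 2 = _ * (V 3 - V 2) at hα
  change V 2 - V 3 = _ * (V 0 - V 3) at hβ
  change V 3 - V 0 = _ * (V 1 - V 0) at hγ
  rw [exp_angle H] at hα hβ
  rw [exp_angle_half, h4, mul_one, h0, sub_zero] at hγ
  rw [h0, sub_zero] at h4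
  have hc := H.cos_one_pos
  have hs := H.sin_two_pos
  have hρr : ρ = tabR n := by
    rw [h0, zero_sub, Complex.neg_re, abs_neg, hγ, Complex.re_ofReal_mul, uvec_re, one_mul,
      abs_of_pos (mul_pos hρ hc), ← H.two_gam] at h3
    apply mul_right_cancel₀ hc.ne'
    rw [h3, tabR_mul H]
  subst hρr
  rw [h0, zero_sub, hγ] at hβ
  have e3 : uvec n 3 = uvec n 2 * uvec n 1 := by rw [← uvec_add]; norm_num
  have e5 : uvec n 5 = uvec n 2 * uvec n 3 := by rw [← uvec_add]; norm_num
  set s' : ℝ := ρ2 * tabR n with hs'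
  set t' : ℝ := ρ3 * s' with ht'
  have hV2 : V 2 = tabR n * uvec n 1 - s' * uvec n 3 := by
    rw [hs', e3]
    push_cast
    linear_combination hβ
  have hcl : (tabR n : ℂ) * uvec n 1 + t' * uvec n 5 = 1 + s' * uvec n 3 := by
    rw [hγ, h4, hV2] at hα
    rw [ht', e5]
    push_cast at hα ⊢
    linear_combination -hα
  -- The difference of the two closing relations, divided by the direction of `I₂`; its imaginary
  -- part isolates the length of `I₁`.
  have hdiff : ((t' - tabT n : ℝ) : ℂ) * uvec n 2 = ((s' - tabS n : ℝ) : ℂ) := by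
    have := table_closes H
    have h3 : ((t' - tabT n : ℝ) : ℂ) * uvec n 5 = ((s' - tabS n : ℝ) : ℂ) * uvec n 3 := by
      push_cast
      linear_combination hcl - this
    rw [e5, ← mul_assoc] at h3
    exact mul_right_cancel₀ (uvec_ne_zero 3) h3
  have him := congrArg Complex.im hdiff
  rw [Complex.im_ofReal_mul, uvec_im, Complex.ofReal_im] at him
  have ht0 : t' - tabT n = 0 := by
    rcases mul_eq_zero.1 him with h | h
    · exact h
    · exact absurd h hs.ne'
  have hs0 : s' = tabS n := by
    rw [ht0, Complex.ofReal_zero, zero_mul] at hdiff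
    have := Complex.ofReal_eq_zero.1 hdiff.symm
    linarith
  funext i
  fin_cases i
  · exact h0
  · exact h4
  · change V 2 = tableV n 2
    rw [tableV_two H, hV2, hs0]
  · exact hγ

theorem existsUnique_isTable (H : Good n) : ∃! V : Fin 4 → ℂ, IsTable n V :=
  ⟨tableV n, isTable_tableV H, fun _ h => h.eq_tableV H⟩

/-! ### The table and the polygons -/

theorem halfSide_one (H : Good n) : halfSide n 1 = tabT n * Real.sin (2 * gam n) := by
  have h := halfSide_rec (n := n) 0
  rw [halfSide_zero, zero_add, halfSide_two] at h
  have h5 := c5_sq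
  have hc := half_lt_c5
  have h2 := tabT_mul H
  rw [sin_two_gam]
  have e : halfSide n 1 = Real.sin (gam n) * (2 * c5 - 1) := by
    apply mul_left_cancel₀ (by linarith : (2 * c5) ≠ 0)
    linear_combination -h - Real.sin (gam n) * h5
  rw [e]
  linear_combination (-2 * Real.sin (gam n)) * h2

/-- Hence `I₃` joins the centers of the polygons 2 and 1. -/
theorem centerDist_one (H : Good n) : centerDist n 1 = tabR n := by
  have h := H.sin_one_pos
  have hc := H.cos_one_pos
  rw [centerDist_eq H, halfSide_two, shear, ← H.two_gam, tabR, sin_two_gam]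
  field_simp

theorem centerDist_reflect (H : Good n) {b : ℕ} (hb : b < 4) :
    centerDist n (3 - b) = centerDist n b := by
  rw [centerDist_eq H, centerDist_eq H]
  congr 1
  rw [← halfSide_reflect (by omega : b + 1 ≤ 5)]
  congr 1
  omega

/-- Hence `I₂` joins the centers of the polygons 0 and 1. -/
theorem centerDist_zero (H : Good n) : centerDist n 0 = tabS n := by
  have h2 := H.sin_two_pos
  rw [centerDist_eq H, zero_add, halfSide_one H, shear, ← H.two_gam, tabS_eq H]
  field_simp

theorem apo_two (H : Good n) (j : ℤ) : apo n 2 j = Real.cos (gam n) := by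
  have hl2 : ∀ j, hl n 2 j = Real.sin (gam n) := by
    intro j
    unfold hl
    split_ifs
    · rw [← halfSide_two, ← halfSide_reflect (by norm_num : 2 ≤ 5)]
    · exact halfSide_two
  have h1 := H.sin_one_pos
  have h2 := H.cos_one_pos
  rw [apo, hl2, hl2, sin_two_gam, cos_two_gam]
  field_simp
  ring

theorem apo_zero_three (H : Good n) : apo n 0 3 = tabT n * Real.cos (2 * gam n) := by
  have h2 := H.sin_two_pos
  have e1 : hl n 0 3 = halfSide n 1 := by simp [hl]
  have e2 : hl n 0 (3 + 2) = halfSide n 0 := by simp [hl]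
  rw [apo, e1, e2, halfSide_zero, halfSide_one H]
  field_simp
  ring

theorem apo_zero_one (H : Good n) : apo n 0 1 = tabT n := by
  have h2 := H.sin_two_pos
  have e1 : hl n 0 1 = halfSide n 0 := by simp [hl]
  have e2 : hl n 0 (1 + 2) = halfSide n 1 := by simp [hl]
  rw [apo, e1, e2, halfSide_zero, halfSide_one H]
  field_simp
  ring

theorem apo_one_three (H : Good n) : apo n 1 3 = tabR n - Real.cos (gam n) := by
  have := centerDist_one H
  rw [centerDist, apo_two H] at this
  linarith

theorem apo_one_one (H : Good n) : apo n 1 1 = tabS n - tabT n * Real.cos (2 * gam n) := by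
  have := centerDist_zero H
  rw [centerDist, apo_zero_three H] at this
  linarith

theorem apo_one_one' (H : Good n) : apo n 1 1 =
    apo n 1 3 * Real.cos (2 * gam n) + Real.sin (gam n) * Real.sin (2 * gam n) := by
  have := apo_sub_two H 1 3
  have e : hl n 1 3 = Real.sin (gam n) := by rw [← halfSide_two]; simp [hl]
  rw [e] at this
  exact this

theorem apo_one_three' (H : Good n) : apo n 1 3 =
    apo n 1 1 * Real.cos (2 * gam n) + tabT n * Real.sin (2 * gam n) * Real.sin (2 * gam n) := by
  have := apo_add_two H 1 1
  have e : hl n 1 1 = tabT n * Real.sin (2 * gam n) := by rw [← halfSide_one H]; simp [hl]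
  rw [e] at this
  exact this

end

/-! ### Decomposition of the table into sectors of the polygons -/

/-- The component of `z` orthogonal to the unit vector of angle `j π / (2 n)`. -/
def cr (n : ℕ) (j : ℤ) (z : ℂ) : ℝ := z.im * Real.cos (j * gam n) - z.re * Real.sin (j * gam n)

/-- The centers of the polygons, for the polygons which meet the table. -/
def ctr (n : ℕ) : ℕ → ℂ
  | 0 => tabR n * uvec n 1 - tabS n * uvec n 3
  | 1 => tabR n * uvec n 1
  | _ => 0

/-- The first wall of the sector at a center. -/
def wallA (n : ℕ) : ℕ → ℤ
  | 0 => 3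
  | 1 => 2 * n + 1
  | _ => 0

/-- The second wall of the sector at a center. -/
def wallB (n : ℕ) : ℕ → ℤ
  | 0 => 5
  | 1 => 2 * n + 3
  | _ => 1

/-- The part of the table in the polygon `i`, relative to the center of the polygon. -/
def part (n i : ℕ) : Set ℂ := {z | 0 ≤ cr n (wallA n i) z ∧ cr n (wallB n i) z ≤ 0 ∧ z ∈ poly n i}

section

variable {n : ℕ}

theorem ip_add (j : ℤ) (z w : ℂ) : ip n j (z + w) = ip n j z + ip n j w := by
  simp only [ip, Complex.add_re, Complex.add_im]
  ring

theorem ip_sub (j : ℤ) (z w : ℂ) : ip n j (z - w) = ip n j z - ip n j w := by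
  simp only [ip, Complex.sub_re, Complex.sub_im]
  ring

theorem ip_neg (j : ℤ) (z : ℂ) : ip n j (-z) = - ip n j z := by
  simp only [ip, Complex.neg_re, Complex.neg_im]
  ring

theorem ip_mul (j : ℤ) (x : ℝ) (z : ℂ) : ip n j (x * z) = x * ip n j z := by
  simp only [ip, Complex.re_ofReal_mul, Complex.im_ofReal_mul]
  ring

theorem ip_uvec (j : ℤ) (x : ℝ) : ip n j (uvec n x) = Real.cos ((x - j) * gam n) := by
  simp only [ip, uvec_re, uvec_im, sub_mul, Real.cos_sub]

theorem cr_add (j : ℤ) (z w : ℂ) : cr n j (z + w) = cr n j z + cr n j w := by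
  simp only [cr, Complex.add_re, Complex.add_im]
  ring

theorem cr_sub (j : ℤ) (z w : ℂ) : cr n j (z - w) = cr n j z - cr n j w := by
  simp only [cr, Complex.sub_re, Complex.sub_im]
  ring

theorem cr_mul (j : ℤ) (x : ℝ) (z : ℂ) : cr n j (x * z) = x * cr n j z := by
  simp only [cr, Complex.re_ofReal_mul, Complex.im_ofReal_mul]
  ring

theorem cr_uvec (j : ℤ) (x : ℝ) : cr n j (uvec n x) = Real.sin ((x - j) * gam n) := by
  simp only [cr, uvec_re, uvec_im, sub_mul, Real.sin_sub]

theorem ip_one (j : ℤ) : ip n j 1 = Real.cos (j * gam n) := by simp [ip]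

theorem cr_one (j : ℤ) : cr n j 1 = - Real.sin (j * gam n) := by simp [cr]

theorem ip_opp (H : Good n) (j : ℤ) (z : ℂ) : ip n (2 * n + j) z = - ip n j z := by
  simp only [ip]
  push_cast
  rw [add_comm (2 * (n : ℝ)), cos_add_two_n H, sin_add_two_n H]
  ring

theorem cr_opp (H : Good n) (j : ℤ) (z : ℂ) : cr n (2 * n + j) z = - cr n j z := by
  simp only [cr]
  push_cast
  rw [add_comm (2 * (n : ℝ)), cos_add_two_n H, sin_add_two_n H]
  ring

/-- Inside the sector between the directions j and j + 2 this writes any scalar product with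
nonnegative weights, so bounds on cosines translate into bounds on sides. -/
theorem ip_sector (i j : ℤ) (z : ℂ) : ip n i z * Real.sin (2 * gam n) =
    -cr n (j + 2) z * Real.cos ((i - j : ℤ) * gam n) +
      cr n j z * Real.cos ((i - j - 2 : ℤ) * gam n) := by
  have h1 := Real.sin_sq_add_cos_sq (j * gam n)
  have e1 : ((i - j : ℤ) : ℝ) * gam n = i * gam n - j * gam n := by push_cast; ring
  have e2 : ((i - j - 2 : ℤ) : ℝ) * gam n = i * gam n - (j * gam n + 2 * gam n) := by
    push_cast; ring
  have e3 : ((j + 2 : ℤ) : ℝ) * gam n = j * gam n + 2 * gam n := by push_cast; ring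
  simp only [ip, cr, e1, e2, e3, Real.cos_sub, Real.cos_add, Real.sin_add]
  linear_combination (-(z.re * Real.cos (i * gam n) + z.im * Real.sin (i * gam n)) *
    Real.sin (2 * gam n)) * h1

/-! ### Conditions for membership in a part -/

/-- A point in a sector bounded by two neighbouring normals which satisfies the conditions at
the two corresponding sides belongs to the polygon. -/
theorem poly_of_sector (H : Good n) {a : ℕ} {j : ℤ} (hj : j % 2 = 1) {z : ℂ}
    (h1 : 0 ≤ cr n j z) (h2 : cr n (j + 2) z ≤ 0) (h3 : ip n j z ≤ apo n a j)
    (h4 : ip n (j + 2) z ≤ apo n a (j + 2)) : z ∈ poly n a := by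
  have hs := H.sin_two_pos
  intro k
  have e := ip_sector (n := n) (2 * k + 1) j z
  have e0 := ip_sector (n := n) j j z
  have e2 := ip_sector (n := n) (j + 2) j z
  simp only [sub_self, Int.cast_zero, zero_mul, Real.cos_zero, zero_sub, Int.cast_neg,
    Int.cast_ofNat, neg_mul, Real.cos_neg, add_sub_cancel_left] at e0 e2
  obtain ⟨m, hm⟩ : ∃ m, 2 * k + 1 - j = 2 * m := ⟨(2 * k + 1 - j) / 2, by omega⟩
  rw [hm] at e
  rw [show 2 * m - 2 = 2 * (m - 1) by ring] at e
  -- A normal of the same type as `j` is compared with `j`, one of the other type with `j + 2`. In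
  -- both cases `cos_odd_le` bounds one cosine by cos 2γ and the other is at most 1.
  rcases Int.emod_two_eq_zero_or_one m with h | h
  · rw [apo_congr (by omega : (2 * k + 1) % 4 = j % 4)]
    refine le_trans ?_ h3
    have c := cos_odd_le H ((m - 2) / 2)
    rw [show 2 * ((m - 2) / 2) + 1 = m - 1 by omega] at c
    have c' := Real.cos_le_one ((2 * m : ℤ) * gam n)
    refine le_of_mul_le_mul_right ?_ hs
    rw [e, e0]
    nlinarith
  · rw [apo_congr (by omega : (2 * k + 1) % 4 = (j + 2) % 4)]
    refine le_trans ?_ h4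
    have c := cos_odd_le H ((m - 1) / 2)
    rw [show 2 * ((m - 1) / 2) + 1 = m by omega] at c
    have c' := Real.cos_le_one ((2 * (m - 1) : ℤ) * gam n)
    refine le_of_mul_le_mul_right ?_ hs
    rw [e, e2]
    nlinarith

theorem cos_two_le_one : Real.cos (2 * gam n) ≤ 1 := Real.cos_le_one _

theorem two_tabT_le (H : Good n) : 2 * tabT n * Real.cos (2 * gam n) ≤ tabS n := by
  rw [tabS_eq H]
  nlinarith [tabT_pos H, half_lt_c5]

theorem cos_le_tabR (H : Good n) : Real.cos (gam n) < tabR n := by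
  have hc := H.cos_one_pos
  have h := tabR_mul H
  have e := cos_two_gam (n := n)
  have h5 := half_lt_c5
  have := c5_lt_cos H
  have h1 := Real.cos_le_one (gam n)
  nlinarith

/-- The sector has angle γ only. It is half of the sector between the normals -1 and 1, and the
condition at -1 follows from the one at 1 because the imaginary part is nonnegative. -/
theorem mem_part_two (H : Good n) {z : ℂ} (h1 : 0 ≤ cr n 0 z) (h2 : cr n 1 z ≤ 0)
    (h3 : ip n 1 z ≤ Real.cos (gam n)) : z ∈ part n 2 := by
  refine ⟨h1, h2, ?_⟩
  have hs := H.sin_one_pos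
  have hc := H.cos_one_pos
  simp only [cr, Int.cast_zero, zero_mul, Real.cos_zero, Real.sin_zero, mul_one, mul_zero, sub_zero,
    Int.cast_one, one_mul] at h1 h2
  simp only [ip, Int.cast_one, one_mul] at h3
  have hre : 0 ≤ z.re := by
    by_contra hlt
    nlinarith
  refine poly_of_sector H (j := -1) (by norm_num) ?_ ?_ ?_ ?_
  · simp only [cr, Int.cast_neg, Int.cast_one, neg_mul, one_mul, Real.cos_neg, Real.sin_neg]
    nlinarith
  · simpa [cr] using h2
  · rw [apo_two H]
    simp only [ip, Int.cast_neg, Int.cast_one, neg_mul, one_mul, Real.cos_neg, Real.sin_neg]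
    nlinarith
  · rw [apo_two H]
    simpa [ip] using h3

theorem mem_part_one (H : Good n) {z : ℂ} (h1 : cr n 1 z ≤ 0) (h2 : 0 ≤ cr n 3 z)
    (h3 : -ip n 1 z ≤ apo n 1 3) (h4 : -ip n 3 z ≤ apo n 1 1) : z ∈ part n 1 := by
  obtain ⟨m, hm⟩ := H.odd
  refine ⟨?_, ?_, ?_⟩
  · change 0 ≤ cr n (2 * n + 1) z
    rw [cr_opp H]
    linarith
  · change cr n (2 * n + 3) z ≤ 0
    rw [cr_opp H]
    linarith
  · refine poly_of_sector H (j := 2 * n + 1) (by omega) ?_ ?_ ?_ ?_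
    · rw [cr_opp H]
      linarith
    · rw [show (2 * n + 1 + 2 : ℤ) = 2 * n + 3 by ring, cr_opp H]
      linarith
    · rw [ip_opp H, apo_congr (by omega : (2 * (n : ℤ) + 1) % 4 = 3 % 4)]
      exact h3
    · rw [show (2 * n + 1 + 2 : ℤ) = 2 * n + 3 by ring, ip_opp H,
        apo_congr (by omega : (2 * (n : ℤ) + 3) % 4 = 1 % 4)]
      exact h4

theorem mem_part_zero (H : Good n) {z : ℂ} (h1 : 0 ≤ cr n 3 z) (h2 : cr n 5 z ≤ 0)
    (h3 : ip n 3 z ≤ apo n 0 3) (h4 : ip n 5 z ≤ apo n 0 1) : z ∈ part n 0 :=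
  ⟨h1, h2, poly_of_sector H (j := 3) (by norm_num) h1 h2 h3 h4⟩

/-! ### The two triangles of the table and the three sectors -/

theorem mem_convexHull_triple {a b c p : ℂ} : p ∈ convexHull ℝ {a, b, c} ↔
    ∃ x y w : ℝ, 0 ≤ x ∧ 0 ≤ y ∧ 0 ≤ w ∧ x + y + w = 1 ∧ x * a + y * b + w * c = p := by
  constructor
  · intro h
    rw [convexHull_insert (Set.insert_nonempty _ _), convexHull_pair, mem_convexJoin] at h
    obtain ⟨u, rfl, v, ⟨y, w, hy, hw, hyw, rfl⟩, ⟨s, t, hs, ht, hst, rfl⟩⟩ := h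
    refine ⟨s, t * y, t * w, hs, by positivity, by positivity, ?_, ?_⟩
    · rw [add_assoc, ← mul_add, hyw, mul_one, hst]
    · simp only [Complex.real_smul]
      push_cast
      ring
  · rintro ⟨x, y, w, hx, hy, hw, h1, rfl⟩
    have hconv := convex_convexHull ℝ ({a, b, c} : Set ℂ)
    have ha : a ∈ convexHull ℝ ({a, b, c} : Set ℂ) := subset_convexHull ℝ _ (by simp)
    have hb : b ∈ convexHull ℝ ({a, b, c} : Set ℂ) := subset_convexHull ℝ _ (by simp)
    have hc : c ∈ convexHull ℝ ({a, b, c} : Set ℂ) := subset_convexHull ℝ _ (by simp)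
    have := hconv.sum_mem (t := Finset.univ) (w := ![x, y, w]) (z := ![a, b, c])
      (by intro i _; fin_cases i <;> simpa) (by simp [Fin.sum_univ_three, h1])
      (by intro i _; fin_cases i <;> simpa)
    simpa [Fin.sum_univ_three] using this

theorem trig_args :
    Real.sin (4 * gam n) = 2 * Real.sin (2 * gam n) * Real.cos (2 * gam n) ∧
    Real.cos (4 * gam n) = 2 * Real.cos (2 * gam n) ^ 2 - 1 := by
  constructor
  · rw [← Real.sin_two_mul]
    ring_nf
  · rw [← Real.cos_two_mul]
    ring_nf

theorem mem_part_of_tri_one (H : Good n) {x y : ℝ} (hx : 0 ≤ x) (hy : 0 ≤ y) (hxy : x + y ≤ 1) :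
    (x + y * (tabR n * uvec n 1) - ctr n 2 : ℂ) ∈ part n 2 ∨
    (x + y * (tabR n * uvec n 1) - ctr n 1 : ℂ) ∈ part n 1 := by
  have hr := tabR_pos H
  have hs := H.sin_one_pos
  have hs2 := H.sin_two_pos
  have hc := H.cos_one_pos
  have hc2 := H.cos_two_pos
  have ht := tabT_pos H
  set p : ℂ := x + y * (tabR n * uvec n 1) with hp
  have hp' : p = (x : ℂ) * 1 + ((y * tabR n : ℝ) : ℂ) * uvec n 1 := by
    rw [hp]
    push_cast
    ring
  have i1 : ip n 1 p = x * Real.cos (gam n) + y * tabR n := by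
    rw [hp', ip_add, ip_mul, ip_mul, ip_one, ip_uvec]
    norm_num
  have c1 : cr n 1 p = - x * Real.sin (gam n) := by
    rw [hp', cr_add, cr_mul, cr_mul, cr_one, cr_uvec]
    norm_num
  -- The line carrying the side 1 of the 2n-gon passes through V 1 and cuts this triangle into a
  -- piece of the polygon 2 and a piece of the polygon 1.
  rcases le_total (ip n 1 p) (Real.cos (gam n)) with h | h
  · left
    simp only [ctr, sub_zero]
    refine mem_part_two H ?_ ?_ h
    · rw [hp', cr_add, cr_mul, cr_mul, cr_one, cr_uvec]
      norm_num
      positivity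
    · rw [c1]
      nlinarith
  · right
    set z := p - ctr n 1 with hz
    have hz' : z = (x : ℂ) * 1 + (((y - 1) * tabR n : ℝ) : ℂ) * uvec n 1 := by
      rw [hz, hp']
      simp only [ctr]
      push_cast
      ring
    have i1z : ip n 1 z = ip n 1 p - tabR n := by
      rw [hz, ip_sub]
      simp only [ctr, ip_mul, ip_uvec]
      norm_num
    have c1z : cr n 1 z = cr n 1 p := by
      rw [hz, cr_sub]
      simp only [ctr, cr_mul, cr_uvec]
      norm_num
    have e3 : ((1 : ℝ) - (3 : ℤ)) * gam n = - (2 * gam n) := by push_cast; ring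
    have c3z : cr n 3 z = - x * Real.sin (3 * gam n) + (1 - y) * tabR n * Real.sin (2 * gam n) := by
      rw [hz', cr_add, cr_mul, cr_mul, cr_one, cr_uvec, e3, Real.sin_neg]
      push_cast
      ring
    have i3z : ip n 3 z = x * Real.cos (3 * gam n) - (1 - y) * tabR n * Real.cos (2 * gam n) := by
      rw [hz', ip_add, ip_mul, ip_mul, ip_one, ip_uvec, e3, Real.cos_neg]
      push_cast
      ring
    have him := table_im H
    refine mem_part_one H ?_ ?_ ?_ ?_
    · rw [c1z, c1]
      nlinarith
    · have k1 : 0 ≤ (1 - y - x) * (tabR n * Real.sin (2 * gam n)) :=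
        mul_nonneg (by linarith) (by positivity)
      have k2 : 0 ≤ x * (tabT n * Real.sin (2 * gam n)) := by positivity
      rw [c3z]
      nlinarith
    · rw [i1z, apo_one_three H]
      linarith
    · rw [i3z, apo_one_one' H, apo_one_three H]
      rw [i1] at h
      have k1 : (1 - y) * tabR n ≤ tabR n - Real.cos (gam n) + x * Real.cos (gam n) := by linarith
      have k2 := mul_le_mul_of_nonneg_right k1 hc2.le
      have k3 : Real.cos (3 * gam n) = Real.cos (2 * gam n) * Real.cos (gam n) -
          Real.sin (2 * gam n) * Real.sin (gam n) := by
        rw [← Real.cos_add]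
        ring_nf
      have k4 : x * (Real.sin (2 * gam n) * Real.sin (gam n)) ≤
          1 * (Real.sin (2 * gam n) * Real.sin (gam n)) :=
        mul_le_mul_of_nonneg_right (by linarith) (by positivity)
      rw [k3]
      nlinarith

theorem mem_part_of_tri_two (H : Good n) {x y : ℝ} (hx : 0 ≤ x) (hy : 0 ≤ y) (hxy : x + y ≤ 1)
    {p : ℂ} (hp : p = ctr n 0 + ((x * tabT n : ℝ) : ℂ) * uvec n 5 +
      ((y * tabS n : ℝ) : ℂ) * uvec n 3) :
    p - ctr n 0 ∈ part n 0 ∨ p - ctr n 1 ∈ part n 1 := by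
  have hs := tabS_pos H
  have hs2 := H.sin_two_pos
  have hc2 := H.cos_two_pos
  have ht := tabT_pos H
  have hc1 := cos_two_le_one (n := n)
  obtain ⟨hs4, hc4⟩ := trig_args (n := n)
  have hsq := Real.sin_sq_add_cos_sq (2 * gam n)
  set w := p - ctr n 0 with hw
  have hw' : w = ((x * tabT n : ℝ) : ℂ) * uvec n 5 + ((y * tabS n : ℝ) : ℂ) * uvec n 3 := by
    rw [hw, hp]
    ring
  have e53 : ((5 : ℝ) - (3 : ℤ)) * gam n = 2 * gam n := by push_cast; ring
  have e33 : ((3 : ℝ) - (3 : ℤ)) * gam n = 0 := by push_cast; ring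
  have e35 : ((3 : ℝ) - (5 : ℤ)) * gam n = -(2 * gam n) := by push_cast; ring
  have e55 : ((5 : ℝ) - (5 : ℤ)) * gam n = 0 := by push_cast; ring
  have e51 : ((5 : ℝ) - (1 : ℤ)) * gam n = 4 * gam n := by push_cast; ring
  have e31 : ((3 : ℝ) - (1 : ℤ)) * gam n = 2 * gam n := by push_cast; ring
  have i3 : ip n 3 w = x * tabT n * Real.cos (2 * gam n) + y * tabS n := by
    rw [hw', ip_add, ip_mul, ip_mul, ip_uvec, ip_uvec, e53, e33, Real.cos_zero, mul_one]
  have c3 : cr n 3 w = x * tabT n * Real.sin (2 * gam n) := by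
    rw [hw', cr_add, cr_mul, cr_mul, cr_uvec, cr_uvec, e53, e33, Real.sin_zero, mul_zero, add_zero]
  -- The common side of the polygons 0 and 1 ends at V 1 and makes the cut in the second triangle.
  rcases le_total (ip n 3 w) (apo n 0 3) with h | h
  · left
    refine mem_part_zero H ?_ ?_ h ?_
    · rw [c3]
      positivity
    · rw [hw', cr_add, cr_mul, cr_mul, cr_uvec, cr_uvec, e55, e35, Real.sin_zero, Real.sin_neg]
      have : 0 ≤ y * tabS n * Real.sin (2 * gam n) := by positivity
      linarith
    · rw [hw', ip_add, ip_mul, ip_mul, ip_uvec, ip_uvec, e55, e35, Real.cos_zero, Real.cos_neg,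
        apo_zero_one H]
      rw [i3, apo_zero_three H] at h
      have k1 : y * tabS n ≤ (1 - x) * tabT n * Real.cos (2 * gam n) := by linarith
      have k2 := mul_le_mul_of_nonneg_right k1 hc2.le
      have k3 : 0 ≤ (1 - x) * tabT n := mul_nonneg (by linarith) ht.le
      have k4 : 0 ≤ (1 - x) * tabT n * Real.sin (2 * gam n) ^ 2 := by positivity
      nlinarith
  · right
    set z := p - ctr n 1 with hz
    have hzw : z = w - (tabS n : ℂ) * uvec n 3 := by
      rw [hz, hw]
      simp only [ctr]
      ring
    have hz' : z = ((x * tabT n : ℝ) : ℂ) * uvec n 5 + (((y - 1) * tabS n : ℝ) : ℂ) * uvec n 3 := by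
      rw [hzw, hw']
      push_cast
      ring
    rw [i3, apo_zero_three H] at h
    refine mem_part_one H ?_ ?_ ?_ ?_
    · rw [hz', cr_add, cr_mul, cr_mul, cr_uvec, cr_uvec, e51, e31, hs4]
      have k1 := mul_le_mul_of_nonneg_left (two_tabT_le H) hx
      have k2 : x * tabS n ≤ (1 - y) * tabS n := mul_le_mul_of_nonneg_right (by linarith) hs.le
      have k3 : 0 ≤ ((1 - y) * tabS n - x * (2 * tabT n * Real.cos (2 * gam n))) *
          Real.sin (2 * gam n) := mul_nonneg (by linarith) hs2.le
      nlinarith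
    · rw [hzw, cr_sub, c3, cr_mul, cr_uvec, e33, Real.sin_zero, mul_zero, sub_zero]
      positivity
    · rw [hz', ip_add, ip_mul, ip_mul, ip_uvec, ip_uvec, e51, e31, hc4, apo_one_three' H,
        apo_one_one H]
      have k1 : (1 - y) * tabS n ≤ tabS n - tabT n * Real.cos (2 * gam n) +
          x * tabT n * Real.cos (2 * gam n) := by linarith
      have k2 := mul_le_mul_of_nonneg_right k1 hc2.le
      have k3 : x * (tabT n * Real.sin (2 * gam n) ^ 2) ≤ 1 * (tabT n * Real.sin (2 * gam n) ^ 2) :=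
        mul_le_mul_of_nonneg_right (by linarith) (by positivity)
      have k4 := congrArg (fun v => x * tabT n * v) hsq
      nlinarith
    · rw [hzw, ip_sub, i3, ip_mul, ip_uvec, e33, Real.cos_zero, mul_one, apo_one_one H]
      linarith

theorem ctr_two : ctr n 2 = 0 := rfl

theorem ctr_one : ctr n 1 = tabR n * uvec n 1 := rfl

theorem one_eq_ctr (H : Good n) : (1 : ℂ) = ctr n 0 + tabT n * uvec n 5 := by
  simp only [ctr]
  linear_combination -table_closes H

theorem tableV_two_eq (H : Good n) : tableV n 2 = ctr n 0 := tableV_two H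

/-- The table is covered by its parts. -/
theorem exists_part (H : Good n) {p : ℂ} (hp : p ∈ quadRegion (tableV n)) :
    ∃ i < 3, p - ctr n i ∈ part n i := by
  rcases hp with hp | hp
  · obtain ⟨x, y, w, hx, hy, hw, h1, rfl⟩ := mem_convexHull_triple.1 hp
    have := mem_part_of_tri_one H hy hw (by linarith)
    have e : (x : ℂ) * tableV n 0 + y * tableV n 1 + w * tableV n 3 =
        y + w * (tabR n * uvec n 1) := by
      change (x : ℂ) * 0 + y * 1 + w * (tabR n * uvec n 1) = _
      ring
    rw [e]
    rcases this with h | h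
    · exact ⟨2, by norm_num, h⟩
    · exact ⟨1, by norm_num, h⟩
  · obtain ⟨x, y, w, hx, hy, hw, h1, hp'⟩ := mem_convexHull_triple.1 hp
    have h1' : (x : ℂ) + y + w = 1 := by exact_mod_cast h1
    have := mem_part_of_tri_two H hx hw (by linarith) (p := p) (by
      rw [← hp', tableV_two_eq H]
      change (x : ℂ) * 1 + y * ctr n 0 + w * (tabR n * uvec n 1) = _
      rw [one_eq_ctr H]
      simp only [ctr]
      push_cast
      linear_combination ((tabR n : ℂ) * uvec n 1 - tabS n * uvec n 3) * h1')
    rcases this with h | h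
    · exact ⟨0, by norm_num, h⟩
    · exact ⟨1, by norm_num, h⟩

/-- The coordinates of a point with respect to two unit vectors. -/
theorem eq_of_cr (i j : ℤ) (z : ℂ) : (Real.sin ((j - i : ℤ) * gam n) : ℂ) * z =
    ((- cr n j z : ℝ) : ℂ) * uvec n i + ((cr n i z : ℝ) : ℂ) * uvec n j := by
  have e1 : ((j - i : ℤ) : ℝ) * gam n = j * gam n - i * gam n := by push_cast; ring
  rw [e1, Real.sin_sub]
  apply Complex.ext
  · simp only [cr, Complex.re_ofReal_mul, Complex.add_re, uvec_re]
    ring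
  · simp only [cr, Complex.im_ofReal_mul, Complex.add_im, uvec_im]
    ring

theorem apo_one_three_le (H : Good n) : apo n 1 3 ≤ tabR n := by
  rw [apo_one_three H]
  linarith [H.cos_one_pos]

theorem apo_one_one_le (H : Good n) : apo n 1 1 ≤ tabS n := by
  rw [apo_one_one H]
  have := mul_pos (tabT_pos H) H.cos_two_pos
  linarith

/-- The parts belong to the table. -/
theorem part_mem (H : Good n) {i : ℕ} {z : ℂ} (hi : i < 3) (hz : z ∈ part n i) :
    ctr n i + z ∈ quadRegion (tableV n) := by
  have hr := tabR_pos H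
  have hs := tabS_pos H
  have ht := tabT_pos H
  have hs1 := H.sin_one_pos
  have hs2 := H.sin_two_pos
  have hc := H.cos_one_pos
  have hc2 := H.cos_two_pos
  obtain ⟨h1, h2, h3⟩ := hz
  have v0 : tableV n 0 = 0 := rfl
  have v1 : tableV n 1 = 1 := rfl
  have v2 := tableV_two_eq H
  have v3 : tableV n 3 = tabR n * uvec n 1 := rfl
  have one := one_eq_ctr H
  interval_cases i
  · change 0 ≤ cr n 3 z at h1
    change cr n 5 z ≤ 0 at h2
    have h4 := poly_le h3 (j := 3) (by norm_num)
    have e := eq_of_cr (n := n) 3 5 z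
    set α := - cr n 5 z / Real.sin (2 * gam n) with hα
    set β := cr n 3 z / Real.sin (2 * gam n) with hβ
    have hα0 : 0 ≤ α := div_nonneg (by linarith) hs2.le
    have hβ0 : 0 ≤ β := div_nonneg h1 hs2.le
    have ez : z = (α : ℂ) * uvec n 3 + (β : ℂ) * uvec n 5 := by
      have hs2' : (Real.sin (2 * gam n) : ℂ) ≠ 0 := by exact_mod_cast hs2.ne'
      norm_num at e
      apply mul_left_cancel₀ hs2'
      rw [hα, hβ]
      push_cast at e ⊢
      push_cast at hs2'
      rw [e]
      field_simp
    have i3 : ip n 3 z = α + β * Real.cos (2 * gam n) := by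
      rw [ez, ip_add, ip_mul, ip_mul, ip_uvec, ip_uvec,
        show ((3 : ℝ) - (3 : ℤ)) * gam n = 0 by push_cast; ring,
        show ((5 : ℝ) - (3 : ℤ)) * gam n = 2 * gam n by push_cast; ring, Real.cos_zero, mul_one]
    rw [i3, apo_zero_three H] at h4
    have hle : α / tabS n + β / tabT n ≤ 1 := by
      have k1 : α ≤ (tabT n - β) * Real.cos (2 * gam n) := by linarith
      have k2 : 0 ≤ tabT n - β := by
        by_contra hlt
        nlinarith
      have k3 : α * tabT n ≤ (tabT n - β) * tabS n := by
        have := two_tabT_le H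
        have : tabT n * Real.cos (2 * gam n) ≤ tabS n := by nlinarith
        nlinarith
      rw [div_add_div _ _ hs.ne' ht.ne', div_le_one (by positivity)]
      linarith
    right
    refine mem_convexHull_triple.2 ⟨β / tabT n, 1 - (α / tabS n + β / tabT n), α / tabS n,
      by positivity, by linarith, by positivity, by ring, ?_⟩
    rw [v1, v2, v3, one, ez]
    have hs' : (tabS n : ℂ) ≠ 0 := by exact_mod_cast hs.ne'
    have ht' : (tabT n : ℂ) ≠ 0 := by exact_mod_cast ht.ne'
    simp only [ctr]
    push_cast
    field_simp
    ring
  · have h1' : cr n 1 z ≤ 0 := by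
      change 0 ≤ cr n (2 * n + 1) z at h1
      rw [cr_opp H] at h1
      linarith
    have h2' : 0 ≤ cr n 3 z := by
      change cr n (2 * n + 3) z ≤ 0 at h2
      rw [cr_opp H] at h2
      linarith
    obtain ⟨m, hm⟩ := H.odd
    have h4 := poly_le h3 (j := 2 * n + 1) (by omega)
    have h5 := poly_le h3 (j := 2 * n + 3) (by omega)
    rw [ip_opp H, apo_congr (by omega : (2 * (n : ℤ) + 1) % 4 = 3 % 4)] at h4
    rw [ip_opp H, apo_congr (by omega : (2 * (n : ℤ) + 3) % 4 = 1 % 4)] at h5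
    have e := eq_of_cr (n := n) 1 3 z
    set α := cr n 3 z / Real.sin (2 * gam n) with hα
    set β := - cr n 1 z / Real.sin (2 * gam n) with hβ
    have hα0 : 0 ≤ α := div_nonneg h2' hs2.le
    have hβ0 : 0 ≤ β := div_nonneg (by linarith) hs2.le
    have ez : z = -((α : ℂ) * uvec n 1 + (β : ℂ) * uvec n 3) := by
      have hs2' : (Real.sin (2 * gam n) : ℂ) ≠ 0 := by exact_mod_cast hs2.ne'
      norm_num at e
      apply mul_left_cancel₀ hs2'
      rw [hα, hβ]
      push_cast at e ⊢
      push_cast at hs2'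
      rw [e]
      field_simp
      ring
    have i1 : - ip n 1 z = α + β * Real.cos (2 * gam n) := by
      rw [ez, ip_neg, neg_neg, ip_add, ip_mul, ip_mul, ip_uvec, ip_uvec,
        show ((1 : ℝ) - (1 : ℤ)) * gam n = 0 by push_cast; ring,
        show ((3 : ℝ) - (1 : ℤ)) * gam n = 2 * gam n by push_cast; ring, Real.cos_zero, mul_one]
    have i3 : - ip n 3 z = α * Real.cos (2 * gam n) + β := by
      rw [ez, ip_neg, neg_neg, ip_add, ip_mul, ip_mul, ip_uvec, ip_uvec,
        show ((1 : ℝ) - (3 : ℤ)) * gam n = -(2 * gam n) by push_cast; ring,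
        show ((3 : ℝ) - (3 : ℤ)) * gam n = 0 by push_cast; ring, Real.cos_zero, Real.cos_neg, mul_one]
    rw [i1] at h4
    rw [i3] at h5
    set x1 := tabT n with hx1
    set x2 := Real.sin (gam n) / Real.sin (2 * gam n) with hx2
    have hx2pos : 0 < x2 := by positivity
    have a3 : apo n 1 3 = x1 + x2 * Real.cos (2 * gam n) := by
      have e1 : hl n 1 3 = Real.sin (gam n) := by rw [← halfSide_two]; simp [hl]
      have e2 : hl n 1 (3 + 2) = tabT n * Real.sin (2 * gam n) := by
        rw [← halfSide_one H]; simp [hl]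
      rw [apo, e1, e2, hx2]
      field_simp
      ring
    have a1 : apo n 1 1 = x1 * Real.cos (2 * gam n) + x2 := by
      have e1 : hl n 1 (1 + 2) = Real.sin (gam n) := by rw [← halfSide_two]; simp [hl]
      have e2 : hl n 1 1 = tabT n * Real.sin (2 * gam n) := by
        rw [← halfSide_one H]; simp [hl]
      rw [apo, e1, e2, hx2, hx1]
      field_simp
    -- V 1 in the oblique coordinates of the sector at V 3. The ray from V 3 through it is the
    -- diagonal that separates the two triangles of the table.
    have v1z : (1 : ℂ) = ctr n 1 - ((x1 : ℂ) * uvec n 1 + (x2 : ℂ) * uvec n 3) := by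
      have hc3 : cr n 3 (1 - ctr n 1) = x1 * Real.sin (2 * gam n) := by
        rw [cr_sub, cr_one, ctr_one, cr_mul, cr_uvec,
          show ((1 : ℝ) - (3 : ℤ)) * gam n = -(2 * gam n) by push_cast; ring, Real.sin_neg]
        have := table_im H
        push_cast
        linarith
      have hc1 : cr n 1 (1 - ctr n 1) = - Real.sin (gam n) := by
        rw [cr_sub, cr_one, ctr_one, cr_mul, cr_uvec,
          show ((1 : ℝ) - (1 : ℤ)) * gam n = 0 by push_cast; ring, Real.sin_zero]
        simp
      have e' := eq_of_cr (n := n) 1 3 (1 - ctr n 1)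
      rw [hc3, hc1] at e'
      have hs2' : (Real.sin (2 * gam n) : ℂ) ≠ 0 := by exact_mod_cast hs2.ne'
      norm_num at e'
      have : (1 : ℂ) - ctr n 1 = -((x1 : ℂ) * uvec n 1 + (x2 : ℂ) * uvec n 3) := by
        apply mul_left_cancel₀ hs2'
        rw [hx2]
        push_cast at e' ⊢
        push_cast at hs2'
        rw [e']
        field_simp
        ring
      linear_combination this
    -- The side of the diagonal from V 3 to V 1 on which the point lies decides between the
    -- triangles. The remaining barycentric bound follows from the polygon's side, since that side
    -- meets `I₃` or `I₂` before its far end.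
    rcases le_total (β * x1) (α * x2) with hcase | hcase
    · have k0 : 0 ≤ α - β * x1 / x2 := by
        rw [sub_nonneg, div_le_iff₀ hx2pos]
        exact hcase
      have hle : β / x2 + (α - β * x1 / x2) / tabR n ≤ 1 := by
        rw [a3] at h4
        have k1 : (α - β * x1 / x2) ≤ apo n 1 3 * (1 - β / x2) := by
          rw [a3]
          have : (x1 + x2 * Real.cos (2 * gam n)) * (1 - β / x2) =
            x1 + x2 * Real.cos (2 * gam n) - β * x1 / x2 - β * Real.cos (2 * gam n) := by
            field_simp
            ring
          rw [this]
          linarith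
        have k2 : 0 ≤ 1 - β / x2 := by
          by_contra hlt
          push Not at hlt
          have : 0 < apo n 1 3 := by
            rw [a3]
            positivity
          nlinarith
        have k3 : (α - β * x1 / x2) ≤ tabR n * (1 - β / x2) :=
          k1.trans (mul_le_mul_of_nonneg_right (apo_one_three_le H) k2)
        have k4 : (α - β * x1 / x2) / tabR n ≤ 1 - β / x2 := by
          rw [div_le_iff₀ hr]
          linarith
        linarith
      left
      refine mem_convexHull_triple.2 ⟨(α - β * x1 / x2) / tabR n, β / x2,
        1 - (β / x2 + (α - β * x1 / x2) / tabR n), by positivity, by positivity, by linarith,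
        by ring, ?_⟩
      rw [v0, v1, v3, ez, ctr_one]
      have hr' : (tabR n : ℂ) ≠ 0 := by exact_mod_cast hr.ne'
      have hx2' : (x2 : ℂ) ≠ 0 := by exact_mod_cast hx2pos.ne'
      rw [v1z, ctr_one]
      push_cast
      field_simp
      ring
    · have k0 : 0 ≤ β - α * x2 / x1 := by
        rw [sub_nonneg, div_le_iff₀ ht]
        exact hcase
      have hle : α / x1 + (β - α * x2 / x1) / tabS n ≤ 1 := by
        rw [a1] at h5
        have k1 : (β - α * x2 / x1) ≤ apo n 1 1 * (1 - α / x1) := by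
          rw [a1]
          have : (x1 * Real.cos (2 * gam n) + x2) * (1 - α / x1) =
            x1 * Real.cos (2 * gam n) + x2 - α * x2 / x1 - α * Real.cos (2 * gam n) := by
            field_simp
            ring
          rw [this]
          linarith
        have k2 : 0 ≤ 1 - α / x1 := by
          by_contra hlt
          push Not at hlt
          have : 0 < apo n 1 1 := by
            rw [a1]
            positivity
          nlinarith
        have k3 : (β - α * x2 / x1) ≤ tabS n * (1 - α / x1) :=
          k1.trans (mul_le_mul_of_nonneg_right (apo_one_one_le H) k2)
        have k4 : (β - α * x2 / x1) / tabS n ≤ 1 - α / x1 := by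
          rw [div_le_iff₀ hs]
          linarith
        linarith
      right
      refine mem_convexHull_triple.2 ⟨α / x1, (β - α * x2 / x1) / tabS n,
        1 - (α / x1 + (β - α * x2 / x1) / tabS n), by positivity, by positivity, by linarith,
        by ring, ?_⟩
      rw [v2, v1, v3, ez, ctr_one]
      have hs' : (tabS n : ℂ) ≠ 0 := by exact_mod_cast hs.ne'
      have hx1' : (x1 : ℂ) ≠ 0 := by exact_mod_cast ht.ne'
      rw [v1z]
      simp only [ctr]
      push_cast
      field_simp
      ring
  · change 0 ≤ cr n 0 z at h1
    change cr n 1 z ≤ 0 at h2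
    have h4 := poly_le h3 (j := 1) (by norm_num)
    have e := eq_of_cr (n := n) 0 1 z
    set α := - cr n 1 z / Real.sin (gam n) with hα
    set β := cr n 0 z / Real.sin (gam n) with hβ
    have hα0 : 0 ≤ α := div_nonneg (by linarith) hs1.le
    have hβ0 : 0 ≤ β := div_nonneg h1 hs1.le
    have ez : z = (α : ℂ) + (β : ℂ) * uvec n 1 := by
      have hs2' : (Real.sin (gam n) : ℂ) ≠ 0 := by exact_mod_cast hs1.ne'
      norm_num at e
      apply mul_left_cancel₀ hs2'
      rw [hα, hβ]
      push_cast at e ⊢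
      push_cast at hs2'
      rw [e]
      field_simp
    have i1 : ip n 1 z = α * Real.cos (gam n) + β := by
      rw [ez, ← mul_one (α : ℂ), ip_add, ip_mul, ip_mul, ip_uvec, ip_one,
        show ((1 : ℝ) - (1 : ℤ)) * gam n = 0 by push_cast; ring, Real.cos_zero]
      simp
    rw [i1, apo_two H] at h4
    have hle : α + β / tabR n ≤ 1 := by
      have k1 : β ≤ (1 - α) * Real.cos (gam n) := by linarith
      have k2 : 0 ≤ 1 - α := by
        by_contra hlt
        nlinarith
      have k3 : β / tabR n ≤ 1 - α := by
        rw [div_le_iff₀ hr]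
        exact k1.trans (mul_le_mul_of_nonneg_left (cos_le_tabR H).le k2)
      linarith
    left
    refine mem_convexHull_triple.2 ⟨1 - (α + β / tabR n), α, β / tabR n,
      by linarith, by positivity, by positivity, by ring, ?_⟩
    have hr' : (tabR n : ℂ) ≠ 0 := by exact_mod_cast hr.ne'
    rw [v0, v1, v3, ez, ctr_two]
    push_cast
    field_simp
    ring

end

/-! ### The reflection group -/

/-- The rotation by the angle `k π / n`. -/
def IsRot (n : ℕ) (g : ℂ ≃ₗᵢ[ℝ] ℂ) (k : ℤ) : Prop := ∀ z, g z = uvec n (2 * k) * z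

/-- The reflection in the line of angle `k π / (2 n)`. -/
def IsRef (n : ℕ) (g : ℂ ≃ₗᵢ[ℝ] ℂ) (k : ℤ) : Prop :=
  ∀ z, g z = uvec n (2 * k) * (starRingEnd ℂ) z

section

variable {n : ℕ} {g h : ℂ ≃ₗᵢ[ℝ] ℂ} {a b : ℤ}

theorem apply_inv_apply (g : ℂ ≃ₗᵢ[ℝ] ℂ) (z : ℂ) : g (g⁻¹ z) = z := g.apply_symm_apply z

theorem inv_apply_apply (g : ℂ ≃ₗᵢ[ℝ] ℂ) (z : ℂ) : g⁻¹ (g z) = z := g.symm_apply_apply z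

theorem isRot_one : IsRot n 1 0 := by
  intro z
  simp

theorem IsRot.mul (hg : IsRot n g a) (hh : IsRot n h b) : IsRot n (g * h) (a + b) := by
  intro z
  change g (h z) = _
  rw [hg, hh, ← mul_assoc, ← uvec_add]
  push_cast
  ring_nf

theorem IsRot.mul_ref (hg : IsRot n g a) (hh : IsRef n h b) : IsRef n (g * h) (a + b) := by
  intro z
  change g (h z) = _
  rw [hg, hh, ← mul_assoc, ← uvec_add]
  push_cast
  ring_nf

theorem IsRef.mul_rot (hg : IsRef n g a) (hh : IsRot n h b) : IsRef n (g * h) (a - b) := by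
  intro z
  change g (h z) = _
  rw [hg, hh, map_mul, conj_uvec, ← mul_assoc, ← uvec_add]
  push_cast
  ring_nf

theorem IsRef.mul (hg : IsRef n g a) (hh : IsRef n h b) : IsRot n (g * h) (a - b) := by
  intro z
  change g (h z) = _
  rw [hg, hh, map_mul, conj_uvec, Complex.conj_conj, ← mul_assoc, ← uvec_add]
  push_cast
  ring_nf

theorem IsRot.inv (hg : IsRot n g a) : IsRot n g⁻¹ (-a) := by
  intro z
  apply g.injective
  rw [apply_inv_apply, hg, ← mul_assoc, ← uvec_add]
  push_cast
  rw [show 2 * (a : ℝ) + 2 * -a = 0 by ring, uvec_zero, one_mul]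

theorem IsRef.inv (hg : IsRef n g a) : IsRef n g⁻¹ a := by
  intro z
  apply g.injective
  rw [apply_inv_apply, hg, map_mul, conj_uvec,
    Complex.conj_conj, ← mul_assoc, ← uvec_add, add_neg_cancel, uvec_zero, one_mul]

theorem IsRot.ext (hg : IsRot n g a) (hh : IsRot n h b) (e : uvec n (2 * a) = uvec n (2 * b)) :
    g = h := by
  ext z
  rw [hg, hh, e]

theorem IsRef.ext (hg : IsRef n g a) (hh : IsRef n h b) (e : uvec n (2 * a) = uvec n (2 * b)) :
    g = h := by
  ext z
  rw [hg, hh, e]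

theorem IsRot.zpow (hg : IsRot n g a) (k : ℤ) : IsRot n (g ^ k) (k * a) := by
  have hnat : ∀ m : ℕ, IsRot n (g ^ m) (m * a) := by
    intro m
    induction m with
    | zero => simpa using isRot_one
    | succ m ih =>
      have := ih.mul hg
      rw [pow_succ]
      push_cast
      rwa [add_mul, one_mul]
  obtain ⟨m, rfl | rfl⟩ := k.eq_nat_or_neg
  · simpa using hnat m
  · rw [zpow_neg, zpow_natCast, neg_mul]
    exact (hnat m).inv

/-- The reflection in a line of angle `x π / (2 n)`. -/
theorem reflection_span {w : ℂ} {ρ : ℝ} {k : ℤ} (hρ : ρ ≠ 0) (hw : w = ρ * uvec n k) :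
    IsRef n (Submodule.span ℝ {w}).reflection k := by
  intro z
  have e : ((‖w‖ : ℝ) ^ 2) = ρ ^ 2 := by
    rw [hw, norm_mul, norm_uvec, mul_one, Complex.norm_real, Real.norm_eq_abs, sq_abs]
  rw [Submodule.reflection_singleton_apply]
  have hin : inner ℝ w z = ρ * (Real.cos (k * gam n) * z.re + Real.sin (k * gam n) * z.im) := by
    rw [Complex.inner, hw]
    simp only [Complex.mul_re, Complex.mul_im, Complex.conj_re, Complex.conj_im,
      Complex.ofReal_re, Complex.ofReal_im, uvec_re, uvec_im]
    ring
  simp only [RCLike.ofReal_real_eq_id, id]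
  rw [hin, e, hw]
  have e2 : uvec n (2 * k) = uvec n k * uvec n k := by
    rw [← uvec_add]
    ring_nf
  rw [e2]
  have h1 := Real.sin_sq_add_cos_sq (k * gam n)
  apply Complex.ext
  · simp only [nsmul_eq_mul, Complex.sub_re, Complex.mul_re, Complex.real_smul, Complex.ofReal_re,
      Complex.ofReal_im, uvec_re, uvec_im, Complex.conj_re, Complex.conj_im, Complex.mul_im,
      Nat.cast_ofNat, Complex.re_ofNat, Complex.im_ofNat]
    field_simp
    linear_combination (z.re * ρ) * h1
  · simp only [nsmul_eq_mul, Complex.sub_im, Complex.mul_re, Complex.real_smul, Complex.ofReal_re,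
      Complex.ofReal_im, uvec_re, uvec_im, Complex.conj_re, Complex.conj_im, Complex.mul_im,
      Nat.cast_ofNat, Complex.re_ofNat, Complex.im_ofNat]
    field_simp
    linear_combination (z.im * ρ) * h1

/-- The direction of the `i`-th side of the table. -/
def sideDir : Fin 4 → ℤ := ![0, 5, 3, 1]

theorem isRef_side (H : Good n) (i : Fin 4) : IsRef n (sideReflection (tableV n) i) (sideDir i) := by
  have hr := tabR_pos H
  have hs := tabS_pos H
  have ht := tabT_pos H
  unfold sideReflection
  fin_cases i
  · refine reflection_span (ρ := 1) one_ne_zero ?_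
    change (1 : ℂ) - 0 = _
    simp [sideDir]
  · refine reflection_span (ρ := - tabT n) (by linarith) ?_
    change (1 - tabT n * uvec n 5 : ℂ) - 1 = ((- tabT n : ℝ) : ℂ) * uvec n ((5 : ℤ) : ℝ)
    push_cast
    ring
  · refine reflection_span (ρ := tabS n) hs.ne' ?_
    change tableV n 3 - tableV n 2 = (tabS n : ℂ) * uvec n ((3 : ℤ) : ℝ)
    rw [tableV_two H]
    change (tabR n * uvec n 1 : ℂ) - _ = _
    push_cast
    ring
  · refine reflection_span (ρ := - tabR n) (by linarith) ?_
    change (0 : ℂ) - tabR n * uvec n 1 = ((- tabR n : ℝ) : ℂ) * uvec n ((1 : ℤ) : ℝ)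
    push_cast
    ring

/-- The reflection group of the table. -/
abbrev Grp (n : ℕ) : Subgroup (ℂ ≃ₗᵢ[ℝ] ℂ) := reflectionGroup (tableV n)

theorem isRef_sideGen (H : Good n) (i : Fin 4) :
    IsRef n (sideGen (tableV n) i : Grp n).1 (sideDir i) := isRef_side H i

theorem rot_or_ref (H : Good n) (g : Grp n) : ∃ k : ℤ, IsRot n g.1 k ∨ IsRef n g.1 k := by
  obtain ⟨g, hg⟩ := g
  change ∃ k : ℤ, IsRot n g k ∨ IsRef n g k
  induction hg using Subgroup.closure_induction with
  | mem x hx =>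
    obtain ⟨i, rfl⟩ := hx
    exact ⟨_, Or.inr (isRef_side H i)⟩
  | one => exact ⟨0, Or.inl isRot_one⟩
  | mul x y _ _ hx hy =>
    obtain ⟨k, hk | hk⟩ := hx <;> obtain ⟨l, hl | hl⟩ := hy
    · exact ⟨_, Or.inl (hk.mul hl)⟩
    · exact ⟨_, Or.inr (hk.mul_ref hl)⟩
    · exact ⟨_, Or.inr (hk.mul_rot hl)⟩
    · exact ⟨_, Or.inl (hk.mul hl)⟩
  | inv x _ hx =>
    obtain ⟨k, hk | hk⟩ := hx
    · exact ⟨_, Or.inl hk.inv⟩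
    · exact ⟨_, Or.inr hk.inv⟩

theorem exists_rot (H : Good n) (k : ℤ) : ∃ g : Grp n, IsRot n g.1 k := by
  have h1 := ((isRef_sideGen H 3).mul (isRef_sideGen H 0)).zpow k
  rw [show sideDir 3 - sideDir 0 = 1 by decide, mul_one] at h1
  refine ⟨(sideGen (tableV n) 3 * sideGen (tableV n) 0) ^ k, ?_⟩
  rw [Subgroup.coe_zpow, Subgroup.coe_mul]
  exact h1

theorem exists_ref (H : Good n) (k : ℤ) : ∃ g : Grp n, IsRef n g.1 k := by
  obtain ⟨g, hg⟩ := exists_rot H k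
  have := hg.mul_ref (isRef_sideGen H 0)
  rw [show sideDir 0 = 0 by decide, add_zero] at this
  refine ⟨g * sideGen (tableV n) 0, ?_⟩
  rw [Subgroup.coe_mul]
  exact this

theorem uvec_periodic (H : Good n) (x : ℝ) (q : ℤ) : uvec n (x + 4 * n * q) = uvec n x := by
  simp only [uvec]
  rw [cos_four_n_mul H, sin_four_n_mul H]

/-- Two angles with the same direction differ by a multiple of `2π`. -/
theorem uvec_inj (H : Good n) {x y : ℝ} (h : uvec n x = uvec n y) : ∃ q : ℤ, x = y + 4 * n * q := by
  have h1 : uvec n (x - y) = 1 := by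
    rw [sub_eq_add_neg, uvec_add, h, mul_comm, uvec_neg_mul]
  have h2 := congrArg Complex.re h1
  rw [uvec_re, Complex.one_re, Real.cos_eq_one_iff] at h2
  obtain ⟨q, hq⟩ := h2
  refine ⟨q, ?_⟩
  have hg := H.gam_pos
  rw [← H.gam_mul] at hq
  apply mul_right_cancel₀ hg.ne'
  linarith

/-- Finiteness is needed for the covers by copies of parts in `affLift_phi` and `affLift_kappa`. -/
theorem finite_grp (H : Good n) : Finite (Grp n) := by
  have h7 := H.seven_le
  choose k hk using rot_or_ref H
  have key : ∀ k : ℤ, uvec n (2 * ((k % (2 * n : ℤ) : ℤ) : ℝ)) = uvec n (2 * k) := by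
    intro k
    have := Int.emod_add_mul_ediv k (2 * n)
    have h2 : (2 * (k : ℝ)) = 2 * ((k % (2 * n : ℤ) : ℤ) : ℝ) + 4 * n * ((k / (2 * n) : ℤ) : ℝ) := by
      have h3 : (k : ℝ) = ((k % (2 * n) + 2 * n * (k / (2 * n)) : ℤ) : ℝ) := by rw [this]
      push_cast at h3 ⊢
      linarith
    rw [h2, uvec_periodic H]
  let F : Grp n → Finset.Ico (0 : ℤ) (2 * n) × Prop := fun g =>
    (⟨k g % (2 * n), by
      rw [Finset.mem_Ico]
      exact ⟨Int.emod_nonneg _ (by omega), Int.emod_lt_of_pos _ (by omega)⟩⟩, IsRot n g.1 (k g))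
  refine Finite.of_injective F ?_
  intro g g' hgg
  have e1 : k g % (2 * n) = k g' % (2 * n) := congrArg (fun p => (p.1 : ℤ)) hgg
  have e2 : IsRot n g.1 (k g) = IsRot n g'.1 (k g') := congrArg (fun p => p.2) hgg
  have e3 : uvec n (2 * k g) = uvec n (2 * k g') := by rw [← key, ← key (k g'), e1]
  apply Subtype.ext
  by_cases hrot : IsRot n g.1 (k g)
  · exact hrot.ext (e2 ▸ hrot) e3
  · have hrot' : ¬ IsRot n g'.1 (k g') := fun h => hrot (e2.symm ▸ h)
    exact ((hk g).resolve_left hrot).ext ((hk g').resolve_left hrot') e3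

/-! ### Parity of group elements and its action on the five polygons -/

/-- The elements which preserve each of the five polygons. -/
def IsPos (n : ℕ) (g : ℂ ≃ₗᵢ[ℝ] ℂ) : Prop := ∃ k : ℤ, IsRot n g (2 * k) ∨ IsRef n g (2 * k + 1)

/-- The elements which reverse the order of the five polygons. -/
def IsNeg (n : ℕ) (g : ℂ ≃ₗᵢ[ℝ] ℂ) : Prop := ∃ k : ℤ, IsRot n g (2 * k + 1) ∨ IsRef n g (2 * k)

theorem pos_or_neg (H : Good n) (g : Grp n) : IsPos n g.1 ∨ IsNeg n g.1 := by
  obtain ⟨k, hk⟩ := rot_or_ref H g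
  obtain ⟨m, rfl | rfl⟩ := k.even_or_odd'
  · rcases hk with h | h
    · exact Or.inl ⟨m, Or.inl h⟩
    · exact Or.inr ⟨m, Or.inr h⟩
  · rcases hk with h | h
    · exact Or.inr ⟨m, Or.inl h⟩
    · exact Or.inl ⟨m, Or.inr h⟩

theorem IsPos.mul (hg : IsPos n g) (hh : IsPos n h) : IsPos n (g * h) := by
  obtain ⟨k, hk | hk⟩ := hg <;> obtain ⟨l, hl | hl⟩ := hh
  · exact ⟨k + l, Or.inl (by convert hk.mul hl using 1; ring)⟩
  · exact ⟨k + l, Or.inr (by convert hk.mul_ref hl using 1; ring)⟩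
  · exact ⟨k - l, Or.inr (by convert hk.mul_rot hl using 1; ring)⟩
  · exact ⟨k - l, Or.inl (by convert hk.mul hl using 1; ring)⟩

theorem IsPos.inv (hg : IsPos n g) : IsPos n g⁻¹ := by
  obtain ⟨k, hk | hk⟩ := hg
  · exact ⟨-k, Or.inl (by convert hk.inv using 1; ring)⟩
  · exact ⟨k, Or.inr hk.inv⟩

theorem IsNeg.mul (hg : IsNeg n g) (hh : IsNeg n h) : IsPos n (g * h) := by
  obtain ⟨k, hk | hk⟩ := hg <;> obtain ⟨l, hl | hl⟩ := hh
  · exact ⟨k + l + 1, Or.inl (by convert hk.mul hl using 1; ring)⟩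
  · exact ⟨k + l, Or.inr (by convert hk.mul_ref hl using 1; ring)⟩
  · exact ⟨k - l - 1, Or.inr (by convert hk.mul_rot hl using 1; ring)⟩
  · exact ⟨k - l, Or.inl (by convert hk.mul hl using 1; ring)⟩

theorem IsNeg.inv (hg : IsNeg n g) : IsNeg n g⁻¹ := by
  obtain ⟨k, hk | hk⟩ := hg
  · exact ⟨-k - 1, Or.inl (by convert hk.inv using 1; ring)⟩
  · exact ⟨k, Or.inr hk.inv⟩

/-- Parity is meaningful because exponents of rotations and reflections are determined modulo 2n, an
even number. This one odd element is enough to separate `IsPos` from `IsNeg`. -/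
theorem not_isPos_side_zero (H : Good n) : ¬ IsPos n (sideGen (tableV n) 0 : Grp n).1 := by
  rintro ⟨k, hk | hk⟩
  · have h1 := hk 1
    have h2 := hk Complex.I
    have h3 := isRef_sideGen H 0 1
    have h4 := isRef_sideGen H 0 Complex.I
    rw [h1] at h3
    rw [h2] at h4
    simp only [sideDir, Matrix.cons_val_zero, Int.cast_zero, mul_zero, uvec_zero, map_one,
      mul_one, one_mul, Complex.conj_I] at h3 h4
    rw [h3, one_mul] at h4
    have := congrArg Complex.im h4
    norm_num at this
  · have h1 := hk 1
    have h3 := isRef_sideGen H 0 1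
    rw [h1] at h3
    simp only [sideDir, Matrix.cons_val_zero, Int.cast_zero, mul_zero, map_one, mul_one] at h3
    obtain ⟨q, hq⟩ := uvec_inj H h3
    have : (2 * (2 * k + 1) : ℤ) = 4 * (n * q) := by
      have h5 : ((2 * (2 * k + 1) : ℤ) : ℝ) = ((4 * (n * q) : ℤ) : ℝ) := by
        push_cast at hq ⊢
        linarith
      exact_mod_cast h5
    omega

theorem ip_rot (hg : IsRot n g a) (j : ℤ) (z : ℂ) : ip n j (g z) = ip n (j - 2 * a) z := by
  rw [hg]
  simp only [ip, Complex.mul_re, Complex.mul_im, uvec_re, uvec_im]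
  push_cast
  rw [sub_mul (j : ℝ), Real.cos_sub, Real.sin_sub]
  ring

theorem ip_ref (hg : IsRef n g a) (j : ℤ) (z : ℂ) : ip n j (g z) = ip n (2 * a - j) z := by
  rw [hg]
  simp only [ip, Complex.mul_re, Complex.mul_im, uvec_re, uvec_im, Complex.conj_re, Complex.conj_im]
  push_cast
  rw [sub_mul (2 * (a : ℝ)), Real.cos_sub, Real.sin_sub]
  ring

theorem rot_uvec (hg : IsRot n g a) (x : ℝ) : g (uvec n x) = uvec n (2 * a + x) := by
  rw [hg, uvec_add]

theorem ref_uvec (hg : IsRef n g a) (x : ℝ) : g (uvec n x) = uvec n (2 * a - x) := by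
  rw [hg, conj_uvec, sub_eq_add_neg, uvec_add]

/-- Elements that preserve the polygons preserve the two types of normals. -/
theorem IsPos.dir (hg : IsPos n g) {j : ℤ} (hj : j % 2 = 1) : ∃ j' : ℤ, j' % 4 = j % 4 ∧
    g (uvec n j) = uvec n j' ∧ ∀ z, ip n j' (g z) = ip n j z := by
  obtain ⟨k, hk | hk⟩ := hg
  · refine ⟨j + 4 * k, by omega, ?_, fun z => ?_⟩
    · rw [rot_uvec hk]
      push_cast
      ring_nf
    · rw [ip_rot hk]
      congr 1
      ring
  · refine ⟨4 * k + 2 - j, by omega, ?_, fun z => ?_⟩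
    · rw [ref_uvec hk]
      push_cast
      ring_nf
    · rw [ip_ref hk]
      congr 1
      ring

theorem IsNeg.dir (hg : IsNeg n g) {j : ℤ} (hj : j % 2 = 1) : ∃ j' : ℤ, j' % 4 = (j + 2) % 4 ∧
    g (uvec n j) = uvec n j' ∧ ∀ z, ip n j' (g z) = ip n j z := by
  obtain ⟨k, hk | hk⟩ := hg
  · refine ⟨j + 4 * k + 2, by omega, ?_, fun z => ?_⟩
    · rw [rot_uvec hk]
      push_cast
      ring_nf
    · rw [ip_rot hk]
      congr 1
      ring
  · refine ⟨4 * k - j, by omega, ?_, fun z => ?_⟩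
    · rw [ref_uvec hk]
      push_cast
      ring_nf
    · rw [ip_ref hk]
      congr 1
      ring

theorem hl_reflect {c : ℕ} (hc : c < 5) {j : ℤ} (hj : j % 2 = 1) :
    hl n (4 - c) j = hl n c (j + 2) := by
  unfold hl
  rcases (by omega : j % 4 = 1 ∨ j % 4 = 3) with h | h
  · rw [if_neg (by omega), if_pos (by omega), ← halfSide_reflect (by omega)]
    congr 1
    omega
  · rw [if_pos (by omega), if_neg (by omega), ← halfSide_reflect (by omega)]
    congr 1
    omega

theorem apo_reflect {c : ℕ} (hc : c < 5) {j : ℤ} (hj : j % 2 = 1) :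
    apo n (4 - c) j = apo n c (j + 2) := by
  unfold apo
  rw [hl_reflect hc hj, hl_reflect hc (by omega)]

theorem IsPos.mem_poly (hg : IsPos n g) {c : ℕ} {z : ℂ} (hz : z ∈ poly n c) : g z ∈ poly n c := by
  intro k
  obtain ⟨j', h1, h2, h3⟩ := hg.inv.dir (j := 2 * k + 1) (by omega)
  have h4 := h3 (g z)
  rw [inv_apply_apply] at h4
  rw [← h4, ← apo_congr h1]
  exact poly_le hz (by omega)

theorem IsNeg.mem_poly (hg : IsNeg n g) {c : ℕ} (hc : c < 5) {z : ℂ} (hz : z ∈ poly n c) :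
    g z ∈ poly n (4 - c) := by
  intro k
  obtain ⟨j', h1, h2, h3⟩ := hg.inv.dir (j := 2 * k + 1) (by omega)
  have h4 := h3 (g z)
  rw [inv_apply_apply] at h4
  rw [← h4, apo_reflect hc (by omega), ← apo_congr h1]
  exact poly_le hz (by omega)

open Classical in
/-- The index of the polygon to which `g` maps the polygon `i`. -/
def lab (n : ℕ) (g : ℂ ≃ₗᵢ[ℝ] ℂ) (i : ℕ) : ℕ := if IsPos n g then i else 4 - i

theorem lab_lt {i : ℕ} (hi : i < 3) : lab n g i < 5 := by
  unfold lab
  split_ifs <;> omega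

theorem lab_two : lab n g 2 = 2 := by
  unfold lab
  split_ifs <;> rfl

theorem mem_poly_lab (H : Good n) (g : Grp n) {i : ℕ} (hi : i < 3) {z : ℂ} (hz : z ∈ poly n i) :
    g.1 z ∈ poly n (lab n g.1 i) := by
  unfold lab
  split_ifs with h
  · exact h.mem_poly hz
  · exact ((pos_or_neg H g).resolve_left h).mem_poly (by omega) hz

theorem lab_mul_pos (hh : IsPos n h) (i : ℕ) : lab n (g * h) i = lab n g i := by
  have : IsPos n (g * h) ↔ IsPos n g := by
    constructor
    · intro h1
      have := h1.mul hh.inv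
      rwa [mul_assoc, mul_inv_cancel, mul_one] at this
    · exact fun h1 => h1.mul hh
  unfold lab
  by_cases hg : IsPos n g
  · rw [if_pos hg, if_pos (this.2 hg)]
  · rw [if_neg hg, if_neg (fun h1 => hg (this.1 h1))]

/-- The point of the polygons that corresponds to a point of the polygon `i` in the copy `g`. -/
def pt (H : Good n) (g : Grp n) (i : ℕ) (hi : i < 3) (z : ℂ) (hz : z ∈ poly n i) : Pts n :=
  ⟨(lab n g.1 i, g.1 z), lab_lt hi, mem_poly_lab H g hi hz⟩

theorem pt_congr (H : Good n) {g g' : Grp n} {i i' : ℕ} {hi : i < 3} {hi' : i' < 3} {z z' : ℂ}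
    {hz : z ∈ poly n i} {hz' : z' ∈ poly n i'} (h1 : lab n g.1 i = lab n g'.1 i')
    (h2 : g.1 z = g'.1 z') : pt H g i hi z hz = pt H g' i' hi' z' hz' :=
  Subtype.ext (Prod.ext h1 h2)

/-- Gluing between the polygons `1` and `2`. -/
theorem pmk_one_two (H : Good n) (g : Grp n) {p : ℂ} (h1 : p - ctr n 1 ∈ poly n 1)
    (h2 : p - ctr n 2 ∈ poly n 2) (h : ip n 1 p = Real.cos (gam n)) :
    pmk (pt H g 1 (by norm_num) _ h1) = pmk (pt H g 2 (by norm_num) _ h2) := by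
  obtain ⟨m, hm⟩ := H.odd
  have e1 : uvec n ((2 * n + 1 : ℤ) : ℝ) = - uvec n 1 := by
    push_cast
    rw [add_comm, uvec_add_two_n H]
  by_cases hp : IsPos n g.1
  · apply Quot.sound
    obtain ⟨j, hj1, hj2, hj3⟩ := hp.dir (j := 2 * n + 1) (by omega)
    refine ⟨j, by omega, ?_, ?_, ?_⟩
    · simp [pt, lab, hp]
    · simp only [pt, lab, hp, if_true]
      rw [hj3, ip_opp H, ip_sub, h, ctr_one, ip_mul, ip_uvec,
        apo_congr (by omega : j % 4 = 3 % 4), apo_one_three H]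
      norm_num
    · simp only [pt, lab, hp, if_true, ctr_two, sub_zero]
      rw [centerDist_one H, ← hj2, e1, ctr_one]
      simp only [map_sub, map_neg]
      rw [← Complex.real_smul, ← Complex.real_smul, map_smul]
      simp
  -- An element that reverses the order sends the polygons 1 and 2 to 3 and 2, and the gluing
  -- relation is directed from the smaller index to the larger one.
  · symm
    apply Quot.sound
    obtain ⟨j, hj1, hj2, hj3⟩ := ((pos_or_neg H g).resolve_left hp).dir (j := 1) (by norm_num)
    refine ⟨j, by omega, ?_, ?_, ?_⟩
    · simp [pt, lab, hp]
    · simp only [pt, lab_two]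
      rw [hj3, ctr_two, sub_zero, h, apo_two H]
    · simp only [pt, lab_two, ctr_two, sub_zero]
      rw [← centerDist_reflect H (by norm_num : 2 < 4), centerDist_one H, ← hj2, ctr_one]
      simp only [map_sub]
      rw [← Complex.real_smul, ← Complex.real_smul, map_smul]
      simp

/-- Gluing between the polygons `0` and `1`. -/
theorem pmk_zero_one (H : Good n) (g : Grp n) {p : ℂ} (h0 : p - ctr n 0 ∈ poly n 0)
    (h1 : p - ctr n 1 ∈ poly n 1) (h : ip n 3 (p - ctr n 0) = apo n 0 3) :
    pmk (pt H g 0 (by norm_num) _ h0) = pmk (pt H g 1 (by norm_num) _ h1) := by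
  obtain ⟨m, hm⟩ := H.odd
  have e1 : uvec n ((2 * n + 3 : ℤ) : ℝ) = - uvec n 3 := by
    push_cast
    rw [add_comm, uvec_add_two_n H]
  have ec : p - ctr n 1 = (p - ctr n 0) - tabS n * uvec n 3 := by
    simp only [ctr]
    ring
  by_cases hp : IsPos n g.1
  · apply Quot.sound
    obtain ⟨j, hj1, hj2, hj3⟩ := hp.dir (j := 3) (by norm_num)
    refine ⟨j, by omega, ?_, ?_, ?_⟩
    · simp [pt, lab, hp]
    · simp only [pt, lab, hp, if_true]
      rw [hj3, h]
      exact apo_congr (by omega)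
    · simp only [pt, lab, hp, if_true]
      rw [centerDist_zero H, ← hj2, ec, map_sub, ← Complex.real_smul, ← Complex.real_smul, map_smul]
      simp
  · symm
    apply Quot.sound
    obtain ⟨j, hj1, hj2, hj3⟩ := ((pos_or_neg H g).resolve_left hp).dir (j := 2 * n + 3) (by omega)
    refine ⟨j, by omega, ?_, ?_, ?_⟩
    · simp [pt, lab, hp]
    · simp only [pt, lab, hp, if_false]
      rw [hj3, ip_opp H, ec, ip_sub, h, ip_mul, ip_uvec, apo_reflect (by norm_num) (by omega),
        apo_congr (by omega : (j + 2) % 4 = 1 % 4), apo_one_one H, apo_zero_three H]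
      norm_num
    · simp only [pt, lab, hp, if_false]
      rw [show 4 - 1 = 3 - 0 by norm_num, centerDist_reflect H (by norm_num : 0 < 4),
        centerDist_zero H, ← hj2, e1, ec]
      simp only [map_sub, map_neg]
      rw [← Complex.real_smul, ← Complex.real_smul, map_smul]
      simp

/-- The vertex with the reflex angle, in each of the three polygons. -/
theorem part_zero_two (H : Good n) {p : ℂ} (h0 : p - ctr n 0 ∈ part n 0)
    (h2 : p - ctr n 2 ∈ part n 2) : p = 1 := by
  obtain ⟨a1, a2, a3⟩ := h0
  obtain ⟨b1, b2, b3⟩ := h2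
  change 0 ≤ cr n 3 _ at a1
  change cr n 5 _ ≤ 0 at a2
  change 0 ≤ cr n 0 _ at b1
  rw [ctr_two, sub_zero] at b1
  have hs2 := H.sin_two_pos
  have hc2 := H.cos_two_pos
  have hc3 : 0 < Real.cos (3 * gam n) := H.cos_pos (by linarith [H.pos]) (by
    have := H.seven_le
    norm_cast
    omega)
  have hs3 : 0 < Real.sin (3 * gam n) := H.sin_pos (by norm_num) (by
    have := H.seven_le
    norm_cast
    omega)
  have i3 := poly_le a3 (j := 3) (by norm_num)
  rw [apo_zero_three H] at i3
  set w := p - ctr n 0 with hw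
  have e := eq_of_cr (n := n) 3 5 w
  have hs2' : (Real.sin (2 * gam n) : ℂ) ≠ 0 := by exact_mod_cast hs2.ne'
  norm_num at e
  set α := - cr n 5 w / Real.sin (2 * gam n) with hα
  set β := cr n 3 w / Real.sin (2 * gam n) with hβ
  have hα0 : 0 ≤ α := div_nonneg (by linarith) hs2.le
  have ez : w = (α : ℂ) * uvec n 3 + (β : ℂ) * uvec n 5 := by
    apply mul_left_cancel₀ hs2'
    rw [hα, hβ]
    push_cast at e ⊢
    push_cast at hs2'
    rw [e]
    field_simp
  have hp : p = 1 + ((α : ℂ) * uvec n 3 + ((β - tabT n : ℝ) : ℂ) * uvec n 5) := by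
    have : p = ctr n 0 + w := by
      rw [hw]
      ring
    rw [this, ez, one_eq_ctr H]
    push_cast
    ring
  have j3 : ip n 3 w = α + β * Real.cos (2 * gam n) := by
    rw [ez, ip_add, ip_mul, ip_mul, ip_uvec, ip_uvec,
      show ((3 : ℝ) - (3 : ℤ)) * gam n = 0 by push_cast; ring,
      show ((5 : ℝ) - (3 : ℤ)) * gam n = 2 * gam n by push_cast; ring, Real.cos_zero, mul_one]
  rw [j3] at i3
  have b1' : 0 ≤ α * Real.sin (3 * gam n) + (β - tabT n) * Real.sin (5 * gam n) := by
    rw [hp, cr_add, cr_one, cr_add, cr_mul, cr_mul, cr_uvec, cr_uvec] at b1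
    simpa using b1
  have e5 : Real.sin (5 * gam n) = Real.sin (3 * gam n) * Real.cos (2 * gam n) +
      Real.cos (3 * gam n) * Real.sin (2 * gam n) := by
    rw [← Real.sin_add]
    ring_nf
  rw [e5] at b1'
  have k1 : α ≤ (tabT n - β) * Real.cos (2 * gam n) := by linarith
  have k2 : 0 ≤ tabT n - β := by
    by_contra hlt
    nlinarith
  have k3 := mul_le_mul_of_nonneg_right k1 hs3.le
  have k4 : (tabT n - β) * (Real.cos (3 * gam n) * Real.sin (2 * gam n)) ≤ 0 := by nlinarith
  have k5 : tabT n - β = 0 := by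
    rcases k2.eq_or_lt with h | h
    · exact h.symm
    · have := mul_pos h (mul_pos hc3 hs2)
      linarith
  have k6 : α = 0 := by
    rw [k5, zero_mul] at k1
    linarith
  rw [hp, k6, show β - tabT n = 0 by linarith]
  simp

theorem one_mem_parts (H : Good n) : (1 : ℂ) - ctr n 1 ∈ part n 1 ∧
    ip n 1 1 = Real.cos (gam n) ∧ ip n 3 (1 - ctr n 0) = apo n 0 3 := by
  refine ⟨?_, ?_, ?_⟩
  · have him := table_im H
    have hre := table_re H
    have ht := tabT_pos H
    have hs := H.sin_one_pos
    have hs2 := H.sin_two_pos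
    refine mem_part_one H ?_ ?_ ?_ ?_
    · rw [cr_sub, cr_one, ctr_one, cr_mul, cr_uvec]
      norm_num
      exact hs.le
    · rw [cr_sub, cr_one, ctr_one, cr_mul, cr_uvec,
        show ((1 : ℝ) - (3 : ℤ)) * gam n = -(2 * gam n) by push_cast; ring, Real.sin_neg]
      push_cast
      nlinarith
    · rw [ip_sub, ip_one, ctr_one, ip_mul, ip_uvec, apo_one_three H]
      norm_num
    · rw [ip_sub, ip_one, ctr_one, ip_mul, ip_uvec,
        show ((1 : ℝ) - (3 : ℤ)) * gam n = -(2 * gam n) by push_cast; ring, Real.cos_neg,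
        apo_one_one H]
      push_cast
      linarith
  · rw [ip_one]
    norm_num
  · rw [one_eq_ctr H, add_sub_cancel_left, ip_mul, ip_uvec, apo_zero_three H]
    norm_num

/-- The point of the surface does not depend on the part of the table to which it is assigned. -/
theorem pmk_pt_eq (H : Good n) (g : Grp n) {p : ℂ} {i j : ℕ} (hi : i < 3) (hj : j < 3)
    (hpi : p - ctr n i ∈ part n i) (hpj : p - ctr n j ∈ part n j) :
    pmk (pt H g i hi _ hpi.2.2) = pmk (pt H g j hj _ hpj.2.2) := by
  -- Membership in both polygons gives opposite inequalities at their common side, so the point lies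
  -- on it.
  have key12 : ∀ (h1 : p - ctr n 1 ∈ part n 1) (h2 : p - ctr n 2 ∈ part n 2),
      pmk (pt H g 1 (by norm_num) _ h1.2.2) = pmk (pt H g 2 (by norm_num) _ h2.2.2) := by
    intro h1 h2
    apply pmk_one_two
    obtain ⟨m, hm⟩ := H.odd
    have k1 := poly_le h2.2.2 (j := 1) (by norm_num)
    have k2 := poly_le h1.2.2 (j := 2 * n + 1) (by omega)
    rw [ip_opp H, apo_congr (by omega : (2 * (n : ℤ) + 1) % 4 = 3 % 4), apo_one_three H, ip_sub,
      ctr_one, ip_mul, ip_uvec] at k2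
    rw [apo_two H, ctr_two, sub_zero] at k1
    norm_num at k2
    linarith
  have key01 : ∀ (h0 : p - ctr n 0 ∈ part n 0) (h1 : p - ctr n 1 ∈ part n 1),
      pmk (pt H g 0 (by norm_num) _ h0.2.2) = pmk (pt H g 1 (by norm_num) _ h1.2.2) := by
    intro h0 h1
    apply pmk_zero_one
    obtain ⟨m, hm⟩ := H.odd
    have k1 := poly_le h0.2.2 (j := 3) (by norm_num)
    have k2 := poly_le h1.2.2 (j := 2 * n + 3) (by omega)
    have ec : p - ctr n 1 = (p - ctr n 0) - tabS n * uvec n 3 := by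
      simp only [ctr]
      ring
    rw [ip_opp H, apo_congr (by omega : (2 * (n : ℤ) + 3) % 4 = 1 % 4), apo_one_one H, ec, ip_sub,
      ip_mul, ip_uvec] at k2
    rw [apo_zero_three H] at k1 ⊢
    norm_num at k2
    linarith
  have key02 : ∀ (h0 : p - ctr n 0 ∈ part n 0) (h2 : p - ctr n 2 ∈ part n 2),
      pmk (pt H g 0 (by norm_num) _ h0.2.2) = pmk (pt H g 2 (by norm_num) _ h2.2.2) := by
    intro h0 h2
    have hp := part_zero_two H h0 h2
    -- The only common point of the parts 0 and 2 is V 1. It also belongs to part 1, so the two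
    -- gluings can be composed.
    have h1 : p - ctr n 1 ∈ part n 1 := by
      rw [hp]
      exact (one_mem_parts H).1
    exact (key01 h0 h1).trans (key12 h1 h2)
  interval_cases i <;> interval_cases j
  · rfl
  · exact key01 hpi hpj
  · exact key02 hpi hpj
  · exact (key01 hpj hpi).symm
  · rfl
  · exact key12 hpi hpj
  · exact (key02 hpj hpi).symm
  · exact (key12 hpj hpi).symm
  · rfl

end

/-! ### Symmetries of the table -/

section

variable {n : ℕ}

theorem exists_weights {V : Fin 4 → ℂ} {p : ℂ} (hp : p ∈ quadRegion V) :
    ∃ x : Fin 4 → ℝ, (∀ i, 0 ≤ x i) ∧ ∑ i, x i = 1 ∧ p = ∑ i, (x i : ℂ) * V i := by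
  rcases hp with h | h
  · obtain ⟨x, y, w, hx, hy, hw, h1, rfl⟩ := mem_convexHull_triple.1 h
    refine ⟨![x, y, 0, w], ?_, ?_, ?_⟩
    · intro i
      fin_cases i <;> simp [hx, hy, hw]
    · simp [Fin.sum_univ_four, h1]
    · simp [Fin.sum_univ_four]
  · obtain ⟨x, y, w, hx, hy, hw, h1, rfl⟩ := mem_convexHull_triple.1 h
    refine ⟨![0, x, y, w], ?_, ?_, ?_⟩
    · intro i
      fin_cases i <;> simp [hx, hy, hw]
    · simp [Fin.sum_univ_four, h1]
    · simp [Fin.sum_univ_four]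

theorem vertex_mem_quadRegion (V : Fin 4 → ℂ) (i : Fin 4) : V i ∈ quadRegion V := by
  unfold quadRegion
  fin_cases i
  · exact Or.inl (subset_convexHull ℝ _ (by simp))
  · exact Or.inl (subset_convexHull ℝ _ (by simp))
  · exact Or.inr (subset_convexHull ℝ _ (by simp))
  · exact Or.inl (subset_convexHull ℝ _ (by simp))

/-! ### The diameter of the table and rigidity -/

/-- A point of a polygon with maximal distance from a given point is a vertex. -/
theorem eq_vertex_of_far {V : Fin 4 → ℂ} (hV : Function.Injective V) {q : ℂ} {r : ℝ}
    (hr : ∀ i, Complex.normSq (V i - q) ≤ r) {p : ℂ} (hp : p ∈ quadRegion V)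
    (h : r ≤ Complex.normSq (p - q)) : ∃ i, p = V i := by
  obtain ⟨x, h0, h1, hx⟩ := exists_weights hp
  -- The parallel axis identity for a convex combination of the vertices. All terms on the right are
  -- nonnegative, so equality forces the weights to concentrate on one vertex.
  have id : r - Complex.normSq (p - q) = ∑ i, x i * (r - Complex.normSq (V i - q)) +
      (x 0 * x 1 * Complex.normSq (V 0 - V 1) + x 0 * x 2 * Complex.normSq (V 0 - V 2) +
      x 0 * x 3 * Complex.normSq (V 0 - V 3) + x 1 * x 2 * Complex.normSq (V 1 - V 2) +
      x 1 * x 3 * Complex.normSq (V 1 - V 3) + x 2 * x 3 * Complex.normSq (V 2 - V 3)) := by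
    have e : x 0 = 1 - x 1 - x 2 - x 3 := by
      rw [Fin.sum_univ_four] at h1
      linarith
    rw [hx]
    simp only [Fin.sum_univ_four, Complex.normSq_apply, Complex.sub_re, Complex.sub_im,
      Complex.add_re, Complex.add_im, Complex.re_ofReal_mul, Complex.im_ofReal_mul]
    rw [e]
    ring
  have hpos : ∀ i j, i ≠ j → 0 < Complex.normSq (V i - V j) := by
    intro i j hij
    rw [Complex.normSq_pos, sub_ne_zero]
    exact fun h => hij (hV h)
  have hsum : 0 ≤ ∑ i, x i * (r - Complex.normSq (V i - q)) :=
    Finset.sum_nonneg fun i _ => mul_nonneg (h0 i) (by linarith [hr i])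
  have t : ∀ i j, i ≠ j → 0 ≤ x i * x j * Complex.normSq (V i - V j) := fun i j hij =>
    mul_nonneg (mul_nonneg (h0 i) (h0 j)) (hpos i j hij).le
  have t01 := t 0 1 (by decide)
  have t02 := t 0 2 (by decide)
  have t03 := t 0 3 (by decide)
  have t12 := t 1 2 (by decide)
  have t13 := t 1 3 (by decide)
  have t23 := t 2 3 (by decide)
  have z : ∀ i j, i ≠ j → x i * x j * Complex.normSq (V i - V j) ≤ 0 → x i = 0 ∨ x j = 0 := by
    intro i j hij hle
    have h2 := le_antisymm hle (t i j hij)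
    rw [mul_eq_zero, mul_eq_zero] at h2
    exact h2.resolve_right (hpos i j hij).ne'
  have z01 := z 0 1 (by decide) (by linarith)
  have z02 := z 0 2 (by decide) (by linarith)
  have z03 := z 0 3 (by decide) (by linarith)
  have z12 := z 1 2 (by decide) (by linarith)
  have z13 := z 1 3 (by decide) (by linarith)
  have z23 := z 2 3 (by decide) (by linarith)
  rw [Fin.sum_univ_four] at h1 hx
  by_cases e0 : x 0 = 0
  · by_cases e1 : x 1 = 0
    · by_cases e2 : x 2 = 0
      · have e3 : x 3 = 1 := by linarith
        exact ⟨3, by simp [hx, e0, e1, e2, e3]⟩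
      · have e3 := z23.resolve_left e2
        have e2 : x 2 = 1 := by linarith
        exact ⟨2, by simp [hx, e0, e1, e2, e3]⟩
    · have e2 := z12.resolve_left e1
      have e3 := z13.resolve_left e1
      have e1 : x 1 = 1 := by linarith
      exact ⟨1, by simp [hx, e0, e1, e2, e3]⟩
  · have e1 := z01.resolve_left e0
    have e2 := z02.resolve_left e0
    have e3 := z03.resolve_left e0
    have e0 : x 0 = 1 := by linarith
    exact ⟨0, by simp [hx, e0, e1, e2, e3]⟩

/-- V 2 is at distance at most 1 + `tabT n` from V 0, so this keeps it closer to V 0 than V 3 is.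
The diameter is then attained only by the pair V 0, V 3. -/
theorem one_add_tabT_lt (H : Good n) : 1 + tabT n < tabR n := by
  have hc := H.cos_one_pos
  have h1 := tabR_mul H
  have h2 := tabT_mul H
  have h3 := c5_lt_cos H
  have h4 := c5_sq
  have h5 := half_lt_c5
  have h6 : Real.cos (2 * gam n) ≤ Real.cos (gam n) := by
    have := H.gam_pos
    have := H.gam_le
    apply Real.cos_le_cos_of_nonneg_of_le_pi <;> linarith
  have h7 : 0 < (Real.cos (gam n) - c5) * (4 * (Real.cos (gam n) + c5) - 2) :=
    mul_pos (by linarith) (by linarith)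
  rw [cos_two_gam] at h1
  apply lt_of_mul_lt_mul_right _ hc.le
  nlinarith

theorem one_lt_cos_add (H : Good n) : 1 < Real.cos (2 * gam n) + c5 := by
  linarith [c5_lt_cos H, half_lt_c5]

/-- Serves in `table_rigid` to rule out the reflection that exchanges V 0 and V 3. -/
theorem tabR_lt_two_tabS (H : Good n) : tabR n < 2 * tabS n * Real.cos (2 * gam n) := by
  have h1 := c5_lt_cos H
  have h2 := half_lt_c5
  have h3 := c5_sq
  have h4 := tabR_pos H
  have h5 : 1 < 2 * (2 * c5 - 1) * Real.cos (2 * gam n) := by nlinarith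
  have := mul_lt_mul_of_pos_left h5 h4
  unfold tabS
  linarith

theorem tableV_three : tableV n 3 = tabR n * uvec n 1 := rfl

theorem tableV_zero : tableV n 0 = 0 := rfl

theorem tableV_one : tableV n 1 = 1 := rfl

/-- The two vertices at maximal distance. -/
theorem normSq_vertices (H : Good n) (i j : Fin 4) :
    Complex.normSq (tableV n i - tableV n j) ≤ tabR n ^ 2 ∧
    (tabR n ^ 2 ≤ Complex.normSq (tableV n i - tableV n j) → i = 0 ∧ j = 3 ∨ i = 3 ∧ j = 0) := by
  have hr := tabR_pos H
  have hs := tabS_pos H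
  have ht := tabT_pos H
  have h1 := one_add_tabT_lt H
  have nrm : ∀ (x y : ℝ), Complex.normSq (x * uvec n y) = x ^ 2 := by
    intro x y
    rw [Complex.normSq_eq_norm_sq, norm_mul, norm_uvec, mul_one, Complex.norm_real, Real.norm_eq_abs, sq_abs]
  have sym : ∀ a b : ℂ, Complex.normSq (a - b) = Complex.normSq (b - a) := by
    intro a b
    rw [← neg_sub, Complex.normSq_neg]
  have d01 : Complex.normSq (tableV n 0 - tableV n 1) < tabR n ^ 2 := by
    rw [tableV_zero, tableV_one, zero_sub, Complex.normSq_neg, map_one]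
    nlinarith
  have d02 : Complex.normSq (tableV n 0 - tableV n 2) < tabR n ^ 2 := by
    rw [tableV_zero, zero_sub, Complex.normSq_neg, Complex.normSq_eq_norm_sq]
    have : ‖tableV n 2‖ ≤ 1 + tabT n := by
      refine (norm_sub_le _ _).trans ?_
      rw [norm_one, norm_mul, norm_uvec, Complex.norm_real, Real.norm_of_nonneg ht.le, mul_one]
    have h0 := norm_nonneg (tableV n 2)
    nlinarith
  have d03 : Complex.normSq (tableV n 0 - tableV n 3) = tabR n ^ 2 := by
    rw [tableV_zero, zero_sub, Complex.normSq_neg, tableV_three, nrm]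
  have d12 : Complex.normSq (tableV n 1 - tableV n 2) < tabR n ^ 2 := by
    rw [tableV_one, show tableV n 2 = 1 - tabT n * uvec n 5 from rfl, sub_sub_cancel, nrm]
    nlinarith
  have d13 : Complex.normSq (tableV n 1 - tableV n 3) < tabR n ^ 2 := by
    rw [tableV_one, tableV_three]
    have h2 := one_lt_cos_add H
    rw [← tabR_mul H] at h2
    simp only [Complex.normSq_apply, Complex.sub_re, Complex.sub_im, Complex.one_re,
      Complex.one_im, Complex.re_ofReal_mul, Complex.im_ofReal_mul, uvec_re, uvec_im, one_mul]
    nlinarith [Real.sin_sq_add_cos_sq (gam n)]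
  have d23 : Complex.normSq (tableV n 2 - tableV n 3) < tabR n ^ 2 := by
    rw [tableV_two H, tableV_three, sub_sub_cancel_left, Complex.normSq_neg, nrm]
    have : tabS n < tabR n := by
      unfold tabS
      nlinarith [c5_lt_one]
    nlinarith
  have hlt : ∀ i j, ¬ (i = 0 ∧ j = 3 ∨ i = 3 ∧ j = 0) →
      Complex.normSq (tableV n i - tableV n j) < tabR n ^ 2 := by
    intro i j hij
    have dii : ∀ k, Complex.normSq (tableV n k - tableV n k) < tabR n ^ 2 := by
      intro k
      rw [sub_self, map_zero]
      positivity
    fin_cases i <;> fin_cases j <;> simp at hij <;>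
      first | exact dii _ | exact d01 | exact d02 | exact d12 | exact d13 | exact d23 |
        (rw [sym]; first | exact d01 | exact d02 | exact d12 | exact d13 | exact d23)
  by_cases hij : i = 0 ∧ j = 3 ∨ i = 3 ∧ j = 0
  · refine ⟨?_, fun _ => hij⟩
    rcases hij with ⟨rfl, rfl⟩ | ⟨rfl, rfl⟩
    · exact d03.le
    · rw [sym]
      exact d03.le
  · exact ⟨(hlt i j hij).le, fun h => absurd h (not_le.2 (hlt i j hij))⟩

theorem tableV_injective (H : Good n) : Function.Injective (tableV n) := by
  have h := isTable_tableV H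
  have hr := tabR_pos H
  have hs := H.sin_one_pos
  have hg := H.sin_pos (x := 5) (by norm_num) (by
    have := H.seven_le
    norm_cast
    omega)
  have ht := tabT_pos H
  have i0 : (tableV n 0).im = 0 := rfl
  have i1 : (tableV n 1).im = 0 := rfl
  have i2 : (tableV n 2).im < 0 := by
    rw [show tableV n 2 = 1 - tabT n * uvec n 5 from rfl, Complex.sub_im, Complex.im_ofReal_mul,
      uvec_im, Complex.one_im]
    have := mul_pos ht hg
    linarith
  have i3 : 0 < (tableV n 3).im := by
    rw [tableV_three, Complex.im_ofReal_mul, uvec_im, one_mul]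
    positivity
  have h01 : tableV n 0 ≠ tableV n 1 := by
    rw [tableV_zero, tableV_one]
    exact zero_ne_one
  intro a b hab
  have him := congrArg Complex.im hab
  fin_cases a <;> fin_cases b <;>
    first | rfl | exact absurd hab h01 | exact absurd hab.symm h01 | (exfalso; revert him; simp only [Fin.reduceFinMk, Fin.zero_eta, Fin.mk_one]; intro him; linarith)

theorem far_points (H : Good n) {p q : ℂ} (hp : p ∈ quadRegion (tableV n))
    (hq : q ∈ quadRegion (tableV n)) (h : tabR n ^ 2 ≤ Complex.normSq (p - q)) :
    p = tableV n 0 ∧ q = tableV n 3 ∨ p = tableV n 3 ∧ q = tableV n 0 := by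
  have sym : ∀ a b : ℂ, Complex.normSq (a - b) = Complex.normSq (b - a) := by
    intro a b
    rw [← neg_sub, Complex.normSq_neg]
  have hinj := tableV_injective H
  have hv : ∀ i, ∀ q ∈ quadRegion (tableV n), Complex.normSq (tableV n i - q) ≤ tabR n ^ 2 := by
    intro i q hq
    by_contra hlt
    rw [not_le] at hlt
    obtain ⟨j, rfl⟩ := eq_vertex_of_far hinj (fun j => (normSq_vertices H j i).1) hq
      (by rw [sym]; exact hlt.le)
    exact absurd (normSq_vertices H i j).1 (not_le.2 hlt)
  obtain ⟨i, rfl⟩ := eq_vertex_of_far hinj (fun i => hv i q hq) hp h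
  obtain ⟨j, rfl⟩ := eq_vertex_of_far hinj (fun j => (normSq_vertices H j i).1) hq
    (by rw [sym]; exact h)
  rcases (normSq_vertices H i j).2 h with ⟨rfl, rfl⟩ | ⟨rfl, rfl⟩
  · exact Or.inl ⟨rfl, rfl⟩
  · exact Or.inr ⟨rfl, rfl⟩

theorem cr_sum (j : ℤ) (x : Fin 4 → ℝ) (V : Fin 4 → ℂ) :
    cr n j (∑ i, (x i : ℂ) * V i) = ∑ i, x i * cr n j (V i) := by
  simp only [Fin.sum_univ_four, cr_add, cr_mul]

/-- The line through V 0 and V 3 supports the table. This excludes symmetries that would move V 1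
across it. -/
theorem quadRegion_cr_one (H : Good n) {p : ℂ} (hp : p ∈ quadRegion (tableV n)) : cr n 1 p ≤ 0 := by
  obtain ⟨x, h0, h1, rfl⟩ := exists_weights hp
  rw [cr_sum]
  refine Finset.sum_nonpos fun i _ => mul_nonpos_of_nonneg_of_nonpos (h0 i) ?_
  have hs := H.sin_one_pos
  have h4 := H.sin_pos (x := 4) (by norm_num) (by
    have := H.seven_le
    norm_cast
    omega)
  have ht := tabT_pos H
  fin_cases i
  · simp [tableV_zero, cr]
  · change cr n 1 1 ≤ 0
    rw [cr_one]
    push_cast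
    rw [one_mul]
    linarith
  · change cr n 1 (1 - tabT n * uvec n 5) ≤ 0
    rw [cr_sub, cr_one, cr_mul, cr_uvec]
    push_cast
    rw [one_mul, show (5 : ℝ) - 1 = 4 by norm_num]
    have := mul_pos ht h4
    linarith
  · change cr n 1 (tabR n * uvec n 1) ≤ 0
    rw [cr_mul, cr_uvec]
    simp

/-- The line through V 2 and V 3 supports the table, and the constant is the value at these two
vertices. -/
theorem quadRegion_cr_three (H : Good n) {p : ℂ} (hp : p ∈ quadRegion (tableV n)) :
    - (tabR n * Real.sin (2 * gam n)) ≤ cr n 3 p := by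
  obtain ⟨x, h0, h1, rfl⟩ := exists_weights hp
  rw [cr_sum]
  have hs := H.sin_two_pos
  have ht := tabT_pos H
  have hr := tabR_pos H
  have him := table_im H
  have key : ∀ i, - (tabR n * Real.sin (2 * gam n)) ≤ cr n 3 (tableV n i) := by
    have e3 : cr n 3 (tabR n * uvec n 1) = - (tabR n * Real.sin (2 * gam n)) := by
      rw [cr_mul, cr_uvec]
      push_cast
      rw [show ((1 : ℝ) - 3) * gam n = - (2 * gam n) by ring, Real.sin_neg]
      ring
    intro i
    fin_cases i
    · change _ ≤ cr n 3 0
      simp only [cr, Complex.zero_im, Complex.zero_re, zero_mul, sub_zero]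
      have := mul_pos hr hs
      linarith
    · change _ ≤ cr n 3 1
      rw [cr_one]
      push_cast
      have := mul_pos ht hs
      linarith
    · change _ ≤ cr n 3 (tableV n 2)
      rw [tableV_two H, cr_sub, e3, cr_mul, cr_uvec]
      simp
    · exact e3.ge
  calc - (tabR n * Real.sin (2 * gam n)) = ∑ i, x i * (- (tabR n * Real.sin (2 * gam n))) := by
        rw [← Finset.sum_mul, h1, one_mul]
    _ ≤ _ := Finset.sum_le_sum fun i _ => mul_le_mul_of_nonneg_left (key i) (h0 i)

/-- The table has no symmetries. -/
theorem table_rigid (H : Good n) (h : Grp n) (t : ℂ)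
    (hP : ∀ p ∈ quadRegion (tableV n), h.1 p + t ∈ quadRegion (tableV n)) : h.1 = 1 ∧ t = 0 := by
  have hr := tabR_pos H
  have hr' : (tabR n : ℂ) ≠ 0 := by exact_mod_cast hr.ne'
  have hs := H.sin_one_pos
  have v : ∀ i, h.1 (tableV n i) + t ∈ quadRegion (tableV n) :=
    fun i => hP _ (vertex_mem_quadRegion _ i)
  have v0 : h.1 (tableV n 0) + t = t := by rw [tableV_zero, map_zero, zero_add]
  have hsm : ∀ z : ℂ, h.1 (tabR n * z) = tabR n * h.1 z := by
    intro z
    rw [← Complex.real_smul, map_smul, Complex.real_smul]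
  -- The images of V 0 and V 3 are again at the maximal distance, so the map fixes or exchanges
  -- these two vertices.
  have far := far_points H (v 0) (v 3) (by
    rw [add_sub_add_right_eq_sub, ← map_sub, Complex.normSq_eq_norm_sq, LinearIsometryEquiv.norm_map,
      tableV_zero, tableV_three, zero_sub, norm_neg, norm_mul, norm_uvec, mul_one, Complex.norm_real,
      Real.norm_eq_abs, sq_abs])
  rw [v0] at far
  have key : ∀ {e : ℂ} {k : ℤ}, h.1 (uvec n 1) = e * uvec n 1 → (IsRot n h.1 k → uvec n (2 * k) = e) ∧
      (IsRef n h.1 k → uvec n (2 * k) = e * uvec n 2) := by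
    intro e k he
    have e2 : uvec n 2 = uvec n 1 * uvec n 1 := by rw [← uvec_add]; norm_num
    have e1 := uvec_neg_mul (n := n) 1
    refine ⟨fun hk => ?_, fun hk => ?_⟩
    · rw [hk] at he
      exact mul_right_cancel₀ (uvec_ne_zero 1) he
    · rw [hk, conj_uvec] at he
      rw [e2]
      linear_combination uvec n 1 * he - uvec n (2 * k) * e1
  obtain ⟨k, hk⟩ := rot_or_ref H h
  have h1 := v 1
  rw [tableV_one] at h1
  have c1 := quadRegion_cr_one H h1
  rcases far with ⟨h0, h3⟩ | ⟨h0, h3⟩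
  · rw [tableV_zero] at h0
    subst h0
    rw [tableV_three, add_zero, hsm] at h3
    have he : h.1 (uvec n 1) = 1 * uvec n 1 := by
      rw [one_mul]
      exact mul_left_cancel₀ hr' h3
    refine ⟨?_, rfl⟩
    rcases hk with hk | hk
    · ext z
      rw [hk, (key he).1 hk]
      simp
    -- The reflection in the line through V 0 and V 3 would send V 1 to the wrong side of that line.
    · exfalso
      rw [add_zero, hk, (key he).2 hk, map_one, mul_one, one_mul, cr_uvec] at c1
      norm_num at c1
      linarith
  · exfalso
    rw [tableV_three] at h0 h3
    rw [tableV_zero, hsm, h0] at h3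
    have he : h.1 (uvec n 1) = (-1) * uvec n 1 := by
      apply mul_left_cancel₀ hr'
      linear_combination h3
    rcases hk with hk | hk
    · rw [hk, (key he).1 hk, h0, cr_add, cr_mul, cr_uvec] at c1
      have e : cr n 1 (-1 * 1 : ℂ) = Real.sin (gam n) := by simp [cr]
      rw [e] at c1
      norm_num at c1
      linarith
    -- The remaining candidate is the reflection in the perpendicular bisector of V 0 V 3. It would
    -- send V 2 beyond the supporting line through V 2 and V 3.
    · have h2 := v 2
      have e : h.1 (tableV n 2) + t = tabS n * uvec n (-1) := by
        have e2 : uvec n 2 * uvec n (-3) = uvec n (-1) := by rw [← uvec_add]; norm_num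
        have e3 : uvec n 2 * uvec n (-1) = uvec n 1 := by rw [← uvec_add]; norm_num
        rw [hk, (key he).2 hk, tableV_two H, h0, map_sub, map_mul, map_mul, conj_uvec, conj_uvec,
          Complex.conj_ofReal, Complex.conj_ofReal]
        linear_combination (tabS n : ℂ) * e2 - (tabR n : ℂ) * e3
      rw [e] at h2
      have c3 := quadRegion_cr_three H h2
      rw [cr_mul, cr_uvec, show ((-1 : ℝ) - (3 : ℤ)) * gam n = - (4 * gam n) by push_cast; ring,
        Real.sin_neg, trig_args.1] at c3
      have hs2 := H.sin_two_pos
      have := mul_lt_mul_of_pos_right (tabR_lt_two_tabS H) hs2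
      linarith

/-- Copies of the table which differ by a translation are equal. -/
theorem translate_trivial (H : Good n) {g g' : Grp n} {t : ℂ}
    (h : (fun z => g.1 z + t) '' quadRegion (tableV n) = (fun z => g'.1 z) '' quadRegion (tableV n)) :
    g = g' ∧ t = 0 := by
  have key := table_rigid H (g'⁻¹ * g) (g'.1⁻¹ t) (by
    intro p hp
    have : g.1 p + t ∈ (fun z => g'.1 z) '' quadRegion (tableV n) := by
      rw [← h]
      exact ⟨p, hp, rfl⟩
    obtain ⟨q, hq, e⟩ := this
    have e' : ((g'⁻¹ * g : Grp n).1 p) + g'.1⁻¹ t = q := by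
      change g'.1⁻¹ (g.1 p) + g'.1⁻¹ t = q
      rw [← map_add, ← e]
      exact inv_apply_apply _ _
    rw [e']
    exact hq)
  refine ⟨?_, ?_⟩
  · have : g'⁻¹ * g = 1 := Subtype.ext key.1
    exact (inv_mul_eq_one.1 this).symm
  · have := congrArg g'.1 key.2
    rwa [apply_inv_apply, map_zero] at this

end

/-! ### From the unfolding to the polygons -/

section

variable {n : ℕ}

/-- The unfolding of the table. -/
abbrev Unf (n : ℕ) : Type := Unfolding (quadRegion (tableV n)) (tableV n)

/-- The disjoint union of the copies of the table. -/
abbrev Cop (n : ℕ) : Type := Copies (quadRegion (tableV n)) (tableV n)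

/-- The point of the unfolding given by a point of a copy of the table. -/
def umk (d : Cop n) : Unf n := Quot.mk _ d

theorem umk_side (g : Grp n) (s : Fin 4) {p : quadRegion (tableV n)}
    (hp : (p : ℂ) ∈ segment ℝ (tableV n s) (tableV n (s + 1))) :
    umk (n := n) ⟨g, p⟩ = umk ⟨g * sideGen (tableV n) s, p⟩ :=
  Quot.sound (Glue.side g s p hp)

theorem mem_part_one_three (H : Good n) {x : ℝ} (h0 : 0 ≤ x) (h1 : x ≤ apo n 1 3) :
    ((-x : ℝ) : ℂ) * uvec n 1 ∈ part n 1 := by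
  have hs := H.sin_two_pos
  have hc := H.cos_two_pos
  refine mem_part_one H ?_ ?_ ?_ ?_
  · rw [cr_mul, cr_uvec]
    simp
  · rw [cr_mul, cr_uvec, show ((1 : ℝ) - (3 : ℤ)) * gam n = -(2 * gam n) by push_cast; ring,
      Real.sin_neg]
    nlinarith
  · rw [ip_mul, ip_uvec]
    simpa using h1
  · have e := apo_add_two H 1 3
    rw [apo_congr (by norm_num : (3 + 2 : ℤ) % 4 = 1 % 4)] at e
    have hh := hl_nonneg H (by norm_num : 1 < 5) 3
    rw [ip_mul, ip_uvec, show ((1 : ℝ) - (3 : ℤ)) * gam n = -(2 * gam n) by push_cast; ring,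
      Real.cos_neg]
    nlinarith [mul_nonneg hh hs.le, mul_le_mul_of_nonneg_right h1 hc.le]

theorem mem_part_one_one (H : Good n) {x : ℝ} (h0 : 0 ≤ x) (h1 : x ≤ apo n 1 1) :
    ((-x : ℝ) : ℂ) * uvec n 3 ∈ part n 1 := by
  have hs := H.sin_two_pos
  have hc := H.cos_two_pos
  refine mem_part_one H ?_ ?_ ?_ ?_
  · rw [cr_mul, cr_uvec, show ((3 : ℝ) - (1 : ℤ)) * gam n = 2 * gam n by push_cast; ring]
    nlinarith
  · rw [cr_mul, cr_uvec]
    simp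
  · have e := apo_add_two H 1 1
    rw [show (1 + 2 : ℤ) = 3 by norm_num] at e
    have hh := hl_nonneg H (by norm_num : 1 < 5) 1
    rw [ip_mul, ip_uvec, show ((3 : ℝ) - (1 : ℤ)) * gam n = 2 * gam n by push_cast; ring]
    nlinarith [mul_nonneg hh hs.le, mul_le_mul_of_nonneg_right h1 hc.le]
  · rw [ip_mul, ip_uvec]
    simpa using h1

/-- A point on a side of the table lies in a part with a vertex on that side. -/
theorem exists_part_of_side (H : Good n) (s : Fin 4) {p : ℂ}
    (hp : p ∈ segment ℝ (tableV n s) (tableV n (s + 1))) :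
    ∃ i < 3, p - ctr n i ∈ part n i ∧ (s = 0 → i = 2) ∧
      ∃ x : ℝ, p - ctr n i = x * uvec n (sideDir s) := by
  have hs1 := H.sin_one_pos
  have hs := H.sin_two_pos
  have hc1 := H.cos_one_pos
  have hc := H.cos_two_pos
  have hc' := cos_two_le_one (n := n)
  have hr := tabR_pos H
  have hS := tabS_pos H
  have ht := tabT_pos H
  rw [segment_eq_image] at hp
  obtain ⟨θ, ⟨h0, h1⟩, rfl⟩ := hp
  simp only [Complex.real_smul]
  have d31 : ((1 : ℝ) - (3 : ℤ)) * gam n = -(2 * gam n) := by push_cast; ring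
  have d35 : ((3 : ℝ) - (5 : ℤ)) * gam n = -(2 * gam n) := by push_cast; ring
  have d53 : ((5 : ℝ) - (3 : ℤ)) * gam n = 2 * gam n := by push_cast; ring
  fin_cases s
  · refine ⟨2, by norm_num, ?_, fun _ => rfl, θ, ?_⟩
    · have e : (((1 - θ : ℝ) : ℂ) * tableV n 0 + (θ : ℂ) * tableV n 1) - ctr n 2 = θ * uvec n 0 := by
        rw [tableV_zero, tableV_one, ctr_two, uvec_zero]
        ring
      change (((1 - θ : ℝ) : ℂ) * tableV n 0 + (θ : ℂ) * tableV n 1) - ctr n 2 ∈ _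
      rw [e]
      refine mem_part_two H ?_ ?_ ?_
      · rw [cr_mul, cr_uvec]
        simp
      · rw [cr_mul, cr_uvec]
        norm_num
        positivity
      · rw [ip_mul, ip_uvec]
        norm_num
        nlinarith
    · change (((1 - θ : ℝ) : ℂ) * tableV n 0 + (θ : ℂ) * tableV n 1) - ctr n 2 = _ * uvec n ((0 : ℤ) : ℝ)
      rw [tableV_zero, tableV_one, ctr_two, Int.cast_zero, uvec_zero]
      ring
  · have e : (((1 - θ : ℝ) : ℂ) * tableV n 1 + (θ : ℂ) * tableV n 2) - ctr n 0 =
        (((1 - θ) * tabT n : ℝ) : ℂ) * uvec n 5 := by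
      rw [tableV_one, tableV_two_eq H, one_eq_ctr H]
      push_cast
      ring
    refine ⟨0, by norm_num, ?_, fun h => absurd h (by decide), (1 - θ) * tabT n, ?_⟩
    · change (((1 - θ : ℝ) : ℂ) * tableV n 1 + (θ : ℂ) * tableV n 2) - ctr n 0 ∈ _
      rw [e]
      have x0 : 0 ≤ (1 - θ) * tabT n := mul_nonneg (by linarith) ht.le
      have x1 : (1 - θ) * tabT n ≤ tabT n := by nlinarith
      refine mem_part_zero H ?_ ?_ ?_ ?_
      · rw [cr_mul, cr_uvec, d53]
        positivity
      · rw [cr_mul, cr_uvec]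
        simp
      · rw [ip_mul, ip_uvec, d53, apo_zero_three H]
        exact mul_le_mul_of_nonneg_right x1 hc.le
      · rw [ip_mul, ip_uvec, apo_zero_one H]
        simpa using x1
    · change (((1 - θ : ℝ) : ℂ) * tableV n 1 + (θ : ℂ) * tableV n 2) - ctr n 0 = _ * uvec n ((5 : ℤ) : ℝ)
      rw [e]
      norm_num
  · have e0 : (((1 - θ : ℝ) : ℂ) * tableV n 2 + (θ : ℂ) * tableV n 3) - ctr n 0 =
        ((θ * tabS n : ℝ) : ℂ) * uvec n 3 := by
      rw [tableV_two_eq H, tableV_three, ctr]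
      push_cast
      ring
    have e1 : (((1 - θ : ℝ) : ℂ) * tableV n 2 + (θ : ℂ) * tableV n 3) - ctr n 1 =
        ((-((1 - θ) * tabS n) : ℝ) : ℂ) * uvec n 3 := by
      rw [tableV_two_eq H, tableV_three, ctr_one, ctr]
      push_cast
      ring
    have x0 : 0 ≤ θ * tabS n := by positivity
    rcases le_total (θ * tabS n) (tabT n * Real.cos (2 * gam n)) with hx | hx
    · refine ⟨0, by norm_num, ?_, fun h => absurd h (by decide), θ * tabS n, ?_⟩
      · change (((1 - θ : ℝ) : ℂ) * tableV n 2 + (θ : ℂ) * tableV n 3) - ctr n 0 ∈ _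
        rw [e0]
        refine mem_part_zero H ?_ ?_ ?_ ?_
        · rw [cr_mul, cr_uvec]
          simp
        · rw [cr_mul, cr_uvec, d35, Real.sin_neg]
          nlinarith
        · rw [ip_mul, ip_uvec, apo_zero_three H]
          simpa using hx
        · rw [ip_mul, ip_uvec, d35, Real.cos_neg, apo_zero_one H]
          have := mul_le_mul_of_nonneg_right hx hc.le
          nlinarith [mul_nonneg ht.le hc.le]
      · change (((1 - θ : ℝ) : ℂ) * tableV n 2 + (θ : ℂ) * tableV n 3) - ctr n 0 = _ * uvec n ((3 : ℤ) : ℝ)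
        rw [e0]
        norm_num
    · refine ⟨1, by norm_num, ?_, fun h => absurd h (by decide), -((1 - θ) * tabS n), ?_⟩
      · change (((1 - θ : ℝ) : ℂ) * tableV n 2 + (θ : ℂ) * tableV n 3) - ctr n 1 ∈ _
        rw [e1]
        refine mem_part_one_one H (mul_nonneg (by linarith) hS.le) ?_
        rw [apo_one_one H]
        linarith
      · change (((1 - θ : ℝ) : ℂ) * tableV n 2 + (θ : ℂ) * tableV n 3) - ctr n 1 = _ * uvec n ((3 : ℤ) : ℝ)
        rw [e1]
        norm_num
  · have e0 : (((1 - θ : ℝ) : ℂ) * tableV n 3 + (θ : ℂ) * tableV n 0) - ctr n 2 =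
        (((1 - θ) * tabR n : ℝ) : ℂ) * uvec n 1 := by
      rw [tableV_zero, tableV_three, ctr_two]
      push_cast
      ring
    have e1 : (((1 - θ : ℝ) : ℂ) * tableV n 3 + (θ : ℂ) * tableV n 0) - ctr n 1 =
        ((-(θ * tabR n) : ℝ) : ℂ) * uvec n 1 := by
      rw [tableV_zero, tableV_three, ctr_one]
      push_cast
      ring
    have x0 : 0 ≤ (1 - θ) * tabR n := mul_nonneg (by linarith) hr.le
    rcases le_total ((1 - θ) * tabR n) (Real.cos (gam n)) with hx | hx
    · refine ⟨2, by norm_num, ?_, fun _ => rfl, (1 - θ) * tabR n, ?_⟩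
      · change (((1 - θ : ℝ) : ℂ) * tableV n 3 + (θ : ℂ) * tableV n 0) - ctr n 2 ∈ _
        rw [e0]
        refine mem_part_two H ?_ ?_ ?_
        · rw [cr_mul, cr_uvec]
          norm_num
          positivity
        · rw [cr_mul, cr_uvec]
          simp
        · rw [ip_mul, ip_uvec]
          simpa using hx
      · change (((1 - θ : ℝ) : ℂ) * tableV n 3 + (θ : ℂ) * tableV n 0) - ctr n 2 = _ * uvec n ((1 : ℤ) : ℝ)
        rw [e0]
        norm_num
    · refine ⟨1, by norm_num, ?_, fun h => absurd h (by decide), -(θ * tabR n), ?_⟩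
      · change (((1 - θ : ℝ) : ℂ) * tableV n 3 + (θ : ℂ) * tableV n 0) - ctr n 1 ∈ _
        rw [e1]
        refine mem_part_one_three H (by positivity) ?_
        rw [apo_one_three H]
        linarith
      · change (((1 - θ : ℝ) : ℂ) * tableV n 3 + (θ : ℂ) * tableV n 0) - ctr n 1 = _ * uvec n ((1 : ℤ) : ℝ)
        rw [e1]
        norm_num

theorem isPos_side (H : Good n) {s : Fin 4} (hs : s ≠ 0) : IsPos n (sideGen (tableV n) s : Grp n).1 := by
  have h := isRef_sideGen H s
  revert h hs
  generalize (sideGen (tableV n) s : Grp n).1 = g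
  fin_cases s
  · intro h
    exact absurd rfl h
  · exact fun _ h => ⟨2, Or.inr h⟩
  · exact fun _ h => ⟨1, Or.inr h⟩
  · exact fun _ h => ⟨0, Or.inr h⟩

theorem IsRef.fix {g : ℂ ≃ₗᵢ[ℝ] ℂ} {k : ℤ} (hg : IsRef n g k) (x : ℝ) :
    g (x * uvec n k) = x * uvec n k := by
  rw [← Complex.real_smul, map_smul, ref_uvec hg]
  ring_nf

/-- The image of a point of a copy of the table in the surface made of the five polygons. -/
def phiPt (H : Good n) (d : Cop n) : PolySurf n :=
  pmk (pt H d.1 (exists_part H d.2.2).choose (exists_part H d.2.2).choose_spec.1 _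
    (exists_part H d.2.2).choose_spec.2.2.2)

theorem phiPt_eq (H : Good n) (d : Cop n) {i : ℕ} (hi : i < 3) (h : (d.2 : ℂ) - ctr n i ∈ part n i) :
    phiPt H d = pmk (pt H d.1 i hi _ h.2.2) :=
  pmk_pt_eq H d.1 _ hi (exists_part H d.2.2).choose_spec.2 h

/-- A point on a side is assigned to a part whose center lies on the line of that side, so the side
reflection fixes its coordinate relative to the center. The reflection is even, except on the side
0, which meets only the part 2, and the polygon 2 is preserved by all elements. -/
theorem phiPt_glue (H : Good n) {d d' : Cop n} (h : Glue _ _ d d') : phiPt H d = phiPt H d' := by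
  cases h with
  | side g s p hp =>
    obtain ⟨i, hi, hpi, h0, x, hx⟩ := exists_part_of_side H s hp
    rw [phiPt_eq H ⟨g, p⟩ hi hpi, phiPt_eq H ⟨g * sideGen (tableV n) s, p⟩ hi hpi]
    congr 1
    apply pt_congr
    · by_cases hs : s = 0
      · rw [h0 hs, lab_two, lab_two]
      · exact (lab_mul_pos (isPos_side H hs) i).symm
    · change _ = g.1 ((sideGen (tableV n) s : Grp n).1 _)
      rw [hx, (isRef_sideGen H s).fix]
  | translate g g' t h p p' hp =>
    obtain ⟨rfl, rfl⟩ := translate_trivial H h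
    rw [add_zero] at hp
    rw [Subtype.ext (g.1.injective hp)]

/-- The map from the unfolding to the surface made of the five polygons. -/
def phi (H : Good n) : Unf n → PolySurf n := Quot.lift (phiPt H) fun _ _ h => phiPt_glue H h

theorem phi_umk (H : Good n) (d : Cop n) {i : ℕ} (hi : i < 3)
    (h : (d.2 : ℂ) - ctr n i ∈ part n i) : phi H (umk d) = pmk (pt H d.1 i hi _ h.2.2) :=
  phiPt_eq H d hi h

/-! ### From the polygons to the unfolding -/

theorem exists_polar (H : Good n) (z : ℂ) : ∃ τ : ℝ, z = (‖z‖ : ℂ) * uvec n τ := by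
  refine ⟨Complex.arg z / gam n, ?_⟩
  rw [uvec_eq_exp, div_mul_cancel₀ _ H.gam_pos.ne', Complex.norm_mul_exp_arg_mul_I]

/-- Folding the plane to the sector of angles from `x` to `x + e`. -/
theorem exists_fold_sector (H : Good n) (x : ℤ) {e : ℤ} (he : 0 < e) (z : ℂ) :
    ∃ (m : ℤ) (s : ℝ), x ≤ s ∧ s ≤ x + e ∧
      (z = ‖z‖ * uvec n (2 * (m * e : ℤ) + s) ∨ z = ‖z‖ * uvec n (2 * (x + m * e : ℤ) - s)) := by
  obtain ⟨τ, hτ⟩ := exists_polar H z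
  have he' : (0 : ℝ) < e := by exact_mod_cast he
  -- The number of the sector of width `e` that contains the argument. Even sectors are rotated
  -- copies of the first one, odd sectors are reflected copies.
  set q := ⌊(τ - x) / e⌋ with hq
  have h1 : q * (e : ℝ) ≤ τ - x := by
    have := Int.floor_le ((τ - x) / (e : ℝ))
    rwa [le_div_iff₀ he'] at this
  have h2 : τ - x < (q + 1) * (e : ℝ) := by
    have := Int.lt_floor_add_one ((τ - x) / (e : ℝ))
    rwa [div_lt_iff₀ he'] at this
  obtain ⟨m, hm | hm⟩ := q.even_or_odd'
  · have hm' : (q : ℝ) = 2 * m := by exact_mod_cast hm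
    rw [hm'] at h1 h2
    refine ⟨m, τ - 2 * m * e, by linarith, by linarith, Or.inl ?_⟩
    conv_lhs => rw [hτ]
    push_cast
    ring_nf
  · have hm' : (q : ℝ) = 2 * m + 1 := by exact_mod_cast hm
    rw [hm'] at h1 h2
    refine ⟨m + 1, 2 * x + 2 * (m + 1) * e - τ, by linarith, by linarith, Or.inr ?_⟩
    conv_lhs => rw [hτ]
    push_cast
    ring_nf

theorem wall_cases {i : ℕ} (hi : i < 3) : i = 2 ∧ wallA n i = 0 ∧ wallB n i = 1 ∨
    i ≠ 2 ∧ wallA n i % 2 = 1 ∧ wallB n i = wallA n i + 2 := by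
  interval_cases i
  · exact Or.inr ⟨by norm_num, by simp [wallA], by simp [wallA, wallB]⟩
  · refine Or.inr ⟨by norm_num, ?_, ?_⟩
    · simp only [wallA]
      omega
    · simp only [wallA, wallB]
      ring
  · exact Or.inl ⟨rfl, rfl, rfl⟩

/-- Sectors of angle γ need the full group, while sectors of angle 2γ already tile their polygon
under the even subgroup. -/
theorem exists_fold (H : Good n) {i : ℕ} (hi : i < 3) {z : ℂ} (hz : z ∈ poly n i) :
    ∃ g : Grp n, (i ≠ 2 → IsPos n g.1) ∧ g.1⁻¹ z ∈ part n i := by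
  have h7 := H.seven_le
  have key : ∃ g : Grp n, (i ≠ 2 → IsPos n g.1) ∧ ∃ s : ℝ, wallA n i ≤ s ∧ s ≤ wallB n i ∧
      z = g.1 (‖z‖ * uvec n s) := by
    rcases wall_cases (n := n) hi with ⟨rfl, hA, hB⟩ | ⟨h2, hA, hB⟩
    · obtain ⟨m, s, hs1, hs2, h | h⟩ := exists_fold_sector H 0 one_pos z
      · obtain ⟨g, hg⟩ := exists_rot H (m * 1)
        refine ⟨g, fun h => absurd rfl h, s, by rw [hA]; exact hs1, by rw [hB]; simpa using hs2, ?_⟩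
        rw [← Complex.real_smul, map_smul, rot_uvec hg, Complex.real_smul]
        exact h
      · obtain ⟨g, hg⟩ := exists_ref H (0 + m * 1)
        refine ⟨g, fun h => absurd rfl h, s, by rw [hA]; exact hs1, by rw [hB]; simpa using hs2, ?_⟩
        rw [← Complex.real_smul, map_smul, ref_uvec hg, Complex.real_smul]
        exact h
    · obtain ⟨m, s, hs1, hs2, h | h⟩ := exists_fold_sector H (wallA n i) two_pos z
      · obtain ⟨g, hg⟩ := exists_rot H (m * 2)
        refine ⟨g, fun _ => ⟨m, Or.inl (by rw [mul_comm]; exact hg)⟩, s, hs1, ?_, ?_⟩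
        · rw [hB]
          push_cast at hs2 ⊢
          exact hs2
        rw [← Complex.real_smul, map_smul, rot_uvec hg, Complex.real_smul]
        exact h
      · obtain ⟨g, hg⟩ := exists_ref H (wallA n i + m * 2)
        refine ⟨g, fun _ => ⟨(wallA n i + m * 2) / 2, Or.inr ?_⟩, s, hs1, ?_, ?_⟩
        · rw [show 2 * ((wallA n i + m * 2) / 2) + 1 = wallA n i + m * 2 by omega]
          exact hg
        · rw [hB]
          push_cast at hs2 ⊢
          exact hs2
        rw [← Complex.real_smul, map_smul, ref_uvec hg, Complex.real_smul]
        exact h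
  obtain ⟨g, hg, s, hs1, hs2, h⟩ := key
  refine ⟨g, hg, ?_⟩
  have hpoly : g.1⁻¹ z ∈ poly n i := by
    by_cases h2 : i = 2
    · subst h2
      have := mem_poly_lab H g⁻¹ hi hz
      rwa [lab_two] at this
    · exact (hg h2).inv.mem_poly hz
  have e : g.1⁻¹ z = ‖z‖ * uvec n s := by
    conv_lhs => rw [h]
    exact inv_apply_apply _ _
  have hAB : wallB n i ≤ wallA n i + 2 := by
    rcases wall_cases (n := n) hi with ⟨_, hA, hB⟩ | ⟨_, hA, hB⟩ <;> omega
  have hAB' : (wallB n i : ℝ) ≤ wallA n i + 2 := by exact_mod_cast hAB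
  have hgam := H.gam_pos
  have hle := H.gam_le
  have hpi := Real.pi_pos
  refine ⟨?_, ?_, hpoly⟩
  · rw [e, cr_mul, cr_uvec]
    refine mul_nonneg (norm_nonneg _) (Real.sin_nonneg_of_nonneg_of_le_pi ?_ ?_)
    · exact mul_nonneg (by linarith) hgam.le
    · nlinarith
  · rw [e, cr_mul, cr_uvec]
    refine mul_nonpos_of_nonneg_of_nonpos (norm_nonneg _) (Real.sin_nonpos_of_nonpos_of_neg_pi_le ?_ ?_)
    · exact mul_nonpos_of_nonpos_of_nonneg (by linarith) hgam.le
    · nlinarith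

/-- Points of a part in polar coordinates. -/
theorem part_polar (H : Good n) {i : ℕ} (hi : i < 3) {z : ℂ} (hz : z ∈ part n i) :
    ∃ s : ℝ, wallA n i ≤ s ∧ s ≤ wallB n i ∧ z = ‖z‖ * uvec n s := by
  obtain ⟨hA, hB, -⟩ := hz
  have hAB : wallA n i < wallB n i ∧ wallB n i ≤ wallA n i + 2 := by
    rcases wall_cases (n := n) hi with ⟨_, hA, hB⟩ | ⟨_, hA, hB⟩ <;> omega
  have hAB1 : (wallA n i : ℝ) < wallB n i := by exact_mod_cast hAB.1
  have hAB2 : (wallB n i : ℝ) ≤ wallA n i + 2 := by exact_mod_cast hAB.2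
  have hn := H.pos
  have h7 : (7 : ℝ) ≤ n := by exact_mod_cast H.seven_le
  by_cases h0 : z = 0
  · exact ⟨wallA n i, le_rfl, hAB1.le, by simp [h0]⟩
  have hpos : 0 < ‖z‖ := norm_pos_iff.2 h0
  obtain ⟨τ0, hτ0⟩ := exists_polar H z
  -- The argument is taken in a window of length 4n centered at the first wall. In it the two sign
  -- conditions confine the argument to the interval between the walls.
  obtain ⟨m, ⟨hm1, hm2⟩, -⟩ := existsUnique_add_zsmul_mem_Ioc (show (0 : ℝ) < 4 * n by linarith) τ0
    (wallA n i - 2 * n)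
  rw [zsmul_eq_mul] at hm1 hm2
  set τ := τ0 + m * (4 * n) with hτ
  have e : z = ‖z‖ * uvec n τ := by
    conv_lhs => rw [hτ0]
    rw [hτ, mul_comm (m : ℝ), uvec_periodic H]
  refine ⟨τ, ?_, ?_, e⟩
  · by_contra hlt
    rw [not_le] at hlt
    rw [e, cr_mul, cr_uvec] at hA
    have := H.sin_pos (x := wallA n i - τ) (by linarith) (by linarith)
    rw [show (wallA n i - τ) * gam n = - ((τ - wallA n i) * gam n) by ring, Real.sin_neg] at this
    nlinarith
  · by_contra hlt
    rw [not_le] at hlt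
    rw [e, cr_mul, cr_uvec] at hB
    have := H.sin_pos (x := τ - wallB n i) (by linarith) (by linarith)
    nlinarith

/-- The side of the table that contains the first wall of a part. -/
def wallSideA : ℕ → Fin 4
  | 0 => 2
  | 1 => 3
  | _ => 0

/-- The side of the table that contains the second wall of a part. -/
def wallSideB : ℕ → Fin 4
  | 0 => 1
  | 1 => 2
  | _ => 3

theorem IsRef.shift (H : Good n) {g : ℂ ≃ₗᵢ[ℝ] ℂ} {k : ℤ} (hg : IsRef n g k) :
    IsRef n g (2 * n + k) := by
  intro z
  rw [hg]
  have := uvec_periodic H (2 * k) 1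
  push_cast at this ⊢
  rw [← this]
  ring_nf

theorem isRef_wallA (H : Good n) {i : ℕ} (hi : i < 3) :
    IsRef n (sideGen (tableV n) (wallSideA i) : Grp n).1 (wallA n i) := by
  interval_cases i
  · exact isRef_sideGen H 2
  · exact (isRef_sideGen H 3).shift H
  · exact isRef_sideGen H 0

theorem isRef_wallB (H : Good n) {i : ℕ} (hi : i < 3) :
    IsRef n (sideGen (tableV n) (wallSideB i) : Grp n).1 (wallB n i) := by
  interval_cases i
  · exact isRef_sideGen H 1
  · exact (isRef_sideGen H 2).shift H
  · exact isRef_sideGen H 3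

theorem mem_segment_of_eq {a b p : ℂ} (θ : ℝ) (h0 : 0 ≤ θ) (h1 : θ ≤ 1)
    (h : p = a + θ * (b - a)) : p ∈ segment ℝ a b := by
  rw [segment_eq_image]
  refine ⟨θ, ⟨h0, h1⟩, ?_⟩
  simp only [Complex.real_smul]
  rw [h]
  push_cast
  ring

theorem mem_segment_wallA (H : Good n) {i : ℕ} (hi : i < 3) {z : ℂ} (hz : z ∈ part n i)
    (h : z = ‖z‖ * uvec n (wallA n i)) :
    ctr n i + z ∈ segment ℝ (tableV n (wallSideA i)) (tableV n (wallSideA i + 1)) := by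
  obtain ⟨m, hm⟩ := H.odd
  have h0 := norm_nonneg z
  set ρ := ‖z‖
  have hr := tabR_pos H
  have hs := tabS_pos H
  have ht := tabT_pos H
  have hc := H.cos_two_pos
  have hc1 := H.cos_one_pos
  have hr' : (tabR n : ℂ) ≠ 0 := by exact_mod_cast hr.ne'
  have hs' : (tabS n : ℂ) ≠ 0 := by exact_mod_cast hs.ne'
  obtain ⟨-, -, hp⟩ := hz
  interval_cases i
  · have h3 := poly_le hp (j := 3) (by norm_num)
    change z = ρ * uvec n ((3 : ℤ) : ℝ) at h
    rw [h, ip_mul, ip_uvec, sub_self, zero_mul, Real.cos_zero, mul_one, apo_zero_three H] at h3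
    have h4 := two_tabT_le H
    refine mem_segment_of_eq (ρ / tabS n) (by positivity) ?_ ?_
    · rw [div_le_one hs]
      nlinarith [mul_pos ht hc]
    · change _ = tableV n 2 + _ * (tableV n 3 - tableV n 2)
      rw [tableV_two_eq H, tableV_three, h, ctr]
      push_cast
      field_simp
      ring
  · have h3 := poly_le hp (j := 2 * n + 1) (by omega)
    change z = ρ * uvec n ((2 * n + 1 : ℤ) : ℝ) at h
    have h' : z = - (ρ * uvec n 1) := by
      rw [h]
      push_cast
      rw [add_comm, uvec_add_two_n H]
      ring
    rw [h, ip_mul, ip_uvec, sub_self, zero_mul, Real.cos_zero, mul_one,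
      apo_congr (by omega : (2 * (n : ℤ) + 1) % 4 = 3 % 4)] at h3
    have h4 := apo_one_three_le H
    refine mem_segment_of_eq (ρ / tabR n) (by positivity) ?_ ?_
    · rw [div_le_one hr]
      linarith
    · change _ = tableV n 3 + _ * (tableV n 0 - tableV n 3)
      rw [tableV_zero, tableV_three, h', ctr]
      push_cast
      field_simp
      ring
  · have h3 := poly_le hp (j := 1) (by norm_num)
    change z = ρ * uvec n ((0 : ℤ) : ℝ) at h
    rw [h, ip_mul, ip_uvec, apo_two H] at h3
    norm_num at h3
    refine mem_segment_of_eq ρ h0 ?_ ?_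
    · exact le_of_mul_le_mul_right (by linarith) hc1
    · change _ = tableV n 0 + _ * (tableV n 1 - tableV n 0)
      rw [tableV_zero, tableV_one, h, ctr_two]
      simp

theorem mem_segment_wallB (H : Good n) {i : ℕ} (hi : i < 3) {z : ℂ} (hz : z ∈ part n i)
    (h : z = ‖z‖ * uvec n (wallB n i)) :
    ctr n i + z ∈ segment ℝ (tableV n (wallSideB i)) (tableV n (wallSideB i + 1)) := by
  obtain ⟨m, hm⟩ := H.odd
  have h0 := norm_nonneg z
  set ρ := ‖z‖
  have hr := tabR_pos H
  have hs := tabS_pos H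
  have ht := tabT_pos H
  have hr' : (tabR n : ℂ) ≠ 0 := by exact_mod_cast hr.ne'
  have hs' : (tabS n : ℂ) ≠ 0 := by exact_mod_cast hs.ne'
  have ht' : (tabT n : ℂ) ≠ 0 := by exact_mod_cast ht.ne'
  obtain ⟨-, -, hp⟩ := hz
  interval_cases i
  · have h3 := poly_le hp (j := 5) (by norm_num)
    change z = ρ * uvec n ((5 : ℤ) : ℝ) at h
    rw [h, ip_mul, ip_uvec, sub_self, zero_mul, Real.cos_zero, mul_one,
      apo_congr (by norm_num : (5 : ℤ) % 4 = 1 % 4), apo_zero_one H] at h3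
    refine mem_segment_of_eq (1 - ρ / tabT n) ?_ (by linarith [div_nonneg h0 ht.le]) ?_
    · rw [sub_nonneg, div_le_one ht]
      exact h3
    · change _ = tableV n 1 + _ * (tableV n 2 - tableV n 1)
      rw [tableV_two_eq H, tableV_one, one_eq_ctr H, h]
      push_cast
      field_simp
      ring
  · have h3 := poly_le hp (j := 2 * n + 3) (by omega)
    change z = ρ * uvec n ((2 * n + 3 : ℤ) : ℝ) at h
    have h' : z = - (ρ * uvec n 3) := by
      rw [h]
      push_cast
      rw [add_comm, uvec_add_two_n H]
      ring
    rw [h, ip_mul, ip_uvec, sub_self, zero_mul, Real.cos_zero, mul_one,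
      apo_congr (by omega : (2 * (n : ℤ) + 3) % 4 = 1 % 4)] at h3
    have h4 := apo_one_one_le H
    refine mem_segment_of_eq (1 - ρ / tabS n) ?_ (by linarith [div_nonneg h0 hs.le]) ?_
    · rw [sub_nonneg, div_le_one hs]
      linarith
    · change _ = tableV n 2 + _ * (tableV n 3 - tableV n 2)
      rw [tableV_two_eq H, tableV_three, h', ctr_one, ctr]
      push_cast
      field_simp
      ring
  · have h3 := poly_le hp (j := 1) (by norm_num)
    change z = ρ * uvec n ((1 : ℤ) : ℝ) at h
    rw [h, ip_mul, ip_uvec, apo_two H] at h3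
    norm_num at h3
    have h4 := cos_le_tabR H
    refine mem_segment_of_eq (1 - ρ / tabR n) ?_ (by linarith [div_nonneg h0 hr.le]) ?_
    · rw [sub_nonneg, div_le_one hr]
      linarith
    · change _ = tableV n 3 + _ * (tableV n 0 - tableV n 3)
      rw [tableV_zero, tableV_three, h, ctr_two]
      push_cast
      field_simp
      ring

/-- The elements of the group which fix a point of the unfolding over a point of the table. -/
def stab (n : ℕ) (p : quadRegion (tableV n)) : Subgroup (Grp n) where
  carrier := {h | ∀ g : Grp n, umk (n := n) ⟨g, p⟩ = umk ⟨g * h, p⟩}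
  one_mem' := fun g => by rw [mul_one]
  mul_mem' := fun {a b} ha hb g => by rw [← mul_assoc]; exact (ha g).trans (hb (g * a))
  inv_mem' := fun {a} ha g => by rw [ha (g * a⁻¹), inv_mul_cancel_right]

theorem side_mem_stab {s : Fin 4} {p : quadRegion (tableV n)}
    (hp : (p : ℂ) ∈ segment ℝ (tableV n s) (tableV n (s + 1))) : sideGen (tableV n) s ∈ stab n p :=
  fun g => umk_side g s hp

/-- Two points of a part which are equivalent under the group are equal, and the group element
fixes the corresponding point of the unfolding. -/
theorem part_chamber (H : Good n) {i : ℕ} (hi : i < 3) {z z' : ℂ} (hz : z ∈ part n i)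
    (hz' : z' ∈ part n i) (h : Grp n) (hpos : i ≠ 2 → IsPos n h.1) (e : h.1 z' = z) :
    z = z' ∧ h ∈ stab n ⟨ctr n i + z', part_mem H hi hz'⟩ := by
  have hnorm : ‖z‖ = ‖z'‖ := by rw [← e, LinearIsometryEquiv.norm_map]
  obtain ⟨s, hs1, hs2, hs⟩ := part_polar H hi hz
  obtain ⟨s', hs1', hs2', hs'⟩ := part_polar H hi hz'
  -- For the sectors of angle 2γ, an even element can only be a rotation with even exponent or a
  -- reflection with odd exponent, whatever representative is used.
  have hodd : ∀ k, i ≠ 2 → (IsRot n h.1 k → k % 2 = 0) ∧ (IsRef n h.1 k → k % 2 = 1) := by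
    intro k h2
    obtain ⟨l, hl | hl⟩ := hpos h2
    · refine ⟨fun hk => ?_, fun hk => ?_⟩
      · have e1 := hk 1
        rw [hl 1, mul_one, mul_one] at e1
        obtain ⟨q, hq⟩ := uvec_inj H e1
        have : (2 * (2 * l) : ℤ) = 2 * k + 4 * (n * q) := by
          have : ((2 * (2 * l) : ℤ) : ℝ) = ((2 * k + 4 * (n * q) : ℤ) : ℝ) := by
            push_cast at hq ⊢
            linarith
          exact_mod_cast this
        omega
      · exfalso
        have e1 := hk 1
        have e2 := hk Complex.I
        rw [hl 1, mul_one, map_one, mul_one] at e1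
        rw [hl Complex.I, e1, Complex.conj_I] at e2
        have e3 := mul_left_cancel₀ (uvec_ne_zero _) e2
        have := congrArg Complex.im e3
        norm_num at this
    · refine ⟨fun hk => ?_, fun hk => ?_⟩
      · exfalso
        have e1 := hk 1
        have e2 := hk Complex.I
        rw [hl 1, mul_one, map_one, mul_one] at e1
        rw [hl Complex.I, e1, Complex.conj_I] at e2
        have e3 := mul_left_cancel₀ (uvec_ne_zero _) e2
        have := congrArg Complex.im e3
        norm_num at this
      · have e1 := hk 1
        rw [hl 1, map_one, mul_one, mul_one] at e1
        obtain ⟨q, hq⟩ := uvec_inj H e1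
        have : (2 * (2 * l + 1) : ℤ) = 2 * k + 4 * (n * q) := by
          have : ((2 * (2 * l + 1) : ℤ) : ℝ) = ((2 * k + 4 * (n * q) : ℤ) : ℝ) := by
            push_cast at hq ⊢
            linarith
          exact_mod_cast this
        omega
  have hA := isRef_wallA H hi
  have hB := isRef_wallB H hi
  have hw := wall_cases (n := n) hi
  obtain ⟨k, hk⟩ := rot_or_ref H h
  -- At the center, which lies on both walls, the stabilizer contains both wall reflections, and
  -- these generate all admissible elements.
  by_cases h0 : z' = 0
  · have h0' : z = 0 := by rw [← e, h0, map_zero]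
    refine ⟨by rw [h0, h0'], ?_⟩
    have mA : sideGen (tableV n) (wallSideA i) ∈ stab n ⟨ctr n i + z', part_mem H hi hz'⟩ :=
      side_mem_stab (mem_segment_wallA H hi hz' (by simp [h0]))
    have mB : sideGen (tableV n) (wallSideB i) ∈ stab n ⟨ctr n i + z', part_mem H hi hz'⟩ :=
      side_mem_stab (mem_segment_wallB H hi hz' (by simp [h0]))
    have hBA := hB.mul hA
    have hrot : ∀ (h : Grp n) (k : ℤ), IsRot n h.1 k → (i ≠ 2 → k % 2 = 0) →
        h ∈ stab n ⟨ctr n i + z', part_mem H hi hz'⟩ := by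
      intro h k hk hk2
      have : ∃ m : ℤ, k = m * (wallB n i - wallA n i) := by
        rcases hw with ⟨_, hA, hB⟩ | ⟨h2, _, hB⟩
        · exact ⟨k, by rw [hA, hB]; ring⟩
        · have := hk2 h2
          exact ⟨k / 2, by rw [hB]; omega⟩
      obtain ⟨m, hm⟩ := this
      have : h = (sideGen (tableV n) (wallSideB i) * sideGen (tableV n) (wallSideA i)) ^ m := by
        apply Subtype.ext
        rw [Subgroup.coe_zpow, Subgroup.coe_mul]
        exact hk.ext (hBA.zpow m) (by rw [hm])
      rw [this]
      exact Subgroup.zpow_mem _ (Subgroup.mul_mem _ mB mA) m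
    rcases hk with hk | hk
    · exact hrot h k hk fun h2 => (hodd k h2).1 hk
    · have := hrot (h * sideGen (tableV n) (wallSideA i)) (k - wallA n i) (hk.mul hA) (fun h2 => by
        have := (hodd k h2).2 hk
        rcases hw with ⟨h3, _⟩ | ⟨_, h3, _⟩
        · exact absurd h3 h2
        · omega)
      exact (Subgroup.mul_mem_cancel_right _ mA).1 this
  · have hnz : (‖z'‖ : ℂ) ≠ 0 := by simpa using h0
    have e' : (‖z'‖ : ℂ) * h.1 (uvec n s') = ‖z'‖ * uvec n s := by
      rw [← hnorm, ← hs, ← e]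
      conv_rhs => rw [hs', ← Complex.real_smul, map_smul]
      rw [LinearIsometryEquiv.norm_map, Complex.real_smul]
    have e'' := mul_left_cancel₀ hnz e'
    rcases hk with hk | hk
    · rw [rot_uvec hk] at e''
      obtain ⟨q, hq⟩ := uvec_inj H e''
      -- Both arguments lie in one sector, so the rotation angle is at most the opening of the
      -- sector. Parity leaves only the identity.
      have hj : k = 2 * (n * q) := by
        have b1 : ((2 * (k - 2 * (n * q)) : ℤ) : ℝ) ≤ ((wallB n i - wallA n i : ℤ) : ℝ) := by
          push_cast
          linarith
        have b2 : ((-(wallB n i - wallA n i) : ℤ) : ℝ) ≤ ((2 * (k - 2 * (n * q)) : ℤ) : ℝ) := by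
          push_cast
          linarith
        have b1' : 2 * (k - 2 * (n * q)) ≤ wallB n i - wallA n i := by exact_mod_cast b1
        have b2' : -(wallB n i - wallA n i) ≤ 2 * (k - 2 * (n * q)) := by exact_mod_cast b2
        rcases hw with ⟨_, hA, hB⟩ | ⟨h2, _, hB⟩
        · omega
        · have := (hodd k h2).1 hk
          omega
      have h1 : h = 1 := by
        apply Subtype.ext
        refine hk.ext isRot_one ?_
        rw [hj]
        have := uvec_periodic H (2 * ((0 : ℤ) : ℝ)) q
        rw [← this]
        push_cast
        ring_nf
      subst h1
      exact ⟨by rw [← e]; rfl, Subgroup.one_mem _⟩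
    · rw [ref_uvec hk] at e''
      obtain ⟨q, hq⟩ := uvec_inj H e''
      have hsum : (2 * (k - 2 * (n * q)) : ℤ) = s + s' := by
        push_cast
        linarith
      have b1 : ((2 * wallA n i : ℤ) : ℝ) ≤ ((2 * (k - 2 * (n * q)) : ℤ) : ℝ) := by
        rw [hsum]
        push_cast
        linarith
      have b2 : ((2 * (k - 2 * (n * q)) : ℤ) : ℝ) ≤ ((2 * wallB n i : ℤ) : ℝ) := by
        rw [hsum]
        push_cast
        linarith
      have b1' : 2 * wallA n i ≤ 2 * (k - 2 * (n * q)) := by exact_mod_cast b1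
      have b2' : 2 * (k - 2 * (n * q)) ≤ 2 * wallB n i := by exact_mod_cast b2
      -- The axis of the reflection bisects the two arguments, hence lies in the closed sector.
      -- Parity forces it to be one of the walls, and then both points lie on that wall.
      have hcase : k - 2 * (n * q) = wallA n i ∨ k - 2 * (n * q) = wallB n i := by
        rcases hw with ⟨_, hA, hB⟩ | ⟨h2, _, hB⟩
        · omega
        · have := (hodd k h2).2 hk
          omega
      have hper : ∀ w : ℤ, k - 2 * (n * q) = w → uvec n (2 * k) = uvec n (2 * w) := by
        intro w hw
        rw [← uvec_periodic H (2 * (w : ℝ)) q, ← hw]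
        push_cast
        ring_nf
      rcases hcase with hc | hc
      · rw [hc] at hsum
        push_cast at hsum
        have es' : s' = wallA n i := by linarith
        have es : s = wallA n i := by linarith
        refine ⟨by rw [hs, hs', hnorm, es, es'], ?_⟩
        rw [show h = sideGen (tableV n) (wallSideA i) from Subtype.ext (hk.ext hA (hper _ hc))]
        exact side_mem_stab (mem_segment_wallA H hi hz' (by rw [← es']; exact hs'))
      · rw [hc] at hsum
        push_cast at hsum
        have es' : s' = wallB n i := by linarith
        have es : s = wallB n i := by linarith
        refine ⟨by rw [hs, hs', hnorm, es, es'], ?_⟩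
        rw [show h = sideGen (tableV n) (wallSideB i) from Subtype.ext (hk.ext hB (hper _ hc))]
        exact side_mem_stab (mem_segment_wallB H hi hz' (by rw [← es']; exact hs'))

/-- The point `q` of the polygons lies over the point `x` of the unfolding. -/
def Fold (H : Good n) (q : Pts n) (x : Unf n) : Prop :=
  ∃ (g : Grp n) (i : ℕ) (hi : i < 3) (z : ℂ) (hz : z ∈ part n i),
    q = pt H g i hi z hz.2.2 ∧ x = umk ⟨g, ⟨ctr n i + z, part_mem H hi hz⟩⟩

theorem lab_inj (H : Good n) {g g' : Grp n} {i i' : ℕ} (hi : i < 3) (hi' : i' < 3)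
    (h : lab n g.1 i = lab n g'.1 i') : i = i' ∧ (i ≠ 2 → IsPos n (g⁻¹ * g').1) := by
  unfold lab at h
  rcases pos_or_neg H g with hg | hg <;> rcases pos_or_neg H g' with hg' | hg'
  · refine ⟨?_, fun _ => hg.inv.mul hg'⟩
    rwa [if_pos hg, if_pos hg'] at h
  · by_cases hp : IsPos n g'.1
    · refine ⟨?_, fun _ => hg.inv.mul hp⟩
      rwa [if_pos hg, if_pos hp] at h
    · rw [if_pos hg, if_neg hp] at h
      omega
  · by_cases hp : IsPos n g.1
    · refine ⟨?_, fun _ => hp.inv.mul hg'⟩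
      rwa [if_pos hp, if_pos hg'] at h
    · rw [if_neg hp, if_pos hg'] at h
      omega
  · refine ⟨?_, fun _ => hg.inv.mul hg'⟩
    split_ifs at h <;> omega

theorem Fold.unique (H : Good n) {q : Pts n} {x x' : Unf n} (h : Fold H q x) (h' : Fold H q x') :
    x = x' := by
  obtain ⟨g, i, hi, z, hz, rfl, rfl⟩ := h
  obtain ⟨g', i', hi', z', hz', e, rfl⟩ := h'
  have e1 : lab n g.1 i = lab n g'.1 i' := congrArg (fun q => q.1.1) e
  have e2 : g.1 z = g'.1 z' := congrArg (fun q => q.1.2) e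
  obtain ⟨rfl, hpos⟩ := lab_inj H hi hi' e1
  obtain ⟨rfl, hst⟩ := part_chamber H hi hz hz' (g⁻¹ * g') hpos (by
    change g.1⁻¹ (g'.1 z') = z
    rw [← e2]
    exact inv_apply_apply _ _)
  have := hst g
  rwa [mul_inv_cancel_left] at this

theorem exists_pt (H : Good n) (q : Pts n) : ∃ (g : Grp n) (i : ℕ) (_ : i < 3),
    lab n g.1 i = q.1.1 ∧ g.1⁻¹ q.1.2 ∈ part n i := by
  obtain ⟨⟨a, z⟩, ha, hz⟩ := q
  change a < 5 at ha
  change z ∈ poly n a at hz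
  change ∃ (g : Grp n) (i : ℕ) (_ : i < 3), lab n g.1 i = a ∧ g.1⁻¹ z ∈ part n i
  by_cases h3 : a < 3
  · obtain ⟨g, hg, h⟩ := exists_fold H h3 hz
    refine ⟨g, a, h3, ?_, h⟩
    by_cases h2 : a = 2
    · rw [h2, lab_two]
    · unfold lab
      rw [if_pos (hg h2)]
  -- The polygons 3 and 4 contain no sector of the table itself. An odd reflection carries them to
  -- the polygons 1 and 0.
  · set σ : Grp n := sideGen (tableV n) 0
    have hneg : IsNeg n σ.1 := (pos_or_neg H σ).resolve_left (not_isPos_side_zero H)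
    have hz' := hneg.inv.mem_poly ha hz
    obtain ⟨g, hg, h⟩ := exists_fold H (by omega : 4 - a < 3) hz'
    have hg := hg (by omega)
    refine ⟨σ * g, 4 - a, by omega, ?_, ?_⟩
    · have : ¬ IsPos n (σ * g : Grp n).1 := by
        intro hp
        apply not_isPos_side_zero H
        have := hp.mul hg.inv
        rwa [Subgroup.coe_mul, mul_inv_cancel_right] at this
      unfold lab
      rw [if_neg this]
      omega
    · rw [Subgroup.coe_mul, mul_inv_rev]
      exact h

theorem fold_of_mem (H : Good n) {q : Pts n} {g : Grp n} {i : ℕ} (hi : i < 3)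
    (h1 : lab n g.1 i = q.1.1) (h2 : g.1⁻¹ q.1.2 ∈ part n i) :
    Fold H q (umk ⟨g, ⟨ctr n i + g.1⁻¹ q.1.2, part_mem H hi h2⟩⟩) := by
  refine ⟨g, i, hi, _, h2, ?_, rfl⟩
  apply Subtype.ext
  exact Prod.ext h1.symm (apply_inv_apply _ _).symm

theorem exists_Fold (H : Good n) (q : Pts n) : ∃ x, Fold H q x := by
  obtain ⟨g, i, hi, h1, h2⟩ := exists_pt H q
  exact ⟨_, fold_of_mem H hi h1 h2⟩

/-! ### Gluing of edges seen in the table -/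

theorem cr_rot {g : ℂ ≃ₗᵢ[ℝ] ℂ} {a : ℤ} (hg : IsRot n g a) (j : ℤ) (z : ℂ) :
    cr n j (g z) = cr n (j - 2 * a) z := by
  rw [hg]
  simp only [cr, Complex.mul_re, Complex.mul_im, uvec_re, uvec_im]
  push_cast
  rw [sub_mul (j : ℝ), Real.cos_sub, Real.sin_sub]
  ring

theorem cr_ref {g : ℂ ≃ₗᵢ[ℝ] ℂ} {a : ℤ} (hg : IsRef n g a) (j : ℤ) (z : ℂ) :
    cr n j (g z) = - cr n (2 * a - j) z := by
  rw [hg]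
  simp only [cr, Complex.mul_re, Complex.mul_im, uvec_re, uvec_im, Complex.conj_re, Complex.conj_im]
  push_cast
  rw [sub_mul (2 * (a : ℝ)), Real.cos_sub, Real.sin_sub]
  ring

/-- There is an element of the group that maps the direction `d` to the direction `j` and a point
on a given side of the first direction to a given point. -/
theorem exists_frame (H : Good n) {d j : ℤ} (hd : d % 2 = 1) (hj : j % 2 = 1) (p : ℂ) (ε : ℝ) :
    ∃ g : Grp n, (j % 4 = d % 4 → IsPos n g.1) ∧ (j % 4 ≠ d % 4 → IsNeg n g.1) ∧
      g.1 (uvec n d) = uvec n j ∧ (∀ z, ip n j (g.1 z) = ip n d z) ∧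
      (∀ z, |cr n j (g.1 z)| = |cr n d z|) ∧ 0 ≤ ε * cr n d (g.1⁻¹ p) := by
  -- Both a rotation and a reflection carry the direction `d` to `j`. They differ by a reflection
  -- that exchanges the two halves of the edge, so one of them produces the required sign.
  rcases le_total 0 (ε * cr n j p) with hε | hε
  · obtain ⟨g, hg⟩ := exists_rot H ((j - d) / 2)
    have e : j - 2 * ((j - d) / 2) = d := by omega
    refine ⟨g, fun h => ⟨(j - d) / 4, Or.inl ?_⟩, fun h => ⟨(j - d) / 4, Or.inl ?_⟩, ?_, fun z => ?_,
      fun z => ?_, ?_⟩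
    · rw [show 2 * ((j - d) / 4) = (j - d) / 2 by omega]
      exact hg
    · rw [show 2 * ((j - d) / 4) + 1 = (j - d) / 2 by omega]
      exact hg
    · rw [rot_uvec hg]
      congr 1
      have : (((2 * ((j - d) / 2) + d : ℤ)) : ℝ) = j := by
        exact_mod_cast (by omega : 2 * ((j - d) / 2) + d = j)
      push_cast at this ⊢
      exact this
    · rw [ip_rot hg, e]
    · rw [cr_rot hg, e]
    · have := cr_rot hg j (g.1⁻¹ p)
      rw [apply_inv_apply, e] at this
      rwa [← this]
  · obtain ⟨g, hg⟩ := exists_ref H ((j + d) / 2)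
    have e : 2 * ((j + d) / 2) - j = d := by omega
    refine ⟨g, fun h => ⟨(j + d) / 4, Or.inr ?_⟩, fun h => ⟨(j + d) / 4, Or.inr ?_⟩, ?_, fun z => ?_,
      fun z => ?_, ?_⟩
    · rw [show 2 * ((j + d) / 4) + 1 = (j + d) / 2 by omega]
      exact hg
    · rw [show 2 * ((j + d) / 4) = (j + d) / 2 by omega]
      exact hg
    · rw [ref_uvec hg]
      congr 1
      have : (((2 * ((j + d) / 2) - d : ℤ)) : ℝ) = j := by
        exact_mod_cast (by omega : 2 * ((j + d) / 2) - d = j)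
      push_cast at this ⊢
      exact this
    · rw [ip_ref hg, e]
    · rw [cr_ref hg, e, abs_neg]
    · have := cr_ref hg j (g.1⁻¹ p)
      rw [apply_inv_apply, e] at this
      rw [this] at hε
      linarith

theorem cr_add_two (j : ℤ) (z : ℂ) : cr n (j + 2) z = cr n j z * Real.cos (2 * gam n) -
    ip n j z * Real.sin (2 * gam n) := by
  unfold cr ip
  push_cast
  rw [add_mul (j : ℝ), Real.cos_add, Real.sin_add]
  ring

theorem cr_sub_two (j : ℤ) (z : ℂ) : cr n (j - 2) z = cr n j z * Real.cos (2 * gam n) +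
    ip n j z * Real.sin (2 * gam n) := by
  unfold cr ip
  push_cast
  rw [sub_mul (j : ℝ), Real.cos_sub, Real.sin_sub]
  ring

theorem ip_add_two' (j : ℤ) (z : ℂ) : ip n (j + 2) z = ip n j z * Real.cos (2 * gam n) +
    cr n j z * Real.sin (2 * gam n) := ip_add_two j z

theorem ip_sub_two' (j : ℤ) (z : ℂ) : ip n (j - 2) z = ip n j z * Real.cos (2 * gam n) -
    cr n j z * Real.sin (2 * gam n) := ip_sub_two j z

/-- Half of an edge between the polygons `1` and `2`. -/
theorem edge_one_two (H : Good n) {w : ℂ} (h : ip n 1 w = - apo n 1 3) (h0 : cr n 1 w ≤ 0)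
    (h1 : - Real.sin (gam n) ≤ cr n 1 w) : w ∈ part n 1 ∧ w + tabR n * uvec n 1 ∈ part n 2 := by
  have hs := H.sin_two_pos
  have hs1 := H.sin_one_pos
  have hc := H.cos_two_pos
  have hc1 := H.cos_one_pos
  have ht := tabT_pos H
  have him := table_im H
  have e3 : Real.sin (3 * gam n) = Real.sin (2 * gam n) * Real.cos (gam n) +
      Real.cos (2 * gam n) * Real.sin (gam n) := by
    rw [← Real.sin_add]
    ring_nf
  have a13 := apo_one_three H
  refine ⟨mem_part_one H h0 ?_ (by linarith) ?_, mem_part_two H ?_ ?_ ?_⟩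
  · rw [show (3 : ℤ) = 1 + 2 by norm_num, cr_add_two, h, a13]
    nlinarith [mul_le_mul_of_nonneg_right h1 hc.le, mul_pos ht hs]
  · have e := apo_add_two H 1 3
    rw [apo_congr (by norm_num : (3 + 2 : ℤ) % 4 = 1 % 4)] at e
    have hh : hl n 1 3 = Real.sin (gam n) := by
      rw [← halfSide_two (n := n)]
      simp [hl]
    rw [show (3 : ℤ) = 1 + 2 by norm_num, ip_add_two', h, e, hh]
    nlinarith [mul_le_mul_of_nonneg_right h1 hs.le]
  · have key : ∀ z, cr n 0 z = ip n 1 z * Real.sin (gam n) + cr n 1 z * Real.cos (gam n) := by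
      intro z
      simp only [cr, ip]
      push_cast
      rw [zero_mul, one_mul, Real.cos_zero, Real.sin_zero]
      have := Real.sin_sq_add_cos_sq (gam n)
      linear_combination (-z.im) * this
    rw [key, ip_add, cr_add, ip_mul, cr_mul, ip_uvec, cr_uvec, h, a13]
    norm_num
    nlinarith [mul_le_mul_of_nonneg_right h1 hc1.le]
  · rw [cr_add, cr_mul, cr_uvec]
    simpa using h0
  · rw [ip_add, ip_mul, ip_uvec, h, a13]
    norm_num

/-- Half of an edge between the polygons `0` and `1`. -/
theorem edge_zero_one (H : Good n) {w : ℂ} (h : ip n 3 w = apo n 0 3) (h0 : 0 ≤ cr n 3 w)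
    (h1 : cr n 3 w ≤ halfSide n 1) : w ∈ part n 0 ∧ w - tabS n * uvec n 3 ∈ part n 1 := by
  have hs := H.sin_two_pos
  have hc := H.cos_two_pos
  have ht := tabT_pos H
  have hh := halfSide_one H
  rw [hh] at h1
  have a03 := apo_zero_three H
  rw [a03] at h
  have hsq := Real.sin_sq_add_cos_sq (2 * gam n)
  have k1 := mul_le_mul_of_nonneg_right h1 hc.le
  have k2 := mul_le_mul_of_nonneg_right h1 hs.le
  have ei : ip n 3 (w - tabS n * uvec n 3) = tabT n * Real.cos (2 * gam n) - tabS n := by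
    rw [ip_sub, ip_mul, ip_uvec, h]
    norm_num
  have ec : cr n 3 (w - tabS n * uvec n 3) = cr n 3 w := by
    rw [cr_sub, cr_mul, cr_uvec]
    norm_num
  refine ⟨mem_part_zero H h0 ?_ (by rw [h, a03]) ?_, mem_part_one H ?_ ?_ ?_ ?_⟩
  · rw [show (5 : ℤ) = 3 + 2 by norm_num, cr_add_two, h]
    nlinarith
  · rw [show (5 : ℤ) = 3 + 2 by norm_num, ip_add_two', h, apo_zero_one H]
    nlinarith
  · rw [show (1 : ℤ) = 3 - 2 by norm_num, cr_sub_two, ei, ec]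
    nlinarith [mul_le_mul_of_nonneg_right (two_tabT_le H) hs.le]
  · rw [ec]
    exact h0
  · have e := apo_add_two H 1 1
    have hl1 : hl n 1 1 = halfSide n 1 := by simp [hl]
    rw [show (1 + 2 : ℤ) = 3 by norm_num, hl1, hh, apo_one_one H] at e
    rw [show (1 : ℤ) = 3 - 2 by norm_num, ip_sub_two', ei, ec]
    rw [e]
    nlinarith
  · rw [ei, apo_one_one H]
    linarith

theorem fold_pair (H : Good n) {q q' : Pts n} {g : Grp n} {i i' : ℕ} (hi : i < 3) (hi' : i' < 3)
    (h1 : lab n g.1 i = q.1.1) (h2 : g.1⁻¹ q.1.2 ∈ part n i)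
    (h1' : lab n g.1 i' = q'.1.1) (h2' : g.1⁻¹ q'.1.2 ∈ part n i')
    (e : ctr n i + g.1⁻¹ q.1.2 = ctr n i' + g.1⁻¹ q'.1.2) : ∃ x, Fold H q x ∧ Fold H q' x := by
  refine ⟨_, fold_of_mem H hi h1 h2, ?_⟩
  have := fold_of_mem H hi' h1' h2'
  convert this using 4

theorem lab_pos {g : ℂ ≃ₗᵢ[ℝ] ℂ} (hg : IsPos n g) (i : ℕ) : lab n g i = i := if_pos hg

theorem IsNeg.not_isPos (H : Good n) {g : Grp n} (hg : IsNeg n g.1) : ¬ IsPos n g.1 := by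
  intro hp
  have hσ := (pos_or_neg H (sideGen (tableV n) 0)).resolve_left (not_isPos_side_zero H)
  have := hp.inv.mul (hg.mul hσ)
  rw [inv_mul_cancel_left] at this
  exact not_isPos_side_zero H this

theorem lab_neg (H : Good n) {g : Grp n} (hg : IsNeg n g.1) (i : ℕ) : lab n g.1 i = 4 - i :=
  if_neg (hg.not_isPos H)

/-- By symmetry every point of a glued edge can be moved to the half edge that lies in the interior
of the table between two sectors. There the two glued points are the same point of the table. -/
theorem EdgeRel.fold (H : Good n) {q q' : Pts n} (h : EdgeRel n q q') :
    ∃ x, Fold H q x ∧ Fold H q' x := by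
  obtain ⟨m, hm⟩ := H.odd
  obtain ⟨j, hj, h1, h2, h3⟩ := h
  obtain ⟨⟨b, p⟩, hb, hp⟩ := q
  obtain ⟨⟨b', p'⟩, hb', hp'⟩ := q'
  change b' = b + 1 at h1
  change ip n j p = apo n b j at h2
  change p' = p - centerDist n b * uvec n j at h3
  change b < 5 at hb
  change b' < 5 at hb'
  change p ∈ poly n b at hp
  subst h1
  have habs : |cr n j p| ≤ hl n b j := abs_le_hl H hp (by omega) h2
  have hlj : hl n b j = halfSide n (b + 1) := by simp [hl, hj]
  rw [hlj] at habs
  have hp3 : ∀ (g : Grp n) (d : ℤ), g.1 (uvec n d) = uvec n j →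
      g.1⁻¹ p' = g.1⁻¹ p - centerDist n b * uvec n d := by
    intro g d hg
    rw [h3, map_sub, ← Complex.real_smul, ← Complex.real_smul, map_smul, ← hg, inv_apply_apply]
  have hb4 : b < 4 := by omega
  have r12 := halfSide_two (n := n)
  have e1 : uvec n ((2 * n + 1 : ℤ) : ℝ) = - uvec n 1 := by
    push_cast
    rw [add_comm, uvec_add_two_n H]
  have e3 : uvec n ((2 * n + 3 : ℤ) : ℝ) = - uvec n 3 := by
    push_cast
    rw [add_comm, uvec_add_two_n H]
  clear h3
  interval_cases b
  · obtain ⟨g, g1, -, g3, g4, g5, g6⟩ := exists_frame H (d := 3) (by norm_num) (by omega : j % 2 = 1) p 1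
    have hg := g1 (by omega)
    have c1 := g5 (g.1⁻¹ p)
    have c2 := g4 (g.1⁻¹ p)
    rw [apply_inv_apply] at c1 c2
    rw [c1] at habs
    rw [h2, apo_congr (by omega : j % 4 = 3 % 4)] at c2
    have hw := edge_zero_one H c2.symm (by linarith) (le_of_abs_le habs)
    have e := hp3 g 3 g3
    rw [centerDist_zero H] at e
    norm_num [-LinearIsometryEquiv.coe_inv] at e
    refine fold_pair H (g := g) (by norm_num : 0 < 3) (by norm_num : 1 < 3) (lab_pos hg 0) hw.1
      (lab_pos hg 1) ?_ ?_
    · change g.1⁻¹ p' ∈ _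
      rw [e]
      exact hw.2
    · change _ + g.1⁻¹ p = _ + g.1⁻¹ p'
      rw [e, ctr_one, ctr]
      ring
  · obtain ⟨g, g1, -, g3, g4, g5, g6⟩ := exists_frame H (d := 2 * n + 1) (by omega) (by omega : j % 2 = 1) p 1
    have hg := g1 (by omega)
    have c1 := g5 (g.1⁻¹ p)
    have c2 := g4 (g.1⁻¹ p)
    rw [apply_inv_apply] at c1 c2
    rw [c1, cr_opp H, abs_neg, r12] at habs
    rw [cr_opp H] at g6
    rw [h2, apo_congr (by omega : j % 4 = 3 % 4), ip_opp H] at c2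
    have hw := edge_one_two H (by linarith) (by linarith) (neg_le_of_abs_le habs)
    have e := hp3 g _ g3
    rw [centerDist_one H, e1, mul_neg, sub_neg_eq_add] at e
    refine fold_pair H (g := g) (by norm_num : 1 < 3) (by norm_num : 2 < 3) (lab_pos hg 1) hw.1
      (lab_pos hg 2) ?_ ?_
    · change g.1⁻¹ p' ∈ _
      rw [e]
      exact hw.2
    · change _ + g.1⁻¹ p = _ + g.1⁻¹ p'
      rw [e, ctr_one, ctr_two]
      ring
  -- The edge between the polygons 2 and 3 is the image of the edge between 2 and 1 under an odd
  -- element, so the roles of the two points are exchanged.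
  · obtain ⟨g, -, g1, g3, g4, g5, g6⟩ := exists_frame H (d := 1) (by norm_num) (by omega : j % 2 = 1) p (-1)
    have hg := g1 (by omega)
    have c1 := g5 (g.1⁻¹ p)
    have c2 := g4 (g.1⁻¹ p)
    rw [apply_inv_apply] at c1 c2
    have r32 : halfSide n (2 + 1) = Real.sin (gam n) := by
      rw [← r12, ← halfSide_reflect (by norm_num : 2 ≤ 5)]
    rw [c1, r32] at habs
    rw [h2, apo_two H] at c2
    have e := hp3 g 1 g3
    rw [← centerDist_reflect H (by norm_num : 2 < 4), centerDist_one H] at e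
    rw [Int.cast_one] at e
    have hw := edge_one_two H (w := g.1⁻¹ p') (by
        rw [e, ip_sub, ip_mul, ip_uvec, ← c2, apo_one_three H]
        norm_num [-LinearIsometryEquiv.coe_inv]) (by
        rw [e, cr_sub, cr_mul, cr_uvec]
        norm_num [-LinearIsometryEquiv.coe_inv]
        linarith) (by
        rw [e, cr_sub, cr_mul, cr_uvec]
        norm_num [-LinearIsometryEquiv.coe_inv]
        exact neg_le_of_abs_le habs)
    refine fold_pair H (g := g) (by norm_num : 2 < 3) (by norm_num : 1 < 3) lab_two ?_
      (lab_neg H hg 1) hw.1 ?_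
    · change g.1⁻¹ p ∈ _
      have := hw.2
      rwa [e, sub_add_cancel] at this
    · change _ + g.1⁻¹ p = _ + g.1⁻¹ p'
      rw [e, ctr_one, ctr_two]
      ring
  · obtain ⟨g, -, g1, g3, g4, g5, g6⟩ := exists_frame H (d := 2 * n + 3) (by omega) (by omega : j % 2 = 1) p (-1)
    have hg := g1 (by omega)
    have c1 := g5 (g.1⁻¹ p)
    have c2 := g4 (g.1⁻¹ p)
    rw [apply_inv_apply] at c1 c2
    have r41 : halfSide n (3 + 1) = halfSide n 1 := by
      rw [← halfSide_reflect (by norm_num : 1 ≤ 5)]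
    rw [c1, cr_opp H, abs_neg, r41] at habs
    rw [cr_opp H] at g6
    have a3 : apo n 3 j = apo n 1 1 := by
      rw [show 3 = 4 - 1 by norm_num, apo_reflect (by norm_num) (by omega)]
      exact apo_congr (by omega)
    rw [h2, a3, apo_one_one H, ip_opp H] at c2
    have e := hp3 g _ g3
    have d3 : centerDist n 3 = tabS n := by
      rw [show 3 = 3 - 0 by norm_num, centerDist_reflect H (by norm_num : 0 < 4), centerDist_zero H]
    rw [d3, e3, mul_neg, sub_neg_eq_add] at e
    have hw := edge_zero_one H (w := g.1⁻¹ p') (by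
        rw [e, ip_add, ip_mul, ip_uvec, apo_zero_three H]
        norm_num [-LinearIsometryEquiv.coe_inv]
        linarith) (by
        rw [e, cr_add, cr_mul, cr_uvec]
        norm_num [-LinearIsometryEquiv.coe_inv]
        linarith) (by
        rw [e, cr_add, cr_mul, cr_uvec]
        norm_num [-LinearIsometryEquiv.coe_inv]
        exact le_of_abs_le habs)
    refine fold_pair H (g := g) (by norm_num : 1 < 3) (by norm_num : 0 < 3) (lab_neg H hg 1) ?_
      (lab_neg H hg 0) hw.1 ?_
    · change g.1⁻¹ p ∈ _
      have := hw.2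
      rwa [e, add_sub_cancel_right] at this
    · change _ + g.1⁻¹ p = _ + g.1⁻¹ p'
      rw [e, ctr_one, ctr]
      ring

/-- The map from the surface made of the five polygons to the unfolding. -/
def kappa (H : Good n) : PolySurf n → Unf n :=
  Quot.lift (fun q => (exists_Fold H q).choose) fun q q' h => by
    obtain ⟨x, h1, h2⟩ := h.fold H
    exact ((exists_Fold H q).choose_spec.unique H h1).trans
      (h2.unique H (exists_Fold H q').choose_spec)

theorem kappa_pmk (H : Good n) {q : Pts n} {x : Unf n} (h : Fold H q x) : kappa H (pmk q) = x :=
  (exists_Fold H q).choose_spec.unique H h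

theorem kappa_phi (H : Good n) (x : Unf n) : kappa H (phi H x) = x := by
  induction x using Quot.ind with
  | mk d =>
    obtain ⟨g, p, hp⟩ := d
    obtain ⟨i, hi, h⟩ := exists_part H hp
    change kappa H (phi H (umk ⟨g, ⟨p, hp⟩⟩)) = umk ⟨g, ⟨p, hp⟩⟩
    rw [phi_umk H ⟨g, ⟨p, hp⟩⟩ hi h]
    refine kappa_pmk H ⟨g, i, hi, _, h, rfl, ?_⟩
    congr 3
    ring

theorem phi_kappa (H : Good n) (y : PolySurf n) : phi H (kappa H y) = y := by
  induction y using Quot.ind with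
  | mk q =>
    obtain ⟨x, hx⟩ := exists_Fold H q
    change phi H (kappa H (pmk q)) = pmk q
    rw [kappa_pmk H hx]
    obtain ⟨g, i, hi, z, hz, rfl, rfl⟩ := hx
    have e : ctr n i + z - ctr n i = z := by ring
    rw [phi_umk H ⟨g, ⟨ctr n i + z, part_mem H hi hz⟩⟩ hi (by rw [e]; exact hz)]
    congr 1
    exact pt_congr H rfl (by rw [e])

/-! ### The homeomorphism between the two surfaces -/

/-- The developing map of the copies of the table. -/
abbrev udev (n : ℕ) : Cop n → ℂ := develop (quadRegion (tableV n)) (tableV n)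

theorem isQuotientMap_umk : IsQuotientMap (umk (n := n)) := isQuotientMap_quot_mk

theorem isQuotientMap_pmk : IsQuotientMap (pmk (n := n)) := isQuotientMap_quot_mk

theorem isClosed_part (n i : ℕ) : IsClosed (part n i) := by
  have h1 : ∀ j, Continuous (cr n j) := fun j => by unfold cr; fun_prop
  have h2 : ∀ j, Continuous (ip n j) := fun j => by unfold ip; fun_prop
  have h3 : IsClosed (poly n i) := by
    unfold poly
    simp only [Set.ofPred_forall]
    exact isClosed_iInter fun k => isClosed_le (h2 _) continuous_const
  exact (isClosed_le continuous_const (h1 _)).inter ((isClosed_le (h1 _) continuous_const).inter h3)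

theorem continuous_cop_snd : Continuous fun d : Cop n => (d.2 : ℂ) :=
  continuous_sigma fun _ => continuous_subtype_val

theorem continuous_udev : Continuous (udev n) :=
  continuous_sigma fun g => g.1.continuous.comp continuous_subtype_val

-- The cover consists of the copies of the three parts. On each one the map is a translation in the
-- plane coordinate, hence the derivative 1.
open Classical in
theorem affLift_phi (H : Good n) :
    AffLift 1 (udev n) pdev (fun d => phi H (umk d)) pmk := by
  have := finite_grp H
  have hbase : (0 : ℂ) ∈ part n 2 := mem_part_two H (by simp [cr]) (by simp [cr]) (by
    simp only [ip, Complex.zero_re, Complex.zero_im, zero_mul, add_zero]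
    exact H.cos_one_pos.le)
  refine ⟨Grp n × Fin 3, inferInstance,
    fun k => {d | d.1 = k.1 ∧ (d.2 : ℂ) - ctr n k.2 ∈ part n k.2},
    fun k d => if h : (d.2 : ℂ) - ctr n k.2 ∈ part n k.2 then pt H k.1 k.2 k.2.2 _ h.2.2 else
      pt H 1 2 (by norm_num) 0 hbase.2.2,
    fun k => - k.1.1 (ctr n k.2), fun k => ?_, fun d => ?_, fun k => ?_, fun k d hd => ?_⟩
  · rw [isClosed_sigma_iff]
    intro g
    change IsClosed {p : quadRegion (tableV n) | g = k.1 ∧ (p : ℂ) - ctr n k.2 ∈ part n k.2}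
    refine isClosed_const.and ?_
    exact (isClosed_part n k.2).preimage (continuous_subtype_val.sub continuous_const)
  · obtain ⟨i, hi, h⟩ := exists_part H d.2.2
    exact ⟨(d.1, ⟨i, hi⟩), rfl, h⟩
  · refine Topology.IsInducing.subtypeVal.continuousOn_iff.2 ?_
    refine ContinuousOn.congr (f := fun d : Cop n =>
      (lab n k.1.1 k.2, k.1.1 ((d.2 : ℂ) - ctr n k.2))) ?_ ?_
    · exact (continuous_const.prodMk
        (k.1.1.continuous.comp (continuous_cop_snd.sub continuous_const))).continuousOn
    · intro d hd
      simp only [Function.comp, dif_pos hd.2]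
      rfl
  · obtain ⟨g, p⟩ := d
    obtain ⟨h1, h2⟩ := hd
    change g = k.1 at h1
    subst h1
    simp only [dif_pos h2, matAct_one]
    refine ⟨phi_umk H _ k.2.2 h2, ?_⟩
    change k.1.1 ((p : ℂ) - ctr n k.2) = k.1.1 p + _
    rw [map_sub]
    ring

open Classical in
theorem affLift_kappa (H : Good n) :
    AffLift 1 pdev (udev n) (fun q => kappa H (pmk q)) umk := by
  have := finite_grp H
  refine ⟨Grp n × Fin 3, inferInstance,
    fun k => {q | lab n k.1.1 k.2 = q.1.1 ∧ k.1.1⁻¹ q.1.2 ∈ part n k.2},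
    fun k q => if h : k.1.1⁻¹ q.1.2 ∈ part n k.2 then
      ⟨k.1, ⟨ctr n k.2 + k.1.1⁻¹ q.1.2, part_mem H k.2.2 h⟩⟩ else
      ⟨1, ⟨_, vertex_mem_quadRegion _ 0⟩⟩,
    fun k => k.1.1 (ctr n k.2), fun k => ?_, fun q => ?_, fun k => ?_, fun k q hq => ?_⟩
  · refine IsClosed.and ?_ ?_
    · exact isClosed_eq continuous_const (continuous_fst.comp continuous_subtype_val)
    · exact (isClosed_part n k.2).preimage (k.1.1⁻¹.continuous.comp continuous_pdev)
  · obtain ⟨g, i, hi, h1, h2⟩ := exists_pt H q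
    exact ⟨(g, ⟨i, hi⟩), h1, h2⟩
  · rw [continuousOn_iff_continuous_domRestrict]
    have : Continuous fun q : {q : Pts n | lab n k.1.1 k.2 = q.1.1 ∧ k.1.1⁻¹ q.1.2 ∈ part n k.2} =>
        (⟨k.1, ⟨ctr n k.2 + k.1.1⁻¹ q.1.1.2, part_mem H k.2.2 q.2.2⟩⟩ : Cop n) := by
      refine continuous_sigmaMk.comp (Continuous.subtype_mk ?_ _)
      exact continuous_const.add (k.1.1⁻¹.continuous.comp (continuous_pdev.comp continuous_subtype_val))
    convert this using 1
    ext1 q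
    simp only [Set.domRestrict_apply]
    rw [dif_pos q.2.2]
  · simp only [dif_pos hq.2, matAct_one]
    refine ⟨kappa_pmk H (fold_of_mem H k.2.2 hq.1 hq.2), ?_⟩
    change k.1.1 (ctr n k.2 + k.1.1⁻¹ q.1.2) = q.1.2 + _
    rw [map_add, apply_inv_apply, add_comm]

/-- The unfolding is homeomorphic to the surface made of the five polygons. -/
def phiHomeo (H : Good n) : Unf n ≃ₜ PolySurf n where
  toFun := phi H
  invFun := kappa H
  left_inv := kappa_phi H
  right_inv := phi_kappa H
  continuous_toFun := isQuotientMap_umk.continuous_iff.2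
    ((affLift_phi H).continuous isQuotientMap_pmk.continuous)
  continuous_invFun := isQuotientMap_pmk.continuous_iff.2
    ((affLift_kappa H).continuous isQuotientMap_umk.continuous)

/-! ### Flat functions and affine homeomorphisms -/

theorem continuous_matAct (A : SL(2, ℝ)) : Continuous (matAct A) := by
  have : Continuous fun z : ℂ => Complex.equivRealProdCLM.symm
      (A 0 0 * z.re + A 0 1 * z.im, A 1 0 * z.re + A 1 1 * z.im) := by
    refine Complex.equivRealProdCLM.symm.continuous.comp ?_
    fun_prop
  exact this

/-- A matrix as a homeomorphism of the plane. -/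
def matHomeo (A : SL(2, ℝ)) : ℂ ≃ₜ ℂ where
  toFun := matAct A
  invFun := matAct A⁻¹
  left_inv z := by rw [← matAct_mul, inv_mul_cancel, matAct_one]
  right_inv z := by rw [← matAct_mul, mul_inv_cancel, matAct_one]
  continuous_toFun := continuous_matAct A
  continuous_invFun := continuous_matAct A⁻¹

/-- Flat functions with the same derivative locally differ by a constant. -/
theorem FlatOn.locally_const {W Z : Type*} [TopologicalSpace W] [TopologicalSpace Z] {q : W → Z}
    (hq : IsQuotientMap q) {A : SL(2, ℝ)} {dev : W → ℂ} {U U' : Set Z} {φ ψ : Z → ℂ}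
    (hU : IsOpen U) (hU' : IsOpen U') (hφ : FlatOn A dev q U φ) (hψ : FlatOn A dev q U' ψ)
    {x : Z} (hx : x ∈ U) (hx' : x ∈ U') : ∃ c : ℂ, ∀ᶠ y in 𝓝 x, φ y = ψ y + c := by
  refine ⟨φ x - ψ x, ?_⟩
  let S : Set Z := {y | y ∈ U ∧ y ∈ U' ∧ φ y - ψ y = φ x - ψ x}
  have hS : IsOpen S := by
    rw [← hq.isOpen_preimage, isOpen_iff_mem_nhds]
    rintro w ⟨h1, h2, h3⟩
    obtain ⟨c, hc⟩ := hφ w h1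
    obtain ⟨c', hc'⟩ := hψ w h2
    have k1 := hc.self_of_nhds
    have k2 := hc'.self_of_nhds
    filter_upwards [hc, hc', hq.continuous.continuousAt.eventually (hU.mem_nhds h1),
      hq.continuous.continuousAt.eventually (hU'.mem_nhds h2)] with w' a1 a2 a3 a4
    refine ⟨a3, a4, ?_⟩
    rw [a1, a2, ← h3, k1, k2]
    ring
  filter_upwards [hS.mem_nhds (⟨hx, hx', rfl⟩ : x ∈ S)] with y hy
  linear_combination hy.2.2

theorem mem_charts_iff {e : OpenPartialHomeomorph (Unf n) ℂ} :
    e ∈ (quadSurface (tableV n)).charts ↔ FlatOn 1 (udev n) umk e.source e := by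
  simp only [FlatOn, matAct_one]
  rfl

/-- The function `f` has derivative `A` in the sense that it pulls back flat functions to functions
with derivative `A`. -/
def HasDer (f : Unf n → Unf n) (A : SL(2, ℝ)) : Prop :=
  ∀ (U : Set (Unf n)) (φ : Unf n → ℂ), FlatOn 1 (udev n) umk U φ →
    FlatOn A (udev n) umk (f ⁻¹' U) (φ ∘ f)

/-- Pulling back a chart by `f` and undoing the derivative with `A⁻¹` gives a chart of the atlas. No
description of the singular points is needed. -/
theorem HasDer.isRegular {f : Unf n ≃ₜ Unf n} {A : SL(2, ℝ)} (hf : HasDer f A) {x : Unf n}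
    (hx : (quadSurface (tableV n)).IsRegular (f x)) : (quadSurface (tableV n)).IsRegular x := by
  obtain ⟨e, he, hxe⟩ := hx
  rw [mem_charts_iff] at he
  refine ⟨(f.toOpenPartialHomeomorph.trans e).trans (matHomeo A⁻¹).toOpenPartialHomeomorph, ?_, ?_⟩
  · rw [mem_charts_iff]
    intro w hw
    have hw' : f (umk w) ∈ e.source := by simpa using hw
    obtain ⟨c, hc⟩ := hf _ _ he w hw'
    refine ⟨matAct A⁻¹ c, ?_⟩
    filter_upwards [hc] with w' h1
    change matAct A⁻¹ (e (f (umk w'))) = _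
    rw [matAct_one]
    simp only [Function.comp] at h1
    rw [h1, matAct_add, ← matAct_mul, inv_mul_cancel, matAct_one]
  · simpa using hxe

/-- In the overlap of two charts, the pulled back chart and `A` applied to the source chart have the
same derivative, so they differ locally by a constant. -/
theorem isAffine_of_hasDer {f : Unf n ≃ₜ Unf n} {A : SL(2, ℝ)} (hf : HasDer f A)
    (hf' : HasDer f.symm A⁻¹) : (quadSurface (tableV n)).IsAffine f A := by
  refine ⟨fun x => ⟨fun h => hf.isRegular h, fun h => ?_⟩, ?_⟩
  · apply hf'.isRegular
    rwa [f.symm_apply_apply]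
  · intro e he e' he' x hx hx'
    rw [mem_charts_iff] at he he'
    refine FlatOn.locally_const (φ := e' ∘ f) (ψ := fun y => matAct A (e y)) (A := A)
      isQuotientMap_umk (e'.open_source.preimage f.continuous) e.open_source (hf _ _ he') ?_ hx' hx
    intro w hw
    obtain ⟨c, hc⟩ := he w hw
    refine ⟨matAct A c, ?_⟩
    filter_upwards [hc] with w' h1
    rw [h1, matAct_add, matAct_one]

/-! ### The twist -/

/-- The powers of the twist, on the unfolding. -/
def unfTwist (H : Good n) (ε : ℤ) : Unf n ≃ₜ Unf n :=
  ((phiHomeo H).trans (twistHomeo H ε)).trans (phiHomeo H).symm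

/-- The chain rule `AffLift.flatOn` applied to the three factors `phi`, the twist and `kappa`; the
outer two have derivative 1. -/
theorem hasDer_unfTwist (H : Good n) (ε : ℤ) : HasDer (unfTwist H ε) (twMat n ε) := by
  intro U φ h
  have h1 : FlatOn 1 pdev pmk (kappa H ⁻¹' U) (φ ∘ kappa H) := by
    have := (affLift_kappa H).flatOn h
    rw [mul_one] at this
    exact this
  have h2 : FlatOn (twMat n ε) pdev pmk (twistFun H ε ⁻¹' (kappa H ⁻¹' U))
      ((φ ∘ kappa H) ∘ twistFun H ε) := by
    have := (affLift_twist H ε).flatOn h1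
    rw [one_mul] at this
    exact this
  have h3 := (affLift_phi H).flatOn h2
  rw [mul_one] at h3
  exact h3

theorem twMat_one : twMat n 1 = matT n := by
  apply Subtype.ext
  simp [twMat, matT, shear]

theorem twMat_neg (ε : ℤ) : twMat n (-ε) = (twMat n ε)⁻¹ := by
  apply eq_inv_of_mul_eq_one_left
  apply Subtype.ext
  rw [Matrix.SpecialLinearGroup.coe_mul]
  ext i j
  fin_cases i <;> fin_cases j <;> simp [twMat, Matrix.mul_apply, Fin.sum_univ_two]

theorem unfTwist_symm (H : Good n) (ε : ℤ) : (unfTwist H ε).symm = unfTwist H (-ε) := by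
  ext x
  rfl

theorem twMat_mem (H : Good n) (k : ℤ) : twMat n k ∈ (quadSurface (tableV n)).affineGroup := by
  refine ⟨unfTwist H k, isAffine_of_hasDer (hasDer_unfTwist H k) ?_⟩
  rw [← twMat_neg, unfTwist_symm]
  exact hasDer_unfTwist H (-k)

theorem matT_mem (H : Good n) : matT n ∈ (quadSurface (tableV n)).affineGroup := by
  rw [← twMat_one]
  exact twMat_mem H 1

/-! ### The rotation -/

/-- The action of the reflection group on the unfolding. -/
def lmul (H : Good n) (a : Grp n) : Unf n → Unf n :=
  Quot.lift (fun d => umk ⟨a * d.1, d.2⟩) fun d d' h => by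
    cases h with
    | side g s p hp =>
      rw [← mul_assoc]
      exact umk_side _ s hp
    | translate g g' t h p p' hp =>
      obtain ⟨rfl, rfl⟩ := translate_trivial H h
      rw [add_zero] at hp
      rw [Subtype.ext (g.1.injective hp)]

theorem continuous_cop_mul (a : Grp n) : Continuous fun d : Cop n => (⟨a * d.1, d.2⟩ : Cop n) :=
  continuous_sigma fun g =>
    @continuous_sigmaMk (Grp n) (fun _ => quadRegion (tableV n)) _ (a * g)

theorem lmul_lmul (H : Good n) (a b : Grp n) (x : Unf n) : lmul H a (lmul H b x) = lmul H (a * b) x := by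
  induction x using Quot.ind with
  | mk d =>
    change umk ⟨a * (b * d.1), d.2⟩ = umk ⟨a * b * d.1, d.2⟩
    rw [mul_assoc]

theorem lmul_one (H : Good n) (x : Unf n) : lmul H 1 x = x := by
  induction x using Quot.ind with
  | mk d =>
    change umk ⟨1 * d.1, d.2⟩ = umk d
    rw [one_mul]

/-- The action of the reflection group on the unfolding, by homeomorphisms. -/
def lmulHomeo (H : Good n) (a : Grp n) : Unf n ≃ₜ Unf n where
  toFun := lmul H a
  invFun := lmul H a⁻¹
  left_inv x := by rw [lmul_lmul, inv_mul_cancel, lmul_one]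
  right_inv x := by rw [lmul_lmul, mul_inv_cancel, lmul_one]
  continuous_toFun := isQuotientMap_umk.continuous_iff.2
    (isQuotientMap_umk.continuous.comp (continuous_cop_mul a))
  continuous_invFun := isQuotientMap_umk.continuous_iff.2
    (isQuotientMap_umk.continuous.comp (continuous_cop_mul a⁻¹))

theorem hasDer_lmul (H : Good n) {a : Grp n} {A : SL(2, ℝ)} (hA : ∀ z, a.1 z = matAct A z) :
    HasDer (lmul H a) A := by
  intro U φ h w hw
  obtain ⟨c, hc⟩ := h ⟨a * w.1, w.2⟩ hw
  refine ⟨c, ?_⟩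
  filter_upwards [(continuous_cop_mul a).continuousAt.eventually hc] with w' h1
  change φ (umk ⟨a * w'.1, w'.2⟩) = _
  rw [h1, matAct_one, ← hA]
  rfl

theorem matAct_matR (H : Good n) (z : ℂ) : matAct (matR n) z = uvec n 2 * z := by
  apply Complex.ext
  · simp [matAct, matR, Complex.mul_re, ← H.two_gam]
    ring
  · simp [matAct, matR, Complex.mul_im, ← H.two_gam]
    ring

theorem mem_affineGroup_of_grp (H : Good n) {a : Grp n} {A : SL(2, ℝ)}
    (hA : ∀ z, a.1 z = matAct A z) : A ∈ (quadSurface (tableV n)).affineGroup := by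
  refine ⟨lmulHomeo H a, isAffine_of_hasDer (hasDer_lmul H hA) (hasDer_lmul H (a := a⁻¹) fun z => ?_)⟩
  apply a.1.injective
  have : a.1 ((a⁻¹ : Grp n).1 z) = z := apply_inv_apply _ _
  rw [this, hA, ← matAct_mul, mul_inv_cancel, matAct_one]

theorem matR_mem (H : Good n) : matR n ∈ (quadSurface (tableV n)).affineGroup := by
  obtain ⟨a, ha⟩ := exists_rot H 1
  refine mem_affineGroup_of_grp H (a := a) fun z => ?_
  rw [ha, matAct_matR H]
  norm_num

/-- Membership of -1 lets elements of `PSL2R` be lifted with either sign in the proof of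
discreteness. -/
theorem neg_one_mem (H : Good n) : (-1 : SL(2, ℝ)) ∈ (quadSurface (tableV n)).affineGroup := by
  obtain ⟨a, ha⟩ := exists_rot H n
  refine mem_affineGroup_of_grp H (a := a) fun z => ?_
  have h := uvec_add_two_n H 0
  rw [zero_add, uvec_zero] at h
  rw [ha, Int.cast_natCast, h]
  apply Complex.ext <;> simp [matAct]

/-! ### Short closed geodesics -/

/-- The projection of the unfolding to the table. -/
def proj (H : Good n) : Unf n → ℂ :=
  Quot.lift (fun d => (d.2 : ℂ)) fun d d' h => by
    cases h with
    | side g s p hp => rfl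
    | translate g g' t h p p' hp =>
      obtain ⟨rfl, rfl⟩ := translate_trivial H h
      rw [add_zero] at hp
      exact g.1.injective hp

theorem continuous_proj (H : Good n) : Continuous (proj H) :=
  isQuotientMap_umk.continuous_iff.2 continuous_cop_snd

theorem proj_mem (H : Good n) (x : Unf n) : proj H x ∈ quadRegion (tableV n) := by
  induction x using Quot.ind with
  | mk d => exact d.2.2

theorem FlatOn.continuousOn {W Z : Type*} [TopologicalSpace W] [TopologicalSpace Z] {q : W → Z}
    (hq : IsQuotientMap q) {A : SL(2, ℝ)} {dev : W → ℂ} (hdev : Continuous dev) {U : Set Z}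
    {φ : Z → ℂ} (hU : IsOpen U) (hφ : FlatOn A dev q U φ) : ContinuousOn φ U := by
  rw [continuousOn_open_iff hU]
  intro O hO
  rw [← hq.isOpen_preimage, isOpen_iff_mem_nhds]
  rintro w ⟨h1, h2⟩
  obtain ⟨c, hc⟩ := hφ w h1
  have hO' : O ∈ 𝓝 (matAct A (dev w) + c) := by
    rw [← hc.self_of_nhds]
    exact hO.mem_nhds h2
  have hcont : Continuous fun w => matAct A (dev w) + c :=
    ((continuous_matAct A).comp hdev).add continuous_const
  filter_upwards [hc, hq.continuous.continuousAt.eventually (hU.mem_nhds h1),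
    hcont.continuousAt.eventually hO'] with w' a1 a2 a3
  refine ⟨a2, ?_⟩
  change φ (q w') ∈ O
  rw [a1]
  exact a3

/-- A flat function on the part of the unfolding over a neighbourhood of a point of the table, which
measures the distance from that point. -/
theorem exists_star (H : Good n) (q : ℂ) : ∃ ρ > 0, ∃ φ : Unf n → ℂ,
    FlatOn 1 (udev n) umk {x | ‖proj H x - q‖ < ρ} φ ∧
    ∀ x, ‖proj H x - q‖ < ρ → ‖φ x‖ = ‖proj H x - q‖ := by
  classical
  have hseg : ∀ s : Fin 4, ∃ ρ > 0, ∀ p ∈ segment ℝ (tableV n s) (tableV n (s + 1)), ‖p - q‖ < ρ →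
      q ∈ segment ℝ (tableV n s) (tableV n (s + 1)) := by
    intro s
    by_cases hq : q ∈ segment ℝ (tableV n s) (tableV n (s + 1))
    · exact ⟨1, one_pos, fun _ _ _ => hq⟩
    · have hcl : IsClosed (segment ℝ (tableV n s) (tableV n (s + 1))) := by
        rw [segment_eq_image_lineMap]
        exact (isCompact_Icc.image AffineMap.lineMap_continuous).isClosed
      obtain ⟨ρ, hρ, hball⟩ := Metric.isOpen_iff.1 hcl.isOpen_compl q hq
      refine ⟨ρ, hρ, fun p hp hlt => absurd hp (hball ?_)⟩
      rwa [Metric.mem_ball, dist_eq_norm]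
  choose ρ hρ hside using hseg
  set r := min (min (ρ 0) (ρ 1)) (min (ρ 2) (ρ 3)) with hr
  have hrle : ∀ s, r ≤ ρ s := by
    intro s
    fin_cases s
    · exact (min_le_left _ _).trans (min_le_left _ _)
    · exact (min_le_left _ _).trans (min_le_right _ _)
    · exact (min_le_right _ _).trans (min_le_left _ _)
    · exact (min_le_right _ _).trans (min_le_right _ _)
  have hrpos : 0 < r := lt_min (lt_min (hρ 0) (hρ 1)) (lt_min (hρ 2) (hρ 3))
  -- If `q` lies on the line of a side, then `p - q` is a multiple of the direction of that side for
  -- `p` on it, so the side reflection fixes it.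
  have hfix : ∀ (s : Fin 4) (p : ℂ), p ∈ segment ℝ (tableV n s) (tableV n (s + 1)) →
      q ∈ segment ℝ (tableV n s) (tableV n (s + 1)) →
      (sideGen (tableV n) s : Grp n).1 (p - q) = p - q := by
    intro s p hp hq
    change (Submodule.span ℝ {tableV n (s + 1) - tableV n s}).reflection (p - q) = p - q
    rw [Submodule.reflection_eq_self_iff, Submodule.mem_span_singleton]
    rw [segment_eq_image'] at hp hq
    obtain ⟨a, -, rfl⟩ := hp
    obtain ⟨b, -, rfl⟩ := hq
    refine ⟨a - b, ?_⟩
    simp only [Complex.real_smul]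
    push_cast
    ring
  -- On the copy `g P` the function is the displacement from `g q`. It respects the gluing because
  -- the radius excludes the sides that do not contain `q`. It is single valued even around a cone
  -- point over `q`, though not injective there.
  let φ0 : Cop n → ℂ := fun d => if ‖(d.2 : ℂ) - q‖ < r then d.1.1 ((d.2 : ℂ) - q) else 0
  have hφ0 : ∀ d d', Glue (quadRegion (tableV n)) (tableV n) d d' → φ0 d = φ0 d' := by
    intro d d' h
    cases h with
    | side g s p hp =>
      simp only [φ0]
      split_ifs with hlt
      · change _ = g.1 ((sideGen (tableV n) s : Grp n).1 _)
        rw [hfix s p hp (hside s p hp (lt_of_lt_of_le hlt (hrle s)))]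
      · rfl
    | translate g g' t h p p' hp =>
      obtain ⟨rfl, rfl⟩ := translate_trivial H h
      rw [add_zero] at hp
      rw [Subtype.ext (g.1.injective hp)]
  refine ⟨r, hrpos, Quot.lift φ0 hφ0, ?_, ?_⟩
  · intro d hd
    refine ⟨- d.1.1 q, ?_⟩
    obtain ⟨g, p⟩ := d
    have ho : ∀ᶠ d' : Cop n in 𝓝 ⟨g, p⟩, ‖(d'.2 : ℂ) - q‖ < r :=
      ((continuous_cop_snd.sub continuous_const).norm.continuousAt).eventually
        (isOpen_Iio.mem_nhds hd)
    have hg : ∀ᶠ d' : Cop n in 𝓝 ⟨g, p⟩, d'.1 = g := by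
      have := @isOpen_range_sigmaMk (Grp n) (fun _ => quadRegion (tableV n)) _ g
      filter_upwards [this.mem_nhds ⟨p, rfl⟩] with d' hd'
      obtain ⟨p', rfl⟩ := hd'
      rfl
    filter_upwards [ho, hg] with d' h1 h2
    change φ0 d' = _
    simp only [φ0, if_pos h1]
    rw [matAct_one, map_sub, h2]
    change _ = d'.1.1 (d'.2 : ℂ) + - g.1 q
    rw [h2]
    ring
  · intro x
    induction x using Quot.ind with
    | mk d =>
      intro hd
      change ‖φ0 d‖ = ‖(d.2 : ℂ) - q‖
      change ‖(d.2 : ℂ) - q‖ < r at hd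
      simp only [φ0, if_pos hd]
      exact d.1.1.norm_map _

/-- The path `c` is, near the parameter `t`, a straight line with velocity `v`. -/
def LineAt (c : ℝ → Unf n) (v : ℂ) (t : ℝ) : Prop :=
  ∃ (U : Set (Unf n)) (ψ : Unf n → ℂ), IsOpen U ∧ FlatOn 1 (udev n) umk U ψ ∧ c t ∈ U ∧
    ∀ᶠ s in 𝓝 t, ψ (c s) = ψ (c t) + ((s - t : ℝ) : ℂ) * v

/-- Only interior parameters need local constancy, and continuity takes care of the ends. The
geodesics used later are known to be straight only inside the polygons. -/
theorem eq_of_locally_const {f : ℝ → ℂ} {a b : ℝ} (hab : a ≤ b) (hc : ContinuousOn f (Set.Icc a b))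
    (h : ∀ t ∈ Set.Ioo a b, ∀ᶠ s in 𝓝 t, f s = f t) : f b = f a := by
  rcases hab.eq_or_lt with rfl | hlt
  · rfl
  have key : ∀ a' ∈ Set.Ioo a b, f a' = f b := by
    intro a' ha'
    refine (constant_of_has_deriv_right_zero (hc.mono (Set.Icc_subset_Icc_left ha'.1.le)) ?_ b
      (Set.right_mem_Icc.2 ha'.2.le)).symm
    intro x hx
    exact ((hasDerivAt_const x (f x)).congr_of_eventuallyEq
      (h x ⟨ha'.1.trans_le hx.1, hx.2⟩)).hasDerivWithinAt
  have h1 : Tendsto f (𝓝[Set.Ioo a b] a) (𝓝 (f a)) :=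
    (hc a (Set.left_mem_Icc.2 hab)).mono_left (nhdsWithin_mono _ Set.Ioo_subset_Icc_self)
  have h2 : Tendsto f (𝓝[Set.Ioo a b] a) (𝓝 (f b)) :=
    tendsto_const_nhds.congr' (eventually_nhdsWithin_of_forall fun x hx => (key x hx).symm)
  have : (𝓝[Set.Ioo a b] a).NeBot := left_nhdsWithin_Ioo_neBot hlt
  exact tendsto_nhds_unique h2 h1

/-- A short straight line stays in the neighbourhood of a point. -/
theorem line_in_star (H : Good n) {q : ℂ} {ρ : ℝ} {φ : Unf n → ℂ}
    (hflat : FlatOn 1 (udev n) umk {x | ‖proj H x - q‖ < ρ} φ)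
    (hnorm : ∀ x, ‖proj H x - q‖ < ρ → ‖φ x‖ = ‖proj H x - q‖) {c : ℝ → Unf n} (hc : Continuous c)
    {a b : ℝ} (hab : a ≤ b) {v : ℂ} (hline : ∀ t ∈ Set.Ioo a b, LineAt c v t)
    (hM : ‖proj H (c a) - q‖ + (b - a) * ‖v‖ < ρ) :
    ‖proj H (c b) - q‖ ≤ ‖proj H (c a) - q‖ + (b - a) * ‖v‖ ∧
      φ (c b) = φ (c a) + ((b - a : ℝ) : ℂ) * v := by
  set M := ‖proj H (c a) - q‖ + (b - a) * ‖v‖ with hMdef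
  have hpc : Continuous fun t => ‖proj H (c t) - q‖ :=
    (((continuous_proj H).comp hc).sub continuous_const).norm
  have hUo : IsOpen {x | ‖proj H x - q‖ < ρ} :=
    isOpen_lt ((continuous_proj H).sub continuous_const).norm continuous_const
  have hφc : ContinuousOn φ {x | ‖proj H x - q‖ < ρ} :=
    hflat.continuousOn isQuotientMap_umk continuous_udev hUo
  have hv := norm_nonneg v
  have h0 : ‖proj H (c a) - q‖ ≤ M := by
    have := mul_nonneg (sub_nonneg.2 hab) hv
    linarith
  -- Continuous induction: the distance bound keeps the path in the star, and the formula for `φ`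
  -- along the path in turn renews the distance bound.
  let S : Set ℝ := {t | ‖proj H (c t) - q‖ ≤ M ∧ φ (c t) = φ (c a) + ((t - a : ℝ) : ℂ) * v}
  have hS : Set.Icc a b ⊆ S := by
    apply IsClosed.Icc_subset_of_forall_mem_nhdsWithin
    · have hK : IsClosed {t | ‖proj H (c t) - q‖ ≤ M} := isClosed_le hpc continuous_const
      have hcont : ContinuousOn (fun t => φ (c t) - (φ (c a) + ((t - a : ℝ) : ℂ) * v))
          {t | ‖proj H (c t) - q‖ ≤ M} := by
        refine ContinuousOn.sub (hφc.comp hc.continuousOn fun t ht => lt_of_le_of_lt ht hM) ?_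
        fun_prop
      have := hcont.preimage_isClosed_of_isClosed hK (isClosed_singleton (x := (0 : ℂ)))
      refine IsClosed.inter ?_ isClosed_Icc
      convert this using 1
      ext t
      simp only [S, Set.mem_ofPred_eq, Set.mem_inter_iff, Set.mem_preimage, Set.mem_singleton_iff,
        sub_eq_zero]
    · refine ⟨h0, ?_⟩
      simp
    · rintro x ⟨⟨hx1, hx2⟩, hxa, hxb⟩
      have hlt := lt_of_le_of_lt hx1 hM
      have hev : ∀ᶠ s in 𝓝 x, ‖proj H (c s) - q‖ < ρ := hpc.continuousAt.eventually
        (isOpen_Iio.mem_nhds hlt)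
      obtain ⟨η, hη, hball⟩ := Metric.eventually_nhds_iff.1 hev
      have hIoo : Set.Ioo x (min b (x + η)) ∈ 𝓝[>] x := Ioo_mem_nhdsGT (lt_min hxb (by linarith))
      filter_upwards [hIoo] with s hs
      have hsb : s < b := hs.2.trans_le (min_le_left _ _)
      have hsη : s < x + η := hs.2.trans_le (min_le_right _ _)
      have hin : ∀ t ∈ Set.Icc x s, ‖proj H (c t) - q‖ < ρ := by
        intro t ht
        apply hball
        rw [Real.dist_eq, abs_lt]
        constructor <;> linarith [ht.1, ht.2]
      have key := eq_of_locally_const (f := fun t => φ (c t) - (t : ℂ) * v) hs.1.le (by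
        refine ContinuousOn.sub (hφc.comp hc.continuousOn fun t ht => hin t ht) ?_
        fun_prop) (by
        intro t ht
        obtain ⟨U, ψ, hU, hψ, htU, hψc⟩ := hline t ⟨hxa.trans_lt ht.1, ht.2.trans hsb⟩
        obtain ⟨k, hk⟩ := hflat.locally_const isQuotientMap_umk hUo hU hψ
          (hin t ⟨ht.1.le, ht.2.le⟩) htU
        have hk0 := hk.self_of_nhds
        filter_upwards [hψc, hc.continuousAt.eventually hk] with s' e1 e2
        rw [e2, e1, hk0]
        push_cast
        ring)
      have hφs : φ (c s) = φ (c a) + ((s - a : ℝ) : ℂ) * v := by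
        have key' : φ (c s) - (s : ℂ) * v = φ (c x) - (x : ℂ) * v := key
        rw [hx2] at key'
        push_cast at key' ⊢
        linear_combination key'
      refine ⟨?_, hφs⟩
      have hs' := hin s ⟨hs.1.le, le_rfl⟩
      rw [← hnorm _ hs', hφs, hMdef, ← hnorm _ (lt_of_le_of_lt h0 hM)]
      refine (norm_add_le _ _).trans ?_
      rw [norm_mul, Complex.norm_real, Real.norm_of_nonneg (by linarith [hs.1])]
      have := mul_le_mul_of_nonneg_right (by linarith : s - a ≤ b - a) hv
      linarith
  exact hS (Set.right_mem_Icc.2 hab)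

theorem isCompact_quadRegion (V : Fin 4 → ℂ) : IsCompact (quadRegion V) :=
  (Set.Finite.isCompact_convexHull ℝ (Set.toFinite _)).union
    (Set.Finite.isCompact_convexHull ℝ (Set.toFinite _))

/-- There are no short closed geodesics made of two straight lines with the same velocity. -/
theorem exists_systole (H : Good n) : ∃ δ > 0, ∀ (c c' : ℝ → Unf n) (a b a' b' : ℝ) (v : ℂ),
    Continuous c → Continuous c' → a ≤ b → a' ≤ b' → (∀ t ∈ Set.Ioo a b, LineAt c v t) →
    (∀ t ∈ Set.Ioo a' b', LineAt c' v t) → c b = c' a' → c' b' = c a →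
    ((b - a) + (b' - a')) * ‖v‖ < δ → (((b - a) + (b' - a') : ℝ) : ℂ) * v = 0 := by
  -- By compactness finitely many half-radius stars cover the table. Half of the smallest radius is
  -- then an admissible length: a path that short stays in the star of its starting point.
  choose ρ hρ φ hflat hnorm using exists_star H
  obtain ⟨t, ht, hcov⟩ := (isCompact_quadRegion (tableV n)).elim_nhds_subcover
    (fun q => Metric.ball q (ρ q / 2)) (fun q _ => Metric.ball_mem_nhds q (half_pos (hρ q)))
  have hne : t.Nonempty := by
    obtain ⟨q, hq, -⟩ := Set.mem_iUnion₂.1 (hcov (vertex_mem_quadRegion _ 0))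
    exact ⟨q, hq⟩
  obtain ⟨q0, hq0, hmin⟩ := t.exists_min_image ρ hne
  refine ⟨ρ q0 / 2, half_pos (hρ q0), ?_⟩
  intro c c' a b a' b' v hc hc' hab hab' hl hl' h1 h2 hlt
  obtain ⟨q, hq, hball⟩ := Set.mem_iUnion₂.1 (hcov (proj_mem H (c a)))
  rw [Metric.mem_ball, dist_eq_norm] at hball
  have hle := hmin q hq
  have hv := norm_nonneg v
  have k1 := mul_nonneg (sub_nonneg.2 hab) hv
  have k2 := mul_nonneg (sub_nonneg.2 hab') hv
  -- Both arcs are followed in the same star. Its single-valued function grows by the total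
  -- displacement and returns to its initial value, so the displacement vanishes.
  obtain ⟨e1, e2⟩ := line_in_star H (hflat q) (hnorm q) hc hab hl (by linarith)
  rw [h1] at e1 e2
  obtain ⟨e3, e4⟩ := line_in_star H (hflat q) (hnorm q) hc' hab' hl' (by linarith)
  rw [h2, e2] at e4
  push_cast at e4 ⊢
  linear_combination -e4

/-! ### Charts at the interior points of the polygons -/

theorem ip_lt_of_interior {a : ℕ} {z : ℂ} (hz : z ∈ interior (poly n a)) {j : ℤ} (hj : j % 2 = 1) :
    ip n j z < apo n a j := by
  rw [mem_interior_iff_mem_nhds, Metric.mem_nhds_iff] at hz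
  obtain ⟨r, hr, hball⟩ := hz
  have h1 : z + ((r / 2 : ℝ) : ℂ) * uvec n j ∈ poly n a := by
    apply hball
    rw [Metric.mem_ball, dist_eq_norm, add_sub_cancel_left, norm_mul, norm_uvec, mul_one,
      Complex.norm_real, Real.norm_of_nonneg (by linarith)]
    linarith
  have h2 := poly_le h1 hj
  rw [ip_add, ip_mul, ip_uvec, sub_self, zero_mul, Real.cos_zero, mul_one] at h2
  linarith

/-- Glued points lie on the boundaries of the polygons, so the plane coordinate on an open polygon
descends to the surface. -/
theorem EdgeRel.not_interior_left {p q : Pts n} (h : EdgeRel n p q) :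
    p.1.2 ∉ interior (poly n p.1.1) := by
  obtain ⟨j, h1, h2, h3, h4⟩ := h
  intro hp
  have := ip_lt_of_interior hp (by omega : j % 2 = 1)
  linarith

theorem EdgeRel.not_interior_right (H : Good n) {p q : Pts n} (h : EdgeRel n p q) :
    q.1.2 ∉ interior (poly n q.1.1) := by
  obtain ⟨m, hm⟩ := H.odd
  obtain ⟨j, h1, h2, h3, h4⟩ := h
  intro hq
  have := ip_lt_of_interior hq (by omega : (2 * n + j) % 2 = 1)
  rw [ip_opp H, h4, ip_sub, ip_mul, ip_uvec, sub_self, zero_mul, Real.cos_zero, mul_one, h3, h2,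
    centerDist, apo_congr (by omega : j % 4 = 3 % 4),
    apo_congr (by omega : (2 * n + j) % 4 = 1 % 4)] at this
  linarith

open Classical in
/-- The coordinate on the interior of a polygon. -/
def intFun (H : Good n) (a : ℕ) : PolySurf n → Option ℂ :=
  Quot.lift (fun p => if p.1.1 = a ∧ p.1.2 ∈ interior (poly n a) then some p.1.2 else none) (by
    intro p q h
    rw [if_neg, if_neg]
    · rintro ⟨h1, h2⟩
      rw [← h1] at h2
      exact h.not_interior_right H h2
    · rintro ⟨h1, h2⟩
      rw [← h1] at h2
      exact h.not_interior_left h2)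

theorem intFun_pmk (H : Good n) {a : ℕ} {p : Pts n} (h1 : p.1.1 = a)
    (h2 : p.1.2 ∈ interior (poly n a)) : intFun H a (pmk p) = some p.1.2 := if_pos ⟨h1, h2⟩

theorem intFun_isSome (H : Good n) {a : ℕ} {p : Pts n} (h : (intFun H a (pmk p)).isSome) :
    p.1.1 = a ∧ p.1.2 ∈ interior (poly n a) := by
  by_contra hn
  have : intFun H a (pmk p) = none := if_neg hn
  rw [this] at h
  simp at h

theorem isOpen_intSource (H : Good n) (a : ℕ) : IsOpen {y | (intFun H a y).isSome} := by
  rw [← isQuotientMap_pmk.isOpen_preimage]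
  have : pmk (n := n) ⁻¹' {y | (intFun H a y).isSome} =
      {p | p.1.1 = a} ∩ {p | p.1.2 ∈ interior (poly n a)} := by
    ext p
    refine ⟨fun h => intFun_isSome H h, fun h => ?_⟩
    change (intFun H a (pmk p)).isSome
    rw [intFun_pmk H h.1 h.2]
    rfl
  rw [this]
  refine IsOpen.inter ?_ (isOpen_interior.preimage continuous_pdev)
  exact (isOpen_discrete {a}).preimage (continuous_fst.comp continuous_subtype_val)

theorem flatOn_intFun (H : Good n) (a : ℕ) :
    FlatOn 1 pdev pmk {y | (intFun H a y).isSome} fun y => (intFun H a y).getD 0 := by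
  intro p hp
  refine ⟨0, ?_⟩
  filter_upwards [((isOpen_intSource H a).preimage isQuotientMap_pmk.continuous).mem_nhds hp]
    with p' hp'
  obtain ⟨h1, h2⟩ := intFun_isSome H hp'
  rw [intFun_pmk H h1 h2, matAct_one, add_zero]
  rfl

theorem zero_mem_poly (H : Good n) : (0 : ℂ) ∈ poly n 2 := by
  intro k
  rw [apo_two H]
  simp only [ip, Complex.zero_re, Complex.zero_im, zero_mul, add_zero]
  exact H.cos_one_pos.le

open Classical in
/-- The chart on the interior of a polygon. -/
def intChart (H : Good n) (a : ℕ) (ha : a < 5) : OpenPartialHomeomorph (PolySurf n) ℂ where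
  toFun y := (intFun H a y).getD 0
  invFun z := if h : z ∈ poly n a then pmk ⟨(a, z), ha, h⟩ else pmk ⟨(2, 0), by norm_num, zero_mem_poly H⟩
  source := {y | (intFun H a y).isSome}
  target := interior (poly n a)
  map_source' y hy := by
    induction y using Quot.ind with
    | mk p =>
      obtain ⟨h1, h2⟩ := intFun_isSome H hy
      change (intFun H a (pmk p)).getD 0 ∈ _
      rw [intFun_pmk H h1 h2]
      exact h2
  map_target' z hz := by
    rw [dif_pos (interior_subset hz)]
    change (intFun H a (pmk _)).isSome
    rw [intFun_pmk H (p := ⟨(a, z), ha, interior_subset hz⟩) rfl hz]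
    rfl
  left_inv' y hy := by
    induction y using Quot.ind with
    | mk p =>
      obtain ⟨h1, h2⟩ := intFun_isSome H hy
      have e : (intFun H a (pmk p)).getD 0 = p.1.2 := by
        rw [intFun_pmk H h1 h2]
        rfl
      change (if h : (intFun H a (pmk p)).getD 0 ∈ poly n a then pmk ⟨(a, _), ha, h⟩ else _) = pmk p
      rw [dif_pos (by rw [e]; exact interior_subset h2)]
      congr 1
      exact Subtype.ext (Prod.ext h1.symm e)
  right_inv' z hz := by
    rw [dif_pos (interior_subset hz)]
    rw [intFun_pmk H (p := ⟨(a, z), ha, interior_subset hz⟩) rfl hz]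
    rfl
  open_source := isOpen_intSource H a
  open_target := isOpen_interior
  continuousOn_toFun := (flatOn_intFun H a).continuousOn isQuotientMap_pmk continuous_pdev
    (isOpen_intSource H a)
  continuousOn_invFun := by
    rw [continuousOn_iff_continuous_domRestrict]
    have : Continuous fun z : interior (poly n a) =>
        pmk (n := n) ⟨(a, z.1), ha, interior_subset z.2⟩ := by
      refine isQuotientMap_pmk.continuous.comp (Continuous.subtype_mk ?_ _)
      exact continuous_const.prodMk continuous_subtype_val
    convert this using 1
    ext1 z
    simp only [Set.domRestrict_apply]
    rw [dif_pos (interior_subset z.2)]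

/-- The chart of the unfolding given by the interior of a polygon. -/
def unfChart (H : Good n) (a : ℕ) (ha : a < 5) : OpenPartialHomeomorph (Unf n) ℂ :=
  (phiHomeo H).toOpenPartialHomeomorph.trans (intChart H a ha)

theorem unfChart_mem (H : Good n) (a : ℕ) (ha : a < 5) :
    unfChart H a ha ∈ (quadSurface (tableV n)).charts := by
  rw [mem_charts_iff]
  have h := (affLift_phi H).flatOn (flatOn_intFun H a)
  rw [mul_one] at h
  intro w hw
  have hw' : (intFun H a (phi H (umk w))).isSome := by
    have : umk w ∈ (phiHomeo H) ⁻¹' (intChart H a ha).source := by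
      simpa [unfChart] using hw
    exact this
  exact h w hw'

theorem unfChart_kappa (H : Good n) {a : ℕ} (ha : a < 5) {p : Pts n} (h1 : p.1.1 = a)
    (h2 : p.1.2 ∈ interior (poly n a)) : kappa H (pmk p) ∈ (unfChart H a ha).source ∧
      unfChart H a ha (kappa H (pmk p)) = p.1.2 := by
  have e := intFun_pmk H h1 h2
  constructor
  · have : kappa H (pmk p) ∈ (phiHomeo H) ⁻¹' (intChart H a ha).source := by
      change (intFun H a (phi H (kappa H (pmk p)))).isSome
      rw [phi_kappa, e]
      rfl
    simpa [unfChart] using this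
  · change (intFun H a (phi H (kappa H (pmk p)))).getD 0 = _
    rw [phi_kappa, e]
    rfl

/-! ### A closed geodesic -/

/-- The horizontal line through the middle of the side `j` of the polygon `a`. -/
def midPath (H : Good n) {a : ℕ} (ha : a < 5) {j : ℤ} (hj : j % 2 = 1) (h1 : -n < j) (h2 : j < n)
    (x : ℝ) : Pts n :=
  -- The abscissa is clamped to the width of the polygon, so that the path is defined and continuous
  -- on the whole line.
  ⟨(a, ⟨max (-(hw n a j (apo n a j * Real.sin (j * gam n))))
      (min x (hw n a j (apo n a j * Real.sin (j * gam n)))), apo n a j * Real.sin (j * gam n)⟩), ha, by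
    have hy : Level n a j (apo n a j * Real.sin (j * gam n)) := by
      unfold Level
      rw [sub_self, abs_zero]
      exact mul_nonneg (hl_nonneg H ha j) (H.cos_right h1 h2).le
    refine mem_poly_of_hw H ha hj h1 h2 hy ?_
    have := hw_nonneg H ha hj h1 h2 hy
    rw [abs_le]
    exact ⟨le_max_left _ _, max_le (by linarith) (min_le_right _ _)⟩⟩

theorem continuous_midPath (H : Good n) {a : ℕ} (ha : a < 5) {j : ℤ} (hj : j % 2 = 1) (h1 : -n < j)
    (h2 : j < n) : Continuous (midPath H ha hj h1 h2) := by
  refine Continuous.subtype_mk (continuous_const.prodMk ?_) _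
  have : Continuous fun x : ℝ => Complex.equivRealProdCLM.symm
      (max (-(hw n a j (apo n a j * Real.sin (j * gam n))))
      (min x (hw n a j (apo n a j * Real.sin (j * gam n)))), apo n a j * Real.sin (j * gam n)) := by
    refine Complex.equivRealProdCLM.symm.continuous.comp ?_
    fun_prop
  exact this

theorem midPath_eq (H : Good n) {a : ℕ} (ha : a < 5) {j : ℤ} (hj : j % 2 = 1) (h1 : -n < j)
    (h2 : j < n) {x : ℝ} (hx : |x| ≤ hw n a j (apo n a j * Real.sin (j * gam n))) :
    (midPath H ha hj h1 h2 x).1.2 = ⟨x, apo n a j * Real.sin (j * gam n)⟩ := by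
  rw [abs_le] at hx
  change (⟨max _ (min x _), _⟩ : ℂ) = _
  rw [min_eq_left hx.2, max_eq_right hx.1]

theorem midPath_interior (H : Good n) {a : ℕ} (ha : a < 5) {j : ℤ} (hj : j % 2 = 1) (h1 : -n < j)
    (h2 : j < n) (hl0 : 0 < hl n a j) {x : ℝ}
    (hx : |x| < hw n a j (apo n a j * Real.sin (j * gam n))) :
    (midPath H ha hj h1 h2 x).1.2 ∈ interior (poly n a) := by
  have hc := H.cos_right h1 h2
  rw [midPath_eq H ha hj h1 h2 hx.le]
  have ho : IsOpen {z : ℂ | |z.im - apo n a j * Real.sin (j * gam n)| < hl n a j * Real.cos (j * gam n) ∧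
      |z.re| < hw n a j z.im} := by
    refine IsOpen.and ?_ ?_
    · exact isOpen_lt (by fun_prop) continuous_const
    · refine isOpen_lt (by fun_prop) ?_
      unfold hw
      fun_prop
  refine interior_maximal ?_ ho ⟨?_, hx⟩
  · rintro z ⟨hz1, hz2⟩
    exact mem_poly_of_hw H ha hj h1 h2 hz1.le hz2.le
  · change |apo n a j * Real.sin (j * gam n) - apo n a j * Real.sin (j * gam n)| < _
    rw [sub_self, abs_zero]
    positivity

theorem matAct_real (A : SL(2, ℝ)) (x : ℝ) : matAct A x = x * matAct A 1 := by
  apply Complex.ext <;> simp [matAct] <;> ring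

/-- An affine homeomorphism maps the interior of a horizontal line to a straight line. -/
theorem lineAt_midPath (H : Good n) {f : Unf n ≃ₜ Unf n} {A : SL(2, ℝ)}
    (hf : (quadSurface (tableV n)).IsAffine f A) {a : ℕ} (ha : a < 5) {j : ℤ} (hj : j % 2 = 1)
    (h1 : -n < j) (h2 : j < n) (hl0 : 0 < hl n a j) {t : ℝ}
    (ht : |t| < hw n a j (apo n a j * Real.sin (j * gam n))) :
    LineAt (fun x => f (kappa H (pmk (midPath H ha hj h1 h2 x)))) (matAct A 1) t := by
  have hinner := midPath_interior H ha hj h1 h2 hl0 ht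
  obtain ⟨hs, -⟩ := unfChart_kappa H ha (p := midPath H ha hj h1 h2 t) rfl hinner
  obtain ⟨e', he', hs'⟩ := (hf.1 _).2 ⟨_, unfChart_mem H a ha, hs⟩
  obtain ⟨b, hb⟩ := hf.2 _ (unfChart_mem H a ha) e' he' _ hs hs'
  have hc : Continuous fun x => kappa H (pmk (midPath H ha hj h1 h2 x)) :=
    (phiHomeo H).symm.continuous.comp
      (isQuotientMap_pmk.continuous.comp (continuous_midPath H ha hj h1 h2))
  have hval : ∀ s : ℝ, |s| < hw n a j (apo n a j * Real.sin (j * gam n)) →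
      unfChart H a ha (kappa H (pmk (midPath H ha hj h1 h2 s))) =
        ⟨s, apo n a j * Real.sin (j * gam n)⟩ := by
    intro s hs
    rw [(unfChart_kappa H ha (p := midPath H ha hj h1 h2 s) rfl
      (midPath_interior H ha hj h1 h2 hl0 hs)).2, midPath_eq H ha hj h1 h2 hs.le]
  refine ⟨e'.source, e', e'.open_source, mem_charts_iff.1 he', hs', ?_⟩
  have hnear : ∀ᶠ s : ℝ in 𝓝 t, |s| < hw n a j (apo n a j * Real.sin (j * gam n)) :=
    (isOpen_lt continuous_abs continuous_const).mem_nhds ht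
  have hb0 := hb.self_of_nhds
  filter_upwards [hnear, hc.continuousAt.eventually hb] with s h3 h4
  rw [h4, hb0, hval s h3, hval t ht, ← matAct_real]
  have : (⟨s, apo n a j * Real.sin (j * gam n)⟩ : ℂ) =
      ⟨t, apo n a j * Real.sin (j * gam n)⟩ + ((s - t : ℝ) : ℂ) := by
    apply Complex.ext <;> simp
  rw [this, matAct_add]
  ring

/-- The derivatives of affine homeomorphisms do not contract the horizontal direction too much. -/
theorem exists_lower_bound (H : Good n) :
    ∃ ε > 0, ∀ A ∈ (quadSurface (tableV n)).affineGroup, ε ≤ ‖matAct A 1‖ := by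
  obtain ⟨δ, hδ, hsys⟩ := exists_systole H
  have h7 := H.seven_le
  -- The cylinder whose core curve, one horizontal segment in the polygon 0 followed by one in the
  -- polygon 1, serves as the test geodesic.
  have hc : Cyl n 0 3 := ⟨by norm_num, by norm_num, by omega, by omega⟩
  have hcw := hc.cwid_pos H
  have hcos := hc.cos_pos H
  have hl0 := hc.hl_pos H
  have hl1 : 0 < hl n 1 (-3) := by rw [hc.hl_neg]; exact hl0
  have g1 : -(n : ℤ) < 3 := hc.gt
  have g2 : (3 : ℤ) < n := hc.lt
  have g1' : -(n : ℤ) < -3 := by omega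
  have g2' : (-3 : ℤ) < n := by omega
  have hlev : Level n 0 3 (apo n 0 3 * Real.sin ((3 : ℤ) * gam n)) := by
    unfold Level
    rw [sub_self, abs_zero]
    positivity
  have ey : apo n 1 (-3) * Real.sin ((-3 : ℤ) * gam n) =
      apo n 0 3 * Real.sin ((3 : ℤ) * gam n) - centerDist n 0 * Real.sin ((3 : ℤ) * gam n) := by
    rw [hc.dist_eq]
    push_cast
    rw [neg_mul, Real.sin_neg]
    ring
  have ew : hw n 1 (-3) (apo n 1 (-3) * Real.sin ((-3 : ℤ) * gam n)) =
      centerDist n 0 * Real.cos ((3 : ℤ) * gam n) - hw n 0 3 (apo n 0 3 * Real.sin ((3 : ℤ) * gam n)) := by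
    rw [ey]
    exact hc.hw_neg H _
  have w0 : 0 ≤ hw n 0 3 (apo n 0 3 * Real.sin ((3 : ℤ) * gam n)) :=
    hw_nonneg H (by norm_num) (by norm_num) g1 g2 hlev
  have w1 : 0 ≤ hw n 1 (-3) (apo n 1 (-3) * Real.sin ((-3 : ℤ) * gam n)) := by
    rw [ew]
    exact hc.bwid_nonneg H hlev true
  set w := hw n 0 3 (apo n 0 3 * Real.sin ((3 : ℤ) * gam n)) with hwdef
  set w' := hw n 1 (-3) (apo n 1 (-3) * Real.sin ((-3 : ℤ) * gam n)) with hwdef'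
  have hcw' : cwid n 0 3 = 2 * centerDist n 0 * Real.cos ((3 : ℤ) * gam n) := rfl
  set m0 := midPath H (by norm_num : 0 < 5) (by norm_num : (3 : ℤ) % 2 = 1) g1 g2 with hm0
  set m1 := midPath H (by norm_num : 1 < 5) (by norm_num : (-3 : ℤ) % 2 = 1) g1' g2' with hm1
  have v0 : ∀ x, |x| ≤ w → (m0 x).1.2 = ⟨x, apo n 0 3 * Real.sin ((3 : ℤ) * gam n)⟩ :=
    fun x hx => midPath_eq H _ _ g1 g2 hx
  have v1 : ∀ x, |x| ≤ w' → (m1 x).1.2 = ⟨x, apo n 1 (-3) * Real.sin ((-3 : ℤ) * gam n)⟩ :=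
    fun x hx => midPath_eq H _ _ g1' g2' hx
  have glue1 : pmk (m0 w) = pmk (m1 (-w')) := by
    have x0 : |w| ≤ w := (abs_of_nonneg w0).le
    have x1 : |-w'| ≤ w' := by rw [abs_neg, abs_of_nonneg w1]
    refine posAt_unique H hc (ξ := ⟨w, apo n 0 3 * Real.sin ((3 : ℤ) * gam n)⟩) hlev
      (s := false) (s' := true) (k := 0) (k' := 0) ⟨rfl, ?_, ?_⟩ ⟨rfl, ?_, ?_⟩
    · rw [v0 w x0]
      simp [shiftv]
    · rw [v0 w x0]
      exact x0
    · rw [v1 _ x1, ey, ew]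
      apply Complex.ext
      · simp [shiftv]
      · simp [shiftv]
    · rw [v1 _ x1]
      change |-w'| ≤ centerDist n 0 * _ - _
      rw [← ew]
      exact x1
  have glue2 : pmk (m1 w') = pmk (m0 (-w)) := by
    have x0 : |-w| ≤ w := by rw [abs_neg, abs_of_nonneg w0]
    have x1 : |w'| ≤ w' := (abs_of_nonneg w1).le
    refine posAt_unique H hc (ξ := ⟨-w, apo n 0 3 * Real.sin ((3 : ℤ) * gam n)⟩) hlev
      (s := true) (s' := false) (k := -1) (k' := 0) ⟨rfl, ?_, ?_⟩ ⟨rfl, ?_, ?_⟩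
    · rw [v1 _ x1, ey, ew, hcw']
      apply Complex.ext
      · simp only [shiftv, if_true, Complex.sub_re, Complex.ofReal_re, Complex.re_ofReal_mul, uvec_re]
        push_cast
        ring
      · simp only [shiftv, if_true, Complex.sub_im, Complex.ofReal_im, Complex.im_ofReal_mul, uvec_im]
        ring
    · rw [v1 _ x1]
      change |w'| ≤ centerDist n 0 * _ - _
      rw [← ew]
      exact x1
    · rw [v0 _ x0]
      simp [shiftv]
    · rw [v0 _ x0]
      exact x0
  have hsum : (w - -w) + (w' - -w') = cwid n 0 3 := by
    rw [ew, hcw']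
    ring
  refine ⟨δ / cwid n 0 3, div_pos hδ hcw, ?_⟩
  rintro A ⟨f, hf⟩
  by_contra hlt
  rw [not_le, lt_div_iff₀ hcw] at hlt
  have hcont : ∀ m : ℝ → Pts n, Continuous m → Continuous fun x => f (kappa H (pmk (m x))) :=
    fun m hm => f.continuous.comp ((phiHomeo H).symm.continuous.comp
      (isQuotientMap_pmk.continuous.comp hm))
  have key := hsys (fun x => f (kappa H (pmk (m0 x)))) (fun x => f (kappa H (pmk (m1 x))))
    (-w) w (-w') w' (matAct A 1) (hcont _ (continuous_midPath H _ _ g1 g2))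
    (hcont _ (continuous_midPath H _ _ g1' g2')) (by linarith) (by linarith)
    (fun t ht => lineAt_midPath H hf _ _ g1 g2 hl0 (abs_lt.2 ht))
    (fun t ht => lineAt_midPath H hf _ _ g1' g2' hl1 (abs_lt.2 ht))
    (by simp only [glue1]) (by simp only [glue2]) (by rw [hsum, mul_comm]; exact hlt)
  rw [hsum, mul_eq_zero] at key
  rcases key with h | h
  · exact hcw.ne' (by exact_mod_cast h)
  -- The image curve would be too short, so its holonomy would vanish, which contradicts the
  -- invertibility of `A`.
  · have h1 : matAct A⁻¹ (matAct A 1) = 1 := by rw [← matAct_mul, inv_mul_cancel, matAct_one]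
    rw [h] at h1
    simp [matAct, Complex.ext_iff] at h1

/-! ### Discreteness of the affine group -/

theorem coe_matR_inv : ((matR n)⁻¹).1 =
    !![Real.cos (Real.pi / n), Real.sin (Real.pi / n);
      -Real.sin (Real.pi / n), Real.cos (Real.pi / n)] := by
  rw [Matrix.SpecialLinearGroup.coe_inv, matR, Matrix.adjugate_fin_two_of, neg_neg]

/-- A power of T reduces the first entry of the first column modulo `shear n` times the lower left
entry c. The norm of the column is then at most (`shear n`/2 + 1)|c|, and `exists_lower_bound`
applies. -/
theorem exists_lower_left_bound (H : Good n) :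
    ∃ ε > 0, ∀ A ∈ (quadSurface (tableV n)).affineGroup, A 1 0 = 0 ∨ ε ≤ |A 1 0| := by
  obtain ⟨ε, hε, h⟩ := exists_lower_bound H
  have hτ := shear_pos H
  refine ⟨ε / (shear n / 2 + 1), by positivity, fun A hA => ?_⟩
  by_cases hc : A 1 0 = 0
  · exact Or.inl hc
  right
  set c := A 1 0 with hcdef
  -- Rounding `x` gives the exponent of T that makes the first entry of the column as small as
  -- possible.
  set x : ℝ := A 0 0 / (shear n * c) with hx
  have h1 := h _ (mul_mem (twMat_mem H (-round x)) hA)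
  have h2 : matAct (twMat n (-round x) * A) 1 = ⟨shear n * c * (x - round x), c⟩ := by
    have : shear n * c * x = A 0 0 := by rw [hx]; field_simp
    rw [matAct_mul, matAct_twMat]
    apply Complex.ext
    · simp [matAct, mul_sub, this]
      ring
    · simp [matAct, hcdef]
  rw [h2] at h1
  have h3 := h1.trans (Complex.norm_le_abs_re_add_abs_im _)
  simp only [abs_mul, abs_of_pos hτ] at h3
  have h4 := abs_sub_round x
  have h5 : shear n * |c| * |x - round x| ≤ shear n * |c| * (1 / 2) := by gcongr
  rw [div_le_iff₀ (by positivity)]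
  linarith

/-- Otherwise powers of `A` would contract the horizontal direction below the lower bound. -/
theorem one_le_abs_of_lower_left_eq_zero (H : Good n) {A : SL(2, ℝ)}
    (hA : A ∈ (quadSurface (tableV n)).affineGroup) (h0 : A 1 0 = 0) : 1 ≤ |A 0 0| := by
  obtain ⟨ε, hε, h⟩ := exists_lower_bound H
  by_contra! hlt
  obtain ⟨m, hm⟩ := exists_pow_lt_of_lt_one hε hlt
  have key : ∀ m : ℕ, matAct (A ^ m) 1 = ((A 0 0 ^ m : ℝ) : ℂ) := by
    intro m
    induction m with
    | zero => simp [matAct_one]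
    | succ m ih =>
      rw [pow_succ, matAct_mul, show matAct A 1 = ((A 0 0 : ℝ) : ℂ) by
        apply Complex.ext <;> simp [matAct, h0], matAct_real, ih, pow_succ]
      push_cast
      ring
  have := h _ (pow_mem hA m)
  rw [key, Complex.norm_real, Real.norm_eq_abs, abs_pow] at this
  linarith

/-- The gap makes `A` upper triangular. Applying the previous bound to `A` and `A⁻¹` forces the
diagonal to be 1, and the remaining entry is moved by R to a place where the gap applies again. -/
theorem eq_one_of_near_one (H : Good n) : ∃ ε > 0, ∀ A ∈ (quadSurface (tableV n)).affineGroup,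
    |A 1 0| < ε → |A 0 1| < ε → 0 < A 0 0 → A = 1 := by
  obtain ⟨ε, hε, h⟩ := exists_lower_left_bound H
  refine ⟨ε, hε, fun A hA h1 h2 h3 => ?_⟩
  have hc : A 1 0 = 0 := (h A hA).resolve_right (not_le.2 h1)
  have hdet : A 0 0 * A 1 1 = 1 := by
    have := A.2
    rw [Matrix.det_fin_two] at this
    have h0 : A.1 1 0 = 0 := hc
    rw [h0, mul_zero, sub_zero] at this
    exact this
  have ha := one_le_abs_of_lower_left_eq_zero H hA hc
  have hd := one_le_abs_of_lower_left_eq_zero H (inv_mem hA)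
    (by simp [Matrix.SpecialLinearGroup.SL2_inv_expl, hc])
  have hd' : A⁻¹ 0 0 = A 1 1 := by simp [Matrix.SpecialLinearGroup.SL2_inv_expl]
  have hdpos : 0 < A 1 1 := by
    by_contra! hn
    nlinarith
  rw [hd', abs_of_pos hdpos] at hd
  rw [abs_of_pos h3] at ha
  have ha1 : A 0 0 = 1 := by nlinarith
  have hd1 : A 1 1 = 1 := by rw [ha1, one_mul] at hdet; exact hdet
  have hs : 0 < Real.sin (Real.pi / n) := by
    have := H.sin_two_pos
    rwa [H.two_gam] at this
  -- Conjugation by R turns the horizontal parabolic into one with a lower left entry no larger than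
  -- its translation length.
  have hconj : (matR n * A * (matR n)⁻¹) 1 0 = -(A 0 1 * Real.sin (Real.pi / n) ^ 2) := by
    have e00 : A.1 0 0 = 1 := ha1
    have e11 : A.1 1 1 = 1 := hd1
    have e10 : A.1 1 0 = 0 := hc
    rw [Matrix.SpecialLinearGroup.coe_mul, Matrix.SpecialLinearGroup.coe_mul, coe_matR_inv,
      Matrix.eta_fin_two A.1, e00, e11, e10]
    simp [matR]
    ring
  have hb : A 0 1 = 0 := by
    rcases h _ (mul_mem (mul_mem (matR_mem H) hA) (inv_mem (matR_mem H))) with h4 | h4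
    · rw [hconj, neg_eq_zero, mul_eq_zero] at h4
      exact h4.resolve_right (by positivity)
    · rw [hconj, abs_neg, abs_mul,
        abs_of_nonneg (sq_nonneg (Real.sin (Real.pi / n)))] at h4
      have : Real.sin (Real.pi / n) ^ 2 ≤ 1 := Real.sin_sq_le_one _
      have := mul_le_mul_of_nonneg_left this (abs_nonneg (A 0 1))
      linarith
  ext i j
  fin_cases i <;> fin_cases j
  · exact ha1
  · exact hb
  · exact hc
  · exact hd1

theorem toPSL_eq_one_iff {A : SL(2, ℝ)} : toPSL A = 1 ↔ A = 1 ∨ A = -1 := by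
  have h : toPSL A = 1 ↔ A ∈ Subgroup.center SL(2, ℝ) := QuotientGroup.eq_one_iff A
  rw [h, Matrix.SpecialLinearGroup.mem_center_iff]
  constructor
  · rintro ⟨r, hr, hA⟩
    rw [Fintype.card_fin] at hr
    rcases eq_or_eq_neg_of_sq_eq_sq r 1 (by rw [hr, one_pow]) with rfl | rfl
    · left
      apply Subtype.ext
      rw [← hA]
      simp
    · right
      apply Subtype.ext
      rw [← hA]
      ext i j
      fin_cases i <;> fin_cases j <;> simp
  · rintro (rfl | rfl)
    · exact ⟨1, by simp, by simp⟩
    · exact ⟨-1, by simp, by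
      ext i j
      fin_cases i <;> fin_cases j <;> simp⟩

theorem toPSL_neg (A : SL(2, ℝ)) : toPSL (-A) = toPSL A := by
  rw [← neg_one_mul, map_mul, toPSL_eq_one_iff.2 (Or.inr rfl), one_mul]

theorem isFuchsian_affineGroup (H : Good n) :
    IsFuchsian ((quadSurface (tableV n)).affineGroup.map toPSL) := by
  obtain ⟨ε, hε, h⟩ := eq_one_of_near_one H
  -- The sign condition on the first entry keeps -1 out of the neighbourhood, so that its only
  -- element from the affine group is 1.
  set N : Set SL(2, ℝ) := {A | |A 1 0| < ε ∧ |A 0 1| < ε ∧ 0 < A 0 0} with hN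
  have hNo : IsOpen N := by
    refine IsOpen.and (isOpen_lt ?_ continuous_const)
      (IsOpen.and (isOpen_lt ?_ continuous_const) (isOpen_lt continuous_const ?_)) <;>
    fun_prop
  have hUo : IsOpen (toPSL '' N) := QuotientGroup.isOpenMap_coe _ hNo
  refine discreteTopology_of_isOpen_singleton_one ?_
  convert hUo.preimage (continuous_subtype_val (p := (· ∈ (quadSurface (tableV n)).affineGroup.map toPSL)))
    using 1
  ext ⟨x, B, hB, rfl⟩
  simp only [Set.mem_singleton_iff, Set.mem_preimage, Set.mem_image]
  constructor
  · intro hx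
    refine ⟨1, ⟨by simpa using hε, by simpa using hε, by simp⟩, ?_⟩
    rw [map_one]
    exact (congrArg Subtype.val hx).symm
  · rintro ⟨A, hA, hAB⟩
    have hA' : A ∈ (quadSurface (tableV n)).affineGroup := by
      have h1 : toPSL (A * B⁻¹) = 1 := by rw [map_mul, map_inv, hAB, mul_inv_cancel]
      rcases toPSL_eq_one_iff.1 h1 with h2 | h2
      · rw [mul_inv_eq_one] at h2
        rwa [h2]
      · rw [mul_inv_eq_iff_eq_mul] at h2
        rw [h2]
        exact mul_mem (neg_one_mem H) hB
    rw [h A hA' hA.1 hA.2.1 hA.2.2, map_one] at hAB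
    exact Subtype.ext hAB.symm

/-! ### The triangle group -/

theorem closure_le_map_affineGroup (H : Good n) :
    Subgroup.closure {toPSL (matR n), toPSL (matT n)} ≤
      (quadSurface (tableV n)).affineGroup.map toPSL := by
  rw [Subgroup.closure_le]
  rintro x (rfl | rfl)
  · exact ⟨_, matR_mem H, rfl⟩
  · exact ⟨_, matT_mem H, rfl⟩

theorem isTriangleGroup_closure (H : Good n) :
    IsTriangleGroup 5 n (Subgroup.closure {toPSL (matR n), toPSL (matT n)}) := by
  -- R⁻¹T has trace 2 cos(π/n) - 2(cos(π/n) + cos(π/5)) = -2 cos(π/5). The minus sign in the first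
  -- generator makes its trace positive and the product equal to -1.
  refine ⟨?_, -((matR n)⁻¹ * matT n)⁻¹, (matR n)⁻¹, matT n, ?_, ?_, ?_, ?_, ?_⟩
  · have h := isFuchsian_affineGroup H
    exact DiscreteTopology.of_subset (s := ((quadSurface (tableV n)).affineGroup.map toPSL : Set PSL2R))
      h (closure_le_map_affineGroup H)
  · rw [mul_assoc, neg_mul, inv_mul_cancel]
  · have hs : Real.sin (Real.pi / n) ≠ 0 := by
      have := H.sin_two_pos
      rw [H.two_gam] at this
      exact this.ne'
    rw [Matrix.SpecialLinearGroup.coe_neg, Matrix.SpecialLinearGroup.coe_inv,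
      Matrix.SpecialLinearGroup.coe_mul, coe_matR_inv, matT, Matrix.mul_fin_two,
      Matrix.adjugate_fin_two_of, Matrix.trace_neg, Matrix.trace_fin_two_of]
    push_cast
    field_simp
    ring
  · rw [coe_matR_inv, Matrix.trace_fin_two_of]
    ring
  · simp [matT, Matrix.trace_fin_two]
    norm_num
  · rw [toPSL_neg, map_inv, map_mul, map_inv]
    apply le_antisymm
    · rw [Subgroup.closure_le]
      have hr : toPSL (matR n) ∈ Subgroup.closure {toPSL (matR n), toPSL (matT n)} :=
        Subgroup.subset_closure (by simp)
      have ht : toPSL (matT n) ∈ Subgroup.closure {toPSL (matR n), toPSL (matT n)} :=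
        Subgroup.subset_closure (by simp)
      rintro x (rfl | rfl | rfl)
      · exact inv_mem (mul_mem (inv_mem hr) ht)
      · exact inv_mem hr
      · exact ht
    · rw [Subgroup.closure_le]
      rintro x (rfl | rfl)
      · rw [SetLike.mem_coe, ← inv_mem_iff]
        exact Subgroup.subset_closure (by simp)
      · exact Subgroup.subset_closure (by simp)

/-! ### The affine group is a lattice -/

theorem im_specialLinearGroup_smul (A : SL(2, ℝ)) (z : ℍ) :
    (A • z).im = z.im / ((A 1 0 * z.re + A 1 1) ^ 2 + (A 1 0 * z.im) ^ 2) := by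
  have hdet : A 0 0 * A 1 1 - A 0 1 * A 1 0 = 1 := by
    have := A.2
    rwa [Matrix.det_fin_two] at this
  rw [← UpperHalfPlane.coe_im, UpperHalfPlane.coe_specialLinearGroup_apply, Complex.div_im]
  simp [Complex.normSq_apply]
  rw [← sub_div]
  congr 1
  · linear_combination z.im * hdet
  · ring

/-- Every point is translated into the strip of width `shear n` by a power of the twist. -/
theorem exists_twMat_smul_strip (H : Good n) (z : ℍ) :
    ∃ k : ℤ, (twMat n k • z).im = z.im ∧ |(twMat n k • z).re| ≤ shear n / 2 := by
  have hsh := shear_pos H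
  refine ⟨-round (z.re / shear n), ?_, ?_⟩
  · rw [im_specialLinearGroup_smul]
    simp [twMat]
  · have h : (twMat n (-round (z.re / shear n)) • z).re =
        shear n * (z.re / shear n - round (z.re / shear n)) := by
      rw [← UpperHalfPlane.coe_re, UpperHalfPlane.coe_specialLinearGroup_apply]
      simp [twMat]
      field_simp
      ring
    rw [h, abs_mul, abs_of_pos hsh]
    have := mul_le_mul_of_nonneg_left (abs_sub_round (z.re / shear n)) hsh.le
    linarith

/-- After reduction to the strip by T, the point lies within horizontal distance c/s of the center
of the isometric circle of R or R⁻¹. For Im z ≤ 1/2 the denominator in the transformation of the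
imaginary part is then at most c² + s²/4 < 1. -/
theorem exists_im_increase (H : Good n) : ∃ κ : ℝ, 0 < κ ∧ κ < 1 ∧ ∀ z : ℍ, z.im ≤ 1 / 2 →
    ∃ A ∈ (quadSurface (tableV n)).affineGroup, z.im ≤ κ * (A • z).im := by
  set c := Real.cos (Real.pi / n) with hc
  set s := Real.sin (Real.pi / n) with hs
  have hs0 : 0 < s := by
    have := H.sin_two_pos
    rwa [H.two_gam] at this
  have hc0 : 0 < c := by
    have := H.cos_two_pos
    rwa [H.two_gam] at this
  have h5 : c5 < c := by
    have := c5_lt_cos H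
    rwa [H.two_gam] at this
  have h5' := half_lt_c5
  have hsc : s ^ 2 + c ^ 2 = 1 := Real.sin_sq_add_cos_sq _
  have hτ : s * (shear n / 2) = c + c5 := by
    rw [shear, ← hc, ← hs, c5]
    field_simp
  refine ⟨c ^ 2 + s ^ 2 / 4, by positivity, by nlinarith, fun z hz => ?_⟩
  have hz0 := z.im_pos
  have main : ∀ B ∈ (quadSurface (tableV n)).affineGroup, ∀ w : ℍ, w.im = z.im →
      |B 1 0| = s → (B 1 0 * w.re + B 1 1) ^ 2 ≤ c ^ 2 →
      z.im ≤ (c ^ 2 + s ^ 2 / 4) * (B • w).im := by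
    intro B _ w hw hB1 hB2
    rw [im_specialLinearGroup_smul, hw]
    have h1 : (B 1 0 * z.im) ^ 2 ≤ s ^ 2 / 4 := by
      rw [mul_pow, ← sq_abs (B 1 0), hB1]
      have : z.im ^ 2 ≤ (1 / 2) ^ 2 := by gcongr
      nlinarith [sq_nonneg s]
    have h2 : 0 < (B 1 0 * z.im) ^ 2 := by
      rw [mul_pow, ← sq_abs (B 1 0), hB1]
      positivity
    rw [mul_div_assoc', le_div_iff₀ (by positivity), mul_comm]
    gcongr
  obtain ⟨k, hwim, hwre⟩ := exists_twMat_smul_strip H z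
  set w : ℍ := twMat n k • z
  rcases le_total 0 w.re with h0 | h0
  · refine ⟨(matR n)⁻¹ * twMat n k, mul_mem (inv_mem (matR_mem H)) (twMat_mem H k), ?_⟩
    rw [mul_smul]
    have e10 : (matR n)⁻¹ 1 0 = -s := by rw [coe_matR_inv]; rfl
    have e11 : (matR n)⁻¹ 1 1 = c := by rw [coe_matR_inv]; rfl
    refine main _ (inv_mem (matR_mem H)) w hwim ?_ ?_
    · rw [e10, abs_neg, abs_of_pos hs0]
    -- On this half of the strip c - s·Re w lies between -cos(π/5) and c, by the choice of `shear
    -- n`. Since cos(π/5) < cos(π/n), its square is at most c².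
    · rw [e10, e11]
      rw [abs_of_nonneg h0] at hwre
      have := mul_le_mul_of_nonneg_left hwre hs0.le
      apply sq_le_sq'
      · linarith
      · nlinarith
  · refine ⟨matR n * twMat n k, mul_mem (matR_mem H) (twMat_mem H k), ?_⟩
    rw [mul_smul]
    have e10 : (matR n) 1 0 = s := by simp [matR, hs]
    have e11 : (matR n) 1 1 = c := by simp [matR, hc]
    refine main _ (matR_mem H) w hwim ?_ ?_
    · rw [e10, abs_of_pos hs0]
    · rw [e10, e11]
      rw [abs_of_nonpos h0] at hwre
      have := mul_le_mul_of_nonneg_left hwre hs0.le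
      apply sq_le_sq'
      · linarith
      · nlinarith

/-- If the orbit stayed below height 1/2, iterating the increase would produce unbounded imaginary
parts. -/
theorem exists_smul_half_le_im (H : Good n) (z : ℍ) :
    ∃ A ∈ (quadSurface (tableV n)).affineGroup, 1 / 2 ≤ (A • z).im := by
  obtain ⟨κ, h0, h1, h⟩ := exists_im_increase H
  by_contra! hlt
  have key : ∀ m : ℕ, ∃ A ∈ (quadSurface (tableV n)).affineGroup, z.im ≤ κ ^ m * (A • z).im := by
    intro m
    induction m with
    | zero => exact ⟨1, one_mem _, by simp⟩
    | succ m ih =>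
      obtain ⟨A, hA, hAz⟩ := ih
      obtain ⟨B, hB, hBz⟩ := h (A • z) (hlt A hA).le
      refine ⟨B * A, mul_mem hB hA, ?_⟩
      rw [mul_smul, pow_succ, mul_assoc]
      exact hAz.trans (mul_le_mul_of_nonneg_left hBz (by positivity))
  obtain ⟨m, hm⟩ := exists_pow_lt_of_lt_one z.im_pos h1
  obtain ⟨A, hA, hAz⟩ := key m
  have := hlt A hA
  have h3 := (A • z).im_pos
  nlinarith [pow_pos h0 m]

/-- The strip of width `2 w` above height `h`. -/
def cuspStrip (w h : ℝ) : Set ℍ := {z | |z.re| ≤ w ∧ h < z.im}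

theorem measurableSet_cuspStrip (w h : ℝ) : MeasurableSet (cuspStrip w h) := by
  have h1 : MeasurableSet {z : ℍ | |z.re| ≤ w} :=
    measurableSet_le UpperHalfPlane.continuous_re.abs.measurable measurable_const
  have h2 : MeasurableSet {z : ℍ | h < z.im} :=
    measurableSet_lt measurable_const UpperHalfPlane.continuous_im.measurable
  exact h1.inter h2

/-- The hyperbolic area element is dx dy / y², whose integral over y > h converges. -/
theorem volume_cuspStrip_lt_top (w : ℝ) {h : ℝ} (hh : 0 < h) : volume (cuspStrip w h) < ⊤ := by
  have himg : ((↑) : ℍ → ℂ) '' cuspStrip w h =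
      Complex.measurableEquivRealProd ⁻¹' (Set.Icc (-w) w ×ˢ Set.Ioi h) := by
    ext z
    constructor
    · rintro ⟨x, ⟨h1, h2⟩, rfl⟩
      exact ⟨abs_le.1 h1, h2⟩
    · rintro ⟨h1, h2⟩
      exact ⟨⟨z, hh.trans h2⟩, ⟨abs_le.2 h1, h2⟩, rfl⟩
  rw [UpperHalfPlane.volume_eq_lintegral, himg]
  have hm : MeasurableSet (Set.Icc (-w) w ×ˢ Set.Ioi h) := measurableSet_Icc.prod measurableSet_Ioi
  have h1 := Complex.volume_preserving_equiv_real_prod.setLIntegral_comp_preimage hm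
    (f := fun p : ℝ × ℝ => (((1 / ‖p.2‖₊) ^ 2 : NNReal) : ENNReal)) (by fun_prop)
  have h2 : ∫⁻ p in Set.Icc (-w) w ×ˢ Set.Ioi h,
      (((1 / ‖p.2‖₊) ^ 2 : NNReal) : ENNReal) ∂(volume : Measure (ℝ × ℝ)) =
      volume (Set.Icc (-w) w) * ∫⁻ y in Set.Ioi h, (((1 / ‖y‖₊) ^ 2 : NNReal) : ENNReal) := by
    have := lintegral_prod_mul (μ := volume.restrict (Set.Icc (-w) w))
      (ν := volume.restrict (Set.Ioi h)) (f := fun _ : ℝ => (1 : ENNReal))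
      (g := fun y : ℝ => (((1 / ‖y‖₊) ^ 2 : NNReal) : ENNReal)) (by fun_prop) (by fun_prop)
    rw [Measure.prod_restrict, ← Measure.volume_eq_prod] at this
    simpa using this
  have h3 : ∫⁻ y in Set.Ioi h, (((1 / ‖y‖₊) ^ 2 : NNReal) : ENNReal) < ⊤ := by
    have hi := integrableOn_Ioi_rpow_of_lt (a := -2) (by norm_num) hh
    refine lt_of_eq_of_lt (setLIntegral_congr_fun measurableSet_Ioi fun y hy => ?_) hi.2
    have hy0 : 0 < y := hh.trans hy
    change _ = ((‖y ^ (-2 : ℝ)‖₊ : NNReal) : ENNReal)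
    congr 1
    apply NNReal.eq
    rw [Real.rpow_neg hy0.le]
    simp
  exact h1.trans_lt (h2.trans_lt (ENNReal.mul_lt_top (by simp) h3))

theorem isVeech_quadSurface (H : Good n) : (quadSurface (tableV n)).IsVeech := by
  -- The height 1/4 leaves room below 1/2, since the strip is open at its lower edge.
  refine ⟨isFuchsian_affineGroup H, cuspStrip (shear n / 2) (1 / 4), measurableSet_cuspStrip _ _,
    volume_cuspStrip_lt_top _ (by norm_num), fun z => ?_⟩
  obtain ⟨A, hA, hAz⟩ := exists_smul_half_le_im H z
  obtain ⟨k, h1, h2⟩ := exists_twMat_smul_strip H (A • z)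
  refine ⟨twMat n k * A, ⟨_, mul_mem (twMat_mem H k) hA, rfl⟩, ?_⟩
  rw [mul_smul]
  refine ⟨h2, ?_⟩
  rw [h1]
  linarith

end

end BilliardVeech

end

open BilliardVeech in
theorem theorem6p1 (n : ℕ) (hn : 7 ≤ n) (hodd : Odd n) (h5 : ¬ 5 ∣ n) :
    (∃! V : Fin 4 → ℂ, IsTable n V) ∧
    (∀ V : Fin 4 → ℂ, IsTable n V →
      matR n ∈ (quadSurface V).affineGroup ∧
      matT n ∈ (quadSurface V).affineGroup ∧
      (quadSurface V).IsVeech) ∧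
    IsTriangleGroup 5 n (Subgroup.closure {toPSL (matR n), toPSL (matT n)}) := by
  have H : Good n := ⟨hn, hodd⟩
  refine ⟨existsUnique_isTable H, fun V hV => ?_, ?_⟩
  · obtain rfl := hV.eq_tableV H
    exact ⟨matR_mem H, matT_mem H, isVeech_quadSurface H⟩
  · exact isTriangleGroup_closure H
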